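/- **Setting.** Let $\mathcal I$ be a finite index set with $|\mathcal I|\ge 2$. For $i\in\mathcal I$ let $S_i=T_i\circ L_i+t_i:\mathbb R^2\to\mathbb R^2$, where $T_i=\operatorname{diag}(c_i,d_i)$ with $c_i,d_i\in(0,1)$, $L_i$ is a linear isometry of the Euclidean plane with $L_i([-1,1]^2)=[-1,1]^2$, and $t_i\in\mathbb R^2$; let $(p_i)_{i\in\mathcal I}$ be a probability vector with all $p_i\in(0,1)$. A box-like self-affine measure is the unique Borel probability measure $\mu$ on $\mathbb R^2$ with $\mu=\sum_i p_i\,\mu\circ S_i^{-1}$. The rectangular open set condition (ROSC) holds if there is a non-empty open rectangle $R=(a,b)\times(c,d)$ such that the sets $S_i(R)$, $i\in\mathcal I$, are pairwise disjoint subsets of $R$. For a finite Borel measure $\nu$ on a Euclidean space and $q\in\mathbb R$, $B(x,\delta)$ denoting the closed ball, let $$I_\delta^q(\nu)=\int_{\operatorname{supp}\nu}\nu(B(x,\delta))^{q-1}\,d\nu(x),\qquad M^q_\delta(\nu)=\sup\sum_j\nu(B(x_j,\delta))^q,\qquad N^q_\delta(\nu)=\inf\sum_j\nu(B(x_j,\delta))^q,$$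 the supremum being over families of pairwise disjoint balls $B(x_j,\delta)$ with centres in $\operatorname{supp}\nu$, and the infimum over covers of $\operatorname{supp}\nu$ by balls $B(x_j,\delta)$ with centres in $\operatorname{supp}\nu$. The lower and upper $L^q$-spectra $\underline\tau_\nu(q),\overline\tau_\nu(q)$ are the lower and upper limits as $\delta\to0^+$ of $\log I^q_\delta(\nu)/(-\log\delta)$; the lower and upper packing multifractal box dimensions $\underline T_{P,\nu}(q),\overline T_{P,\nu}(q)$ are those of $\log M^q_\delta(\nu)/(-\log\delta)$; the upper covering multifractal box dimension $\overline T_{C,\nu}(q)$ is the upper limit of $\log N^q_\delta(\nu)/(-\log\delta)$. Write $\tau_\nu(q)$, $T_{P,\nu}(q)$ for the common value when the lower and upper ones agree. For a word $w=(i_1,\dots,i_k)\in\mathcal I^k$, $k\ge1$, put $S_w=S_{i_1}\circ\cdots\circ S_{i_k}$, $p(w)=p_{i_1}\cdots p_{i_k}$; let $\alpha_1(w)\ge\alpha_2(w)$ be the singular values of the linear part of $S_w$, and $b(w),h(w)$ the lengths of the base and the height of the rectangle $S_w([0,1]^2)$. With $\pi_1(x,y)=x$ and $\pi_2(x,y)=y$,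 let $\pi_w=\pi_1$ if either $S_w$ maps horizontal lines to horizontal lines and $b(w)\ge h(w)$, or $S_w$ maps horizontal lines to vertical lines and $b(w)<h(w)$; otherwise let $\pi_w=\pi_2$. For $s\in\mathbb R$ and $q\ge0$ let $\tau_w(q)=\tau_{\pi_w\mu}(q)$, where $\pi_w\mu=\mu\circ\pi_w^{-1}$, and $$\psi^{s,q}(w)=p(w)^q\,\alpha_1(w)^{\tau_w(q)}\,\alpha_2(w)^{s-\tau_w(q)},\qquad \Psi^{s,q}_k=\sum_{w\in\mathcal I^k}\psi^{s,q}(w),\qquad P(s,q)=\lim_{k\to\infty}\big(\Psi_k^{s,q}\big)^{1/k}.$$ **Theorem 2.6.** Let $\mu$ be a box-like self-affine measure. For every $q\ge0$ the $L^q$-spectra $\tau_{\pi_1\mu}(q)$ and $\tau_{\pi_2\mu}(q)$ exist and are finite, the limit $P(s,q)$ exists and is finite for every $s\in\mathbb R$, and there is a unique $\gamma(q)\in\mathbb R$ with $P(\gamma(q),q)=1$. Moreover: 1. for $q\in[0,1]$, $\ \overline T_{C,\mu}(q)=\overline T_{P,\mu}(q)=\overline\tau_\mu(q)\le\gamma(q)$;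 2. for $q\ge1$, $\ \gamma(q)\le\underline T_{P,\mu}(q)=\underline\tau_\mu(q)$; 3. if in addition the ROSC holds, then for all $q\ge0$ both $T_{P,\mu}(q)$ and $\tau_\mu(q)$ exist and $T_{P,\mu}(q)=\tau_\mu(q)=\gamma(q)$. -/

import Mathlib

open MeasureTheory Filter Topology Set
open scoped ENNReal

noncomputable section

/-! ### `L^q`-spectra and multifractal box dimensions

The spectra are extended-real valued, so that every logarithm, quotient, `liminf` and `limsup`
below is the genuine one. -/

section Spectra

variable {X : Type*} [PseudoMetricSpace X] [MeasurableSpace X]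

/-- `∫_{supp μ} μ(B(x,δ))^{q-1} dμ(x)`. -/
def lqIntegral (μ : Measure X) (q δ : ℝ) : ℝ≥0∞ :=
  ∫⁻ x in μ.support, μ (Metric.closedBall x δ) ^ (q - 1) ∂μ

/-- The supremum of `∑ᵢ μ(Uᵢ)^q` over all centred packings `{Uᵢ}` of `supp μ` by balls of radius
`δ` (pairwise disjoint balls with centres in `supp μ`); a packing is given by its set `A` of
centres. -/
def packingSum (μ : Measure X) (q δ : ℝ) : ℝ≥0∞ :=
  ⨆ (A : Set X) (_ : A ⊆ μ.support ∧ A.PairwiseDisjoint (fun x => Metric.closedBall x δ)),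
    ∑' x : A, μ (Metric.closedBall (x : X) δ) ^ q

/-- The infimum of `∑ᵢ μ(Uᵢ)^q` over all centred covers `{Uᵢ}` of `supp μ` by balls of radius
`δ`; a cover is given by its set `A` of centres. -/
def coveringSum (μ : Measure X) (q δ : ℝ) : ℝ≥0∞ :=
  ⨅ (A : Set X) (_ : A ⊆ μ.support ∧ μ.support ⊆ ⋃ x ∈ A, Metric.closedBall x δ),
    ∑' x : A, μ (Metric.closedBall (x : X) δ) ^ q

/-- `liminf_{δ → 0⁺} log f(δ) / (-log δ)`. -/
def lowerExponent (f : ℝ → ℝ≥0∞) : EReal :=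
  liminf (fun δ : ℝ => ENNReal.log (f δ) / ((-Real.log δ : ℝ) : EReal)) (𝓝[>] 0)

/-- `limsup_{δ → 0⁺} log f(δ) / (-log δ)`. -/
def upperExponent (f : ℝ → ℝ≥0∞) : EReal :=
  limsup (fun δ : ℝ => ENNReal.log (f δ) / ((-Real.log δ : ℝ) : EReal)) (𝓝[>] 0)

/-- The lower `L^q`-spectrum. -/
def lowerLqSpectrum (μ : Measure X) (q : ℝ) : EReal := lowerExponent (lqIntegral μ q)

/-- The upper `L^q`-spectrum. -/
def upperLqSpectrum (μ : Measure X) (q : ℝ) : EReal := upperExponent (lqIntegral μ q)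

/-- The `L^q`-spectrum as a real number. It is meaningful where the lower and the upper spectrum
agree and are finite. -/
def lqSpectrum (μ : Measure X) (q : ℝ) : ℝ := (lowerLqSpectrum μ q).toReal

/-- The lower packing multifractal box dimension. -/
def lowerPackingDim (μ : Measure X) (q : ℝ) : EReal := lowerExponent (packingSum μ q)

/-- The upper packing multifractal box dimension. -/
def upperPackingDim (μ : Measure X) (q : ℝ) : EReal := upperExponent (packingSum μ q)

/-- The upper covering multifractal box dimension. -/
def upperCoveringDim (μ : Measure X) (q : ℝ) : EReal := upperExponent (coveringSum μ q)

end Spectra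

/-! ### Box-like self-affine systems -/

/-- The Euclidean plane. -/
abbrev Plane : Type := EuclideanSpace ℝ (Fin 2)

/-- The coordinate projections: `coordProj 0` is `π₁` and `coordProj 1` is `π₂`. -/
def coordProj (j : Fin 2) (x : Plane) : ℝ := x j

/-- An iterated function system of maps `Sᵢ = Tᵢ ∘ Lᵢ + tᵢ` with `Tᵢ = diag(cᵢ, dᵢ)`,
`cᵢ, dᵢ ∈ (0,1)`, `Lᵢ` a linear isometry preserving the square `[-1,1]²` and `tᵢ` a vector,
together with a probability vector `(pᵢ)` with entries in `(0,1)`; there are at least two maps. -/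
structure BoxLikeIFS (ι : Type*) [Fintype ι] where
  c : ι → ℝ
  d : ι → ℝ
  L : ι → (Plane ≃ₗᵢ[ℝ] Plane)
  t : ι → Plane
  p : ι → ℝ
  two_le_card : 2 ≤ Fintype.card ι
  c_mem : ∀ i, c i ∈ Ioo (0 : ℝ) 1
  d_mem : ∀ i, d i ∈ Ioo (0 : ℝ) 1
  L_square : ∀ i, L i '' {x : Plane | ∀ j, x j ∈ Icc (-1 : ℝ) 1} =
    {x : Plane | ∀ j, x j ∈ Icc (-1 : ℝ) 1}
  p_mem : ∀ i, p i ∈ Ioo (0 : ℝ) 1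
  p_sum : ∑ i, p i = 1

namespace BoxLikeIFS

variable {ι : Type*} [Fintype ι] (Φ : BoxLikeIFS ι)

/-- The linear part `Tᵢ ∘ Lᵢ` of `Sᵢ`. -/
def lin (i : ι) : Plane →ₗ[ℝ] Plane :=
  Matrix.toEuclideanLin !![Φ.c i, 0; 0, Φ.d i] ∘ₗ (Φ.L i).toLinearEquiv.toLinearMap

/-- The map `Sᵢ = Tᵢ ∘ Lᵢ + tᵢ`. -/
def S (i : ι) (x : Plane) : Plane := Φ.lin i x + Φ.t i

/-- The self-affine measure: the (unique) Borel probability measure with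
`μ = ∑ᵢ pᵢ · (μ ∘ Sᵢ⁻¹)`. -/
structure IsSelfAffineMeasure (μ : Measure Plane) : Prop where
  isProbabilityMeasure : IsProbabilityMeasure μ
  eq_sum : μ = ∑ i, ENNReal.ofReal (Φ.p i) • μ.map (Φ.S i)

/-- The rectangular open set condition. -/
def ROSC : Prop :=
  ∃ a b c d : ℝ, a < b ∧ c < d ∧
    (∀ i, Φ.S i '' {x : Plane | x 0 ∈ Ioo a b ∧ x 1 ∈ Ioo c d} ⊆
      {x : Plane | x 0 ∈ Ioo a b ∧ x 1 ∈ Ioo c d}) ∧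
    Pairwise fun i j =>
      Disjoint (Φ.S i '' {x : Plane | x 0 ∈ Ioo a b ∧ x 1 ∈ Ioo c d})
        (Φ.S j '' {x : Plane | x 0 ∈ Ioo a b ∧ x 1 ∈ Ioo c d})

/-- `S_w = S_{i₁} ∘ ⋯ ∘ S_{i_k}` for a word `w = (i₁, …, i_k)`. -/
def wordMap : List ι → Plane → Plane
  | [] => id
  | i :: w => Φ.S i ∘ wordMap w

/-- The linear part of `S_w`. -/
def wordLin : List ι → (Plane →ₗ[ℝ] Plane)
  | [] => LinearMap.id
  | i :: w => Φ.lin i ∘ₗ wordLin w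

/-- `wordLin` is the linear part of `wordMap`. -/
theorem wordMap_sub (w : List ι) (x y : Plane) :
    Φ.wordMap w x - Φ.wordMap w y = Φ.wordLin w (x - y) := by
  induction w with
  | nil => rfl
  | cons i w ih =>
    simp only [wordMap, wordLin, Function.comp_apply, S, LinearMap.comp_apply, ← ih]
    rw [map_sub]
    abel

/-- `p(w) = p_{i₁} ⋯ p_{i_k}`. -/
def wordProb (w : List ι) : ℝ := (w.map Φ.p).prod

/-- The larger singular value `α₁(w)` of the linear part of `S_w`. -/
def alpha₁ (w : List ι) : ℝ := (Φ.wordLin w).singularValues 0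

/-- The smaller singular value `α₂(w)` of the linear part of `S_w`. -/
def alpha₂ (w : List ι) : ℝ := (Φ.wordLin w).singularValues 1

/-- The length of the `j`-th coordinate projection of the rectangle `S_w([0,1]²)`: its base for
`j = 0` and its height for `j = 1`. -/
def side (j : Fin 2) (w : List ι) : ℝ :=
  Metric.diam (coordProj j '' (Φ.wordMap w '' {x : Plane | ∀ l, x l ∈ Icc (0 : ℝ) 1}))

/-- `S_w` maps horizontal lines to horizontal lines. -/
def IsTypeA (w : List ι) : Prop :=
  ∀ a : ℝ, ∃ b : ℝ, Φ.wordMap w '' {x : Plane | x 1 = a} = {x : Plane | x 1 = b}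

/-- `S_w` maps horizontal lines to vertical lines. -/
def IsTypeB (w : List ι) : Prop :=
  ∀ a : ℝ, ∃ b : ℝ, Φ.wordMap w '' {x : Plane | x 1 = a} = {x : Plane | x 0 = b}

open Classical in
/-- The index of the projection `π_w`. Every word is of exactly one of the types A and B, so the
value is `π₂` if `w` is of type A with base `<` height, or of type B with base `≥` height. -/
def projIndex (w : List ι) : Fin 2 :=
  if (Φ.IsTypeA w ∧ Φ.side 1 w ≤ Φ.side 0 w) ∨ (Φ.IsTypeB w ∧ Φ.side 0 w < Φ.side 1 w)
  then 0 else 1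

/-- `τ_w(q)`, the `L^q`-spectrum of the projected measure `π_w μ`. -/
def wordTau (μ : Measure Plane) (w : List ι) (q : ℝ) : ℝ :=
  lqSpectrum (μ.map (coordProj (Φ.projIndex w))) q

/-- The `q`-modified singular value function
`ψ^{s,q}(w) = p(w)^q α₁(w)^{τ_w(q)} α₂(w)^{s - τ_w(q)}`. -/
def psi (μ : Measure Plane) (s q : ℝ) (w : List ι) : ℝ :=
  Φ.wordProb w ^ q * Φ.alpha₁ w ^ Φ.wordTau μ w q * Φ.alpha₂ w ^ (s - Φ.wordTau μ w q)

/-- `Ψ_k^{s,q}`, the sum of `ψ^{s,q}` over the words of length `k`. -/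
def Psi (μ : Measure Plane) (k : ℕ) (s q : ℝ) : ℝ :=
  ∑ w : Fin k → ι, Φ.psi μ s q (List.ofFn w)

/-- `P(s,q) = lim_{k → ∞} (Ψ_k^{s,q})^{1/k}`. -/
def P (μ : Measure Plane) (s q : ℝ) : ℝ :=
  limUnder atTop fun k : ℕ => Φ.Psi μ k s q ^ (1 / (k : ℝ))

/-- The moment scaling function `γ`, defined by `P(γ(q),q) = 1`. -/
def gamma (μ : Measure Plane) (q : ℝ) : ℝ :=
  Classical.epsilon fun s : ℝ => Φ.P μ s q = 1

end BoxLikeIFS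

end

/-! All the quantities in the theorem are compared with one: the sum of the `q`-th powers of the
masses of the cells of a grid of mesh `δ` (`Grid.gridSum`). A ball of radius `δ` meets boundedly
many cells of comparable mesh, and conversely, so packing sums, covering sums (for `q ≤ 1`) and
`L^q`-integrals agree with grid sums up to constants. The one exception is the lower bound of the
integral for `q ≤ 1`, where a ball may be much heavier than its cell. There a radius at which the
mass at most doubles is found among many concentric ones, using the polynomial lower bound for
masses of balls, and the loss is `δ ^ (-ε)`. The relation `SubExpLE` tolerates such losses, and it
orders the upper and lower exponents.

Projections. Every `S_w` permutes the coordinates and rescales them, so the projection of the piece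
of `μ` carried by `S_w` is an affine copy of a projection of `μ`. Cutting the tree of words where
the contraction in one direction is about `ρ` and applying Jensen's inequality in each interval of
length `ρ` makes the grid sums of a projection supermultiplicative in the scale for `q ≤ 1`
(`exists_coordSum_mul_le`) and submultiplicative for `q ≥ 1` (`exists_coordSum_le_mul`). Fekete's
lemma then gives the exponents `τ 0`, `τ 1`.

Pressure. Let `coordPsi` be the expression `ψ` with the longer side replaced by the side in a fixed
direction. It is exactly multiplicative along words, and `ψ` is the larger of its two values if `s ≤
τ 0 + τ 1` and the smaller one otherwise. Hence `ψ` is sub- or supermultiplicative, the pressure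
exists and is strictly decreasing in `s`, and over any stopping family the sum of `ψ` is bounded
above for `s > γ` and bounded away from `0` for `s < γ`.

The measure itself. Cut the tree where the height `α₂(w)` is about `δ`. At scale `δ` the piece `S_w`
is indistinguishable from `π_w μ` at scale `δ / α₁(w)`, so its contribution is about `p(w)^q (δ /
α₁(w))^(-τ_w)`, which is comparable to `δ^(-s) ψ^{s,q}(w)`. Summed over the cut this gives `δ^(-γ)`
up to subexponential factors (`pieceSum`). In each cell the grid sum takes the power of a sum over
pieces where `pieceSum` takes the sum of the powers. This gives one inequality for `q ≤ 1` and the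
reverse one for `q ≥ 1`. Under the ROSC a cell is charged by boundedly many pieces
(`exists_card_le`), and the two sums are comparable for every `q ≥ 0`. -/

noncomputable section

/-! ### Powers and power sums -/

/-- The power `x ^ q` with the convention that it vanishes at `x = 0`, also for `q = 0`. -/
def posPow (q : ℝ) (x : ℝ≥0∞) : ℝ≥0∞ := if x = 0 then 0 else x ^ q

@[simp] theorem posPow_zero (q : ℝ) : posPow q 0 = 0 := by simp [posPow]

theorem posPow_of_ne_zero {q : ℝ} {x : ℝ≥0∞} (hx : x ≠ 0) : posPow q x = x ^ q := by simp [posPow, hx]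

theorem posPow_of_pos {q : ℝ} (hq : 0 < q) (x : ℝ≥0∞) : posPow q x = x ^ q := by
  by_cases hx : x = 0
  · simp [hx, ENNReal.zero_rpow_of_pos hq]
  · exact posPow_of_ne_zero hx

theorem posPow_le_rpow (q : ℝ) (x : ℝ≥0∞) : posPow q x ≤ x ^ q := by
  unfold posPow; split_ifs <;> simp

theorem posPow_mono {q : ℝ} (hq : 0 ≤ q) {x y : ℝ≥0∞} (h : x ≤ y) : posPow q x ≤ posPow q y := by
  by_cases hx : x = 0
  · simp [hx]
  · have hy : y ≠ 0 := fun h0 => hx (le_antisymm (h0 ▸ h) bot_le)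
    rw [posPow_of_ne_zero hx, posPow_of_ne_zero hy]
    exact ENNReal.rpow_le_rpow h hq

theorem posPow_mul {q : ℝ} (hq : 0 ≤ q) (x y : ℝ≥0∞) : posPow q (x * y) = posPow q x * posPow q y := by
  by_cases hx : x = 0
  · simp [hx]
  by_cases hy : y = 0
  · simp [hy]
  rw [posPow_of_ne_zero hx, posPow_of_ne_zero hy, posPow_of_ne_zero (mul_ne_zero hx hy),
    ENNReal.mul_rpow_of_nonneg _ _ hq]

theorem posPow_ne_zero {q : ℝ} (hq : 0 ≤ q) {x : ℝ≥0∞} (hx : x ≠ 0) : posPow q x ≠ 0 := by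
  rw [posPow_of_ne_zero hx]
  intro h
  rcases ENNReal.rpow_eq_zero_iff.1 h with h | h
  · exact hx h.1
  · linarith [h.2]

theorem posPow_ne_top {q : ℝ} (hq : 0 ≤ q) {x : ℝ≥0∞} (hx : x ≠ ∞) : posPow q x ≠ ∞ :=
  ne_top_of_le_ne_top (ENNReal.rpow_ne_top_of_nonneg hq hx) (posPow_le_rpow q x)

theorem posPow_sub_one_mul {q : ℝ} {x : ℝ≥0∞} (hx : x ≠ 0) (hx' : x ≠ ∞) :
    x ^ (q - 1) * x = posPow q x := by
  nth_rewrite 2 [← ENNReal.rpow_one x]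
  rw [← ENNReal.rpow_add _ _ hx hx', posPow_of_ne_zero hx]
  congr 1; ring

theorem rpow_le_rpow_of_exponent_nonpos {z : ℝ} (hz : z ≤ 0) {x y : ℝ≥0∞} (h : x ≤ y) :
    y ^ z ≤ x ^ z := by
  rw [← neg_neg z, ENNReal.rpow_neg, ENNReal.rpow_neg x]
  exact ENNReal.inv_le_inv.2 (ENNReal.rpow_le_rpow h (by linarith))

/-- For a finite total `T`, each `a i ≤ T` gives `a i * T ^ (q - 1) ≤ a i ^ q`, and the left sides
add up to `T ^ q`. Infinite families are allowed because covers by balls need not be finite. -/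
theorem posPow_tsum_le {ι : Type*} {q : ℝ} (hq : 0 ≤ q) (hq1 : q ≤ 1) (a : ι → ℝ≥0∞) :
    posPow q (∑' i, a i) ≤ ∑' i, posPow q (a i) := by
  set T := ∑' i, a i with hT
  by_cases h0 : T = 0
  · simp [h0]
  by_cases htop : T = ∞
  · by_cases hq0 : q = 0
    · subst hq0
      have : ∃ i, a i ≠ 0 := by
        by_contra! h
        exact h0 (by simp [hT, h])
      obtain ⟨i, hi⟩ := this
      calc posPow 0 T = 1 := by rw [posPow_of_ne_zero h0, ENNReal.rpow_zero]
        _ = posPow 0 (a i) := by rw [posPow_of_ne_zero hi, ENNReal.rpow_zero]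
        _ ≤ _ := ENNReal.le_tsum i
    · have hqp : 0 < q := lt_of_le_of_ne hq (Ne.symm hq0)
      simp only [posPow_of_pos hqp]
      by_contra! hlt
      have hfin : ∑' i, a i ^ q ≠ ∞ := ne_top_of_lt hlt
      -- A finite sum of `q`-th powers bounds every term, so `a i` is at most a fixed multiple of `a
      -- i ^ q` and the total is finite after all.
      have hev : ∑' i, a i ≠ ∞ := by
        have hle : ∀ i, a i ≤ (∑' i, a i ^ q) ^ (1 / q - 1) * a i ^ q := by
          intro i
          have h1 : a i ^ q ≤ ∑' i, a i ^ q := ENNReal.le_tsum i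
          have hne : 0 ≤ 1 / q - 1 := by
            rw [sub_nonneg, le_div_iff₀ hqp]; linarith
          by_cases hai : a i = 0
          · simp [hai]
          have haitop : a i ≠ ∞ := by
            intro h
            rw [h, ENNReal.top_rpow_of_pos hqp] at h1
            exact hfin (top_le_iff.1 h1)
          calc a i = (a i ^ q) ^ (1 / q - 1) * a i ^ q := by
                rw [← ENNReal.rpow_mul, ← ENNReal.rpow_add _ _ hai haitop]
                have : q * (1 / q - 1) + q = 1 := by field_simp; ring
                rw [this, ENNReal.rpow_one]
            _ ≤ _ := by gcongr
        refine ne_top_of_le_ne_top ?_ (ENNReal.tsum_le_tsum hle)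
        rw [ENNReal.tsum_mul_left]
        refine ENNReal.mul_ne_top (ENNReal.rpow_ne_top_of_nonneg ?_ hfin) hfin
        rw [sub_nonneg, le_div_iff₀ hqp]; linarith
      exact hev htop
  · have hle : ∀ i, a i * T ^ (q - 1) ≤ posPow q (a i) := by
      intro i
      by_cases hai : a i = 0
      · simp [hai]
      have hiT : a i ≤ T := ENNReal.le_tsum i
      have haitop : a i ≠ ∞ := ne_top_of_le_ne_top htop hiT
      rw [← posPow_sub_one_mul hai haitop, mul_comm]
      gcongr ?_ * _
      exact rpow_le_rpow_of_exponent_nonpos (by linarith) hiT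
    calc posPow q T = T ^ (q - 1) * T := (posPow_sub_one_mul h0 htop).symm
      _ = ∑' i, a i * T ^ (q - 1) := by rw [ENNReal.tsum_mul_right, mul_comm]
      _ ≤ _ := ENNReal.tsum_le_tsum hle

theorem posPow_sum_le {ι : Type*} {q : ℝ} (hq : 0 ≤ q) (hq1 : q ≤ 1) (s : Finset ι)
    (a : ι → ℝ≥0∞) : posPow q (∑ i ∈ s, a i) ≤ ∑ i ∈ s, posPow q (a i) := by
  rw [← Finset.tsum_subtype s a, ← Finset.tsum_subtype s fun i => posPow q (a i)]
  exact posPow_tsum_le hq hq1 _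

theorem sum_posPow_le {ι : Type*} {q : ℝ} (hq1 : 1 ≤ q) (s : Finset ι)
    (a : ι → ℝ≥0∞) : ∑ i ∈ s, posPow q (a i) ≤ posPow q (∑ i ∈ s, a i) := by
  classical
  have hqp : 0 < q := by linarith
  simp only [posPow_of_pos hqp]
  induction s using Finset.induction_on with
  | empty => simp [ENNReal.zero_rpow_of_pos hqp]
  | insert i s hi ih =>
    rw [Finset.sum_insert hi, Finset.sum_insert hi]
    calc _ ≤ a i ^ q + (∑ i ∈ s, a i) ^ q := by gcongr
      _ ≤ _ := ENNReal.add_rpow_le_rpow_add _ _ hq1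

theorem posPow_sum_le_card {ι : Type*} {q : ℝ} (hq : 0 ≤ q) (s : Finset ι)
    (a : ι → ℝ≥0∞) : posPow q (∑ i ∈ s, a i) ≤ (s.card : ℝ≥0∞) ^ q * ∑ i ∈ s, posPow q (a i) := by
  rcases s.eq_empty_or_nonempty with rfl | hs
  · simp
  obtain ⟨j, hj, hmax⟩ := s.exists_max_image a hs
  calc posPow q (∑ i ∈ s, a i) ≤ posPow q (s.card * a j) := by
        refine posPow_mono hq ?_
        rw [← nsmul_eq_mul]
        exact Finset.sum_le_card_nsmul s a _ hmax
    _ = posPow q s.card * posPow q (a j) := posPow_mul hq _ _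
    _ ≤ _ := by
        gcongr
        · exact posPow_le_rpow _ _
        · exact Finset.single_le_sum (f := fun i => posPow q (a i)) (fun _ _ => bot_le) hj

theorem sum_posPow_le_card {ι : Type*} {q : ℝ} (hq : 0 ≤ q) (s : Finset ι)
    (a : ι → ℝ≥0∞) : ∑ i ∈ s, posPow q (a i) ≤ s.card * posPow q (∑ i ∈ s, a i) := by
  rw [← nsmul_eq_mul]
  refine Finset.sum_le_card_nsmul s _ _ fun i hi => posPow_mono hq ?_
  exact Finset.single_le_sum (f := a) (fun _ _ => bot_le) hi

/-- Jensen's inequality for the convex power. -/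
theorem posPow_sum_mul_le {ι : Type*} {q : ℝ} (hq1 : 1 ≤ q) (s : Finset ι) (p x : ι → ℝ≥0∞)
    (hp0 : ∑ i ∈ s, p i ≠ 0) (hp : ∑ i ∈ s, p i ≠ ∞) :
    posPow q (∑ i ∈ s, p i * x i) ≤ (∑ i ∈ s, p i) ^ (q - 1) * ∑ i ∈ s, p i * posPow q (x i) := by
  have hqp : 0 < q := by linarith
  set P := ∑ i ∈ s, p i with hP
  have hw : ∑ i ∈ s, p i * P⁻¹ = 1 := by
    rw [← Finset.sum_mul, ← hP, ENNReal.mul_inv_cancel hp0 hp]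
  have key := ENNReal.rpow_arith_mean_le_arith_mean_rpow s (fun i => p i * P⁻¹) x hw hq1
  have e1 : ∑ i ∈ s, p i * x i = P * ∑ i ∈ s, p i * P⁻¹ * x i := by
    rw [Finset.mul_sum]
    refine Finset.sum_congr rfl fun i _ => ?_
    rw [show P * (p i * P⁻¹ * x i) = (P * P⁻¹) * (p i * x i) by ring,
      ENNReal.mul_inv_cancel hp0 hp, one_mul]
  have e2 : ∑ i ∈ s, p i * P⁻¹ * x i ^ q = P⁻¹ * ∑ i ∈ s, p i * x i ^ q := by
    rw [Finset.mul_sum]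
    exact Finset.sum_congr rfl fun i _ => by ring
  rw [e1, posPow_mul hqp.le, ← posPow_sub_one_mul hp0 hp]
  simp only [posPow_of_pos hqp]
  calc _ ≤ P ^ (q - 1) * P * (P⁻¹ * ∑ i ∈ s, p i * x i ^ q) := by rw [← e2]; gcongr
    _ = P ^ (q - 1) * ((P * P⁻¹) * ∑ i ∈ s, p i * x i ^ q) := by ring
    _ = _ := by rw [ENNReal.mul_inv_cancel hp0 hp, one_mul]

/-- Jensen's inequality for the concave power. -/
theorem le_posPow_sum_mul {ι : Type*} {q : ℝ} (hq : 0 ≤ q) (hq1 : q ≤ 1) (s : Finset ι)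
    (p x : ι → ℝ≥0∞) (hp0 : ∑ i ∈ s, p i ≠ 0) (hp : ∑ i ∈ s, p i ≠ ∞) :
    (∑ i ∈ s, p i) ^ (q - 1) * ∑ i ∈ s, p i * posPow q (x i) ≤ posPow q (∑ i ∈ s, p i * x i) := by
  rcases hq.eq_or_lt with rfl | hqp
  · by_cases h0 : ∑ i ∈ s, p i * x i = 0
    · rw [h0, posPow_zero, nonpos_iff_eq_zero, mul_eq_zero]
      right
      rw [Finset.sum_eq_zero_iff] at h0 ⊢
      intro i hi
      rcases mul_eq_zero.1 (h0 i hi) with h | h <;> simp [h]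
    · rw [posPow_of_ne_zero h0, ENNReal.rpow_zero, zero_sub, ENNReal.rpow_neg_one]
      calc _ ≤ (∑ i ∈ s, p i)⁻¹ * ∑ i ∈ s, p i := by
            gcongr with i hi
            calc p i * posPow 0 (x i) ≤ p i * 1 := by
                  gcongr
                  exact (posPow_le_rpow _ _).trans (by simp)
              _ = p i := mul_one _
        _ = 1 := ENNReal.inv_mul_cancel hp0 hp
  -- The convex inequality with exponent `1 / q`, applied to the powers `x i ^ q` and then raised to
  -- the power `q`.
  · have hinv : 1 ≤ 1 / q := by rw [le_div_iff₀ hqp]; linarith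
    have key := posPow_sum_mul_le hinv s p (fun i => posPow q (x i)) hp0 hp
    have hqi : 0 < 1 / q := by positivity
    simp only [posPow_of_pos hqp, posPow_of_pos hqi, ← ENNReal.rpow_mul] at key ⊢
    rw [mul_one_div_cancel hqp.ne'] at key
    simp only [ENNReal.rpow_one] at key
    have key2 := ENNReal.rpow_le_rpow key hqp.le
    rw [← ENNReal.rpow_mul, one_div_mul_cancel hqp.ne', ENNReal.rpow_one,
      ENNReal.mul_rpow_of_nonneg _ _ hqp.le, ← ENNReal.rpow_mul] at key2
    calc _ ≤ (∑ i ∈ s, p i) ^ (q - 1) *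
          ((∑ i ∈ s, p i) ^ ((1 / q - 1) * q) * (∑ i ∈ s, p i * x i) ^ q) := by gcongr
      _ = (∑ i ∈ s, p i * x i) ^ q := by
          rw [← mul_assoc, ← ENNReal.rpow_add _ _ hp0 hp]
          have : q - 1 + (1 / q - 1) * q = 0 := by field_simp; ring
          rw [this, ENNReal.rpow_zero, one_mul]

theorem tsum_indicator_le_of_encard_le {K : Type*} {N : ℕ} {S : Set K} (hS : S.encard ≤ N)
    (c : ℝ≥0∞) : ∑' k, S.indicator (fun _ => c) k ≤ N * c := by
  rw [← tsum_subtype, ENNReal.tsum_const]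
  gcongr
  have h1 : (ENat.card S : ℝ≥0∞) ≤ ((N : ℕ∞) : ℝ≥0∞) := by exact_mod_cast hS
  simpa using h1

/-- Comparison of power sums along a relation with bounded multiplicities. -/
theorem tsum_posPow_le_of_rel {K L : Type*} {q : ℝ} (hq : 0 ≤ q) {a : K → ℝ≥0∞} {b : L → ℝ≥0∞}
    (R : K → L → Prop) {N M : ℕ} (hN : ∀ k, {l | R k l}.encard ≤ N)
    (hM : ∀ l, {k | R k l}.encard ≤ M)
    (hle : ∀ k, a k ≤ ∑' l, {l | R k l}.indicator b l) :
    ∑' k, posPow q (a k) ≤ (N : ℝ≥0∞) ^ q * M * ∑' l, posPow q (b l) := by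
  classical
  have h1 : ∀ k, posPow q (a k) ≤
      (N : ℝ≥0∞) ^ q * ∑' l, {l | R k l}.indicator (fun l => posPow q (b l)) l := by
    intro k
    have hfin : {l | R k l}.Finite := Set.finite_of_encard_le_coe (hN k)
    have hs : ∀ f : L → ℝ≥0∞, ∑' l, {l | R k l}.indicator f l = ∑ l ∈ hfin.toFinset, f l := by
      intro f
      rw [tsum_eq_sum (s := hfin.toFinset)]
      · exact Finset.sum_congr rfl fun l hl => indicator_of_mem (hfin.mem_toFinset.1 hl) f
      · exact fun l hl => indicator_of_notMem (fun h => hl (hfin.mem_toFinset.2 h)) f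
    have hcard : hfin.toFinset.card ≤ N := by
      have := hN k
      rw [hfin.encard_eq_coe_toFinset_card] at this
      exact_mod_cast this
    calc posPow q (a k) ≤ posPow q (∑ l ∈ hfin.toFinset, b l) := posPow_mono hq (hs b ▸ hle k)
      _ ≤ (hfin.toFinset.card : ℝ≥0∞) ^ q * ∑ l ∈ hfin.toFinset, posPow q (b l) :=
        posPow_sum_le_card hq _ _
      _ ≤ _ := by
        rw [hs]
        gcongr
  calc ∑' k, posPow q (a k) ≤
      ∑' k, (N : ℝ≥0∞) ^ q * ∑' l, {l | R k l}.indicator (fun l => posPow q (b l)) l :=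
        ENNReal.tsum_le_tsum h1
    -- Double counting: after the exchange of sums each `b l` is counted once for every related `k`,
    -- that is at most `M` times.
    _ = (N : ℝ≥0∞) ^ q * ∑' l, ∑' k, {l | R k l}.indicator (fun l => posPow q (b l)) l := by
        rw [ENNReal.tsum_mul_left, ENNReal.tsum_comm]
    _ = (N : ℝ≥0∞) ^ q * ∑' l, ∑' k, {k | R k l}.indicator (fun _ => posPow q (b l)) k := by
        simp [Set.indicator_apply]
    _ ≤ (N : ℝ≥0∞) ^ q * ∑' l, M * posPow q (b l) := by
        gcongr with l
        exact tsum_indicator_le_of_encard_le (hM l) _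
    _ = _ := by rw [ENNReal.tsum_mul_left, mul_assoc]

/-! ### Power sums over partitions -/

section PartSum

variable {Ω K L : Type*} [MeasurableSpace Ω]

/-- The sum of the `q`-th powers of the masses of the pieces of the partition given by `F`. -/
def partSum (q : ℝ) (μ : Measure Ω) (F : Ω → K) : ℝ≥0∞ := ∑' k, posPow q (μ (F ⁻¹' {k}))

theorem measure_le_tsum_indicator [Countable L] {μ : Measure Ω} {B : Set Ω} (hB : μ Bᶜ = 0)
    (G : Ω → L) (S : Set Ω) :
    μ S ≤ ∑' l, (G '' (B ∩ S)).indicator (fun l => μ (G ⁻¹' {l})) l := by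
  have hsub : S ⊆ (⋃ l ∈ G '' (B ∩ S), G ⁻¹' {l}) ∪ Bᶜ := by
    intro x hx
    by_cases hxB : x ∈ B
    · left
      simp only [mem_iUnion]
      exact ⟨G x, ⟨x, ⟨hxB, hx⟩, rfl⟩, rfl⟩
    · exact Or.inr hxB
  calc μ S ≤ μ (⋃ l ∈ G '' (B ∩ S), G ⁻¹' {l}) + μ Bᶜ :=
        (measure_mono hsub).trans (measure_union_le _ _)
    _ = μ (⋃ l ∈ G '' (B ∩ S), G ⁻¹' {l}) := by rw [hB, add_zero]
    _ ≤ ∑' l : (G '' (B ∩ S)), μ (G ⁻¹' {(l : L)}) :=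
        measure_biUnion_le _ (to_countable _) _
    _ = _ := by rw [← tsum_subtype]

/-- Two cells are related when they meet inside the set `B` of full measure; what happens off `B`
cannot affect the masses. -/
theorem partSum_le_of_encard_le [Countable L] {q : ℝ} (hq : 0 ≤ q) {μ : Measure Ω} {B : Set Ω}
    (hB : μ Bᶜ = 0) {F : Ω → K} {G : Ω → L} {N M : ℕ}
    (hN : ∀ k, (G '' (B ∩ F ⁻¹' {k})).encard ≤ N) (hM : ∀ l, (F '' (B ∩ G ⁻¹' {l})).encard ≤ M) :
    partSum q μ F ≤ (N : ℝ≥0∞) ^ q * M * partSum q μ G := by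
  refine tsum_posPow_le_of_rel hq (fun k l => l ∈ G '' (B ∩ F ⁻¹' {k})) hN ?_ ?_
  · intro l
    refine le_trans (encard_le_encard ?_) (hM l)
    rintro k ⟨x, ⟨hx, hxk⟩, rfl⟩
    exact ⟨x, ⟨hx, rfl⟩, hxk⟩
  · exact fun k => measure_le_tsum_indicator hB G _

theorem partSum_ne_zero [Countable K] {q : ℝ} (hq : 0 ≤ q) {μ : Measure Ω} (hμ : μ ≠ 0)
    (F : Ω → K) : partSum q μ F ≠ 0 := by
  intro h
  rw [partSum, ENNReal.tsum_eq_zero] at h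
  have h0 : ∀ k, μ (F ⁻¹' {k}) = 0 := fun k => by
    by_contra hk
    exact posPow_ne_zero hq hk (h k)
  apply hμ
  rw [← Measure.measure_univ_eq_zero]
  have : (univ : Set Ω) = ⋃ k, F ⁻¹' {k} := by ext; simp
  rw [this]
  exact measure_iUnion_null h0

theorem partSum_ne_top {q : ℝ} (hq : 0 ≤ q) {μ : Measure Ω} [IsFiniteMeasure μ] {B : Set Ω}
    (hB : μ Bᶜ = 0) {F : Ω → K} (hfin : (F '' B).Finite) : partSum q μ F ≠ ∞ := by
  rw [partSum, tsum_eq_sum (s := hfin.toFinset)]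
  · exact ENNReal.sum_ne_top.2 fun k _ => posPow_ne_top hq (measure_ne_top _ _)
  · intro k hk
    have : μ (F ⁻¹' {k}) = 0 := by
      refine measure_mono_null (t := Bᶜ) (fun x hx hxB => hk ?_) hB
      rw [Finite.mem_toFinset]
      exact ⟨x, hxB, hx⟩
    rw [this, posPow_zero]

theorem partSum_map {Ω' : Type*} [MeasurableSpace Ω'] {q : ℝ} {μ : Measure Ω} {f : Ω → Ω'}
    (hf : Measurable f) {F : Ω' → K} (hF : ∀ k, MeasurableSet (F ⁻¹' {k})) :
    partSum q (μ.map f) F = partSum q μ (F ∘ f) := by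
  unfold partSum
  simp only [Measure.map_apply hf (hF _), preimage_comp]

end PartSum

/-! ### Subexponential comparison of scale functions -/

/-- `f` is bounded by `g` up to factors `δ ^ (-ε)`, for every `ε > 0`, as `δ → 0⁺`. -/
def SubExpLE (f g : ℝ → ℝ≥0∞) : Prop :=
  ∀ ε : ℝ, 0 < ε → ∀ᶠ δ in 𝓝[>] (0 : ℝ), f δ ≤ ENNReal.ofReal (δ ^ (-ε)) * g δ

theorem eventually_le_ofReal_rpow_neg {C : ℝ≥0∞} (hC : C ≠ ∞) {ε : ℝ} (hε : 0 < ε) :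
    ∀ᶠ δ in 𝓝[>] (0 : ℝ), C ≤ ENNReal.ofReal (δ ^ (-ε)) := by
  have h := tendsto_rpow_neg_nhdsGT_zero (neg_lt_zero.2 hε)
  filter_upwards [h.eventually_ge_atTop C.toReal] with δ hδ
  rw [← ENNReal.ofReal_toReal hC]
  exact ENNReal.ofReal_le_ofReal hδ

theorem SubExpLE.trans {f g h : ℝ → ℝ≥0∞} (hfg : SubExpLE f g) (hgh : SubExpLE g h) :
    SubExpLE f h := by
  intro ε hε
  filter_upwards [hfg (ε / 2) (by positivity), hgh (ε / 2) (by positivity),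
    self_mem_nhdsWithin] with δ h1 h2 hδ
  calc f δ ≤ ENNReal.ofReal (δ ^ (-(ε / 2))) * (ENNReal.ofReal (δ ^ (-(ε / 2))) * h δ) := by
        refine h1.trans ?_; gcongr
    _ = ENNReal.ofReal (δ ^ (-ε)) * h δ := by
        have hpos : (0 : ℝ) < δ := hδ
        rw [← mul_assoc, ← ENNReal.ofReal_mul (by positivity), ← Real.rpow_add hpos]
        congr 3; ring

theorem subExpLE_of_eventually_le_mul {f g : ℝ → ℝ≥0∞} {C : ℝ≥0∞} (hC : C ≠ ∞)
    (h : ∀ᶠ δ in 𝓝[>] (0 : ℝ), f δ ≤ C * g δ) : SubExpLE f g := by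
  intro ε hε
  filter_upwards [h, eventually_le_ofReal_rpow_neg hC hε] with δ h1 h2
  exact h1.trans (by gcongr)

theorem subExpLE_of_le_mul {f g : ℝ → ℝ≥0∞} {C : ℝ≥0∞} (hC : C ≠ ∞)
    (h : ∀ δ, 0 < δ → f δ ≤ C * g δ) : SubExpLE f g :=
  subExpLE_of_eventually_le_mul hC (by filter_upwards [self_mem_nhdsWithin] with δ hδ using h δ hδ)

/-- For `δ < 1`, division by the positive number `-log δ` turns the factor `δ ^ (-ε)` into the
additive term `ε`. -/
theorem SubExpLE.eventually_log_div_le {f g : ℝ → ℝ≥0∞} (h : SubExpLE f g) {ε : ℝ} (hε : 0 < ε) :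
    ∀ᶠ δ in 𝓝[>] (0 : ℝ), ENNReal.log (f δ) / ((-Real.log δ : ℝ) : EReal) ≤
      (ε : EReal) + ENNReal.log (g δ) / ((-Real.log δ : ℝ) : EReal) := by
  have h1 : ∀ᶠ δ in 𝓝[>] (0 : ℝ), δ < 1 :=
    eventually_nhdsWithin_of_eventually_nhds (eventually_lt_nhds one_pos)
  filter_upwards [h ε hε, h1, self_mem_nhdsWithin] with δ hδ h1 h0
  have hpos : (0 : ℝ) < δ := h0
  have hlog : 0 < -Real.log δ := neg_pos.2 (Real.log_neg hpos h1)
  have hlog0 : Real.log δ ≠ 0 := (Real.log_neg hpos h1).ne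
  have hlogE : (0 : EReal) ≤ ((-Real.log δ : ℝ) : EReal) := by exact_mod_cast hlog.le
  calc ENNReal.log (f δ) / ((-Real.log δ : ℝ) : EReal)
      ≤ ENNReal.log (ENNReal.ofReal (δ ^ (-ε)) * g δ) / ((-Real.log δ : ℝ) : EReal) :=
        EReal.div_le_div_right_of_nonneg hlogE (ENNReal.log_monotone hδ)
    _ = (ε : EReal) + ENNReal.log (g δ) / ((-Real.log δ : ℝ) : EReal) := by
        rw [ENNReal.log_mul_add, ENNReal.log_ofReal_of_pos (by positivity), Real.log_rpow hpos]
        have e : ((-ε * Real.log δ : ℝ) : EReal) / ((-Real.log δ : ℝ) : EReal) = ε := by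
          rw [← EReal.coe_div]
          congr 1
          field_simp
        rw [← e]
        simp only [EReal.div_eq_inv_mul]
        rw [← EReal.coe_inv]
        exact EReal.left_distrib_of_nonneg_of_ne_top (by exact_mod_cast (inv_pos.2 hlog).le)
          (EReal.coe_ne_top _) _ _

theorem EReal_le_of_forall_pos_le_add {a b : EReal}
    (h : ∀ ε : ℝ, 0 < ε → a ≤ (ε : EReal) + b) : a ≤ b := by
  induction b with
  | bot => simpa using h 1 one_pos
  | top => exact le_top
  | coe b =>
    refine EReal.le_of_forall_lt_iff_le.1 fun z hz => ?_
    have hz' : b < z := by exact_mod_cast hz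
    have := h (z - b) (by linarith)
    rwa [← EReal.coe_add, sub_add_cancel] at this

theorem SubExpLE.upperExponent_le {f g : ℝ → ℝ≥0∞} (h : SubExpLE f g) :
    upperExponent f ≤ upperExponent g := by
  refine EReal_le_of_forall_pos_le_add fun ε hε => ?_
  refine (limsup_le_limsup (h.eventually_log_div_le hε)).trans ?_
  refine (EReal.limsup_add_le (Or.inl ?_) (Or.inl ?_)).trans ?_ <;> simp [upperExponent]

theorem SubExpLE.lowerExponent_le {f g : ℝ → ℝ≥0∞} (h : SubExpLE f g) :
    lowerExponent f ≤ lowerExponent g := by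
  refine EReal_le_of_forall_pos_le_add fun ε hε => ?_
  refine (liminf_le_liminf (h.eventually_log_div_le hε)).trans ?_
  refine (EReal.liminf_add_le (Or.inl ?_) (Or.inl ?_)).trans ?_ <;> simp [lowerExponent]

theorem tendsto_log_rpow_div (t : ℝ) :
    Tendsto (fun δ : ℝ => ENNReal.log (ENNReal.ofReal (δ ^ (-t))) / ((-Real.log δ : ℝ) : EReal))
      (𝓝[>] 0) (𝓝 (t : EReal)) := by
  refine tendsto_const_nhds.congr' ?_
  have h1 : ∀ᶠ δ in 𝓝[>] (0 : ℝ), δ < 1 :=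
    eventually_nhdsWithin_of_eventually_nhds (eventually_lt_nhds one_pos)
  filter_upwards [h1, self_mem_nhdsWithin] with δ h1 h0
  have hpos : (0 : ℝ) < δ := h0
  have hlog : 0 < -Real.log δ := neg_pos.2 (Real.log_neg hpos h1)
  have hlog0 : Real.log δ ≠ 0 := (Real.log_neg hpos h1).ne
  rw [ENNReal.log_ofReal_of_pos (by positivity), Real.log_rpow hpos, ← EReal.coe_div]
  congr 1
  field_simp

theorem upperExponent_rpow (t : ℝ) :
    upperExponent (fun δ => ENNReal.ofReal (δ ^ (-t))) = t :=
  (tendsto_log_rpow_div t).limsup_eq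

theorem lowerExponent_rpow (t : ℝ) :
    lowerExponent (fun δ => ENNReal.ofReal (δ ^ (-t))) = t :=
  (tendsto_log_rpow_div t).liminf_eq

/-! ### Grids -/

/-- A family of partitions into cells of diameter at most `2δ` such that, for every `R`, the cells
have a finite colouring for which distinct cells of the same colour are more than `R * δ` apart. -/
structure Grid (X : Type*) [PseudoMetricSpace X] [MeasurableSpace X] where
  K : Type
  countable : Countable K
  cell : ℝ → X → K
  measurableSet : ∀ δ k, MeasurableSet (cell δ ⁻¹' {k})
  dist_le : ∀ δ : ℝ, 0 < δ → ∀ x y, cell δ x = cell δ y → dist x y ≤ 2 * δ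
  coloring : ∀ R : ℝ, ∃ (n : ℕ) (col : K → Fin n), ∀ δ : ℝ, 0 < δ → ∀ x y,
    cell δ x ≠ cell δ y → col (cell δ x) = col (cell δ y) → R * δ < dist x y

namespace Grid

attribute [instance] Grid.countable

section Basic

variable {X : Type*} [PseudoMetricSpace X] [MeasurableSpace X] (G : Grid X)

/-- The cells met by a set of diameter at most `R * δ` have pairwise distinct colours, so the number
of colours bounds them uniformly in `δ`. -/
theorem exists_encard_image_le (R : ℝ) : ∃ N : ℕ, ∀ δ : ℝ, 0 < δ → ∀ T : Set X,
    (∀ x ∈ T, ∀ y ∈ T, dist x y ≤ R * δ) → (G.cell δ '' T).encard ≤ N := by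
  obtain ⟨n, col, hcol⟩ := G.coloring R
  refine ⟨n, fun δ hδ T hT => ?_⟩
  have hinj : InjOn col (G.cell δ '' T) := by
    rintro _ ⟨x, hx, rfl⟩ _ ⟨y, hy, rfl⟩ hxy
    by_contra hne
    exact absurd (hT x hx y hy) (not_le.2 (hcol δ hδ x y hne hxy))
  calc (G.cell δ '' T).encard = (col '' (G.cell δ '' T)).encard := hinj.encard_image.symm
    _ ≤ (univ : Set (Fin n)).encard := encard_le_encard (subset_univ _)
    _ = n := by simp

/-- The sum of the `q`-th powers of the masses of the cells of size `δ`. -/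
def gridSum (q : ℝ) (ν : Measure X) (δ : ℝ) : ℝ≥0∞ := partSum q ν (G.cell δ)

/-- Comparison of the grid sums of two images of a measure. -/
theorem exists_partSum_le {Y : Type*} [PseudoMetricSpace Y] [MeasurableSpace Y] (H : Grid Y)
    {q : ℝ} (hq : 0 ≤ q) (R : ℝ) : ∃ C : ℝ≥0∞, C ≠ ∞ ∧
    ∀ {Ω : Type*} [MeasurableSpace Ω] (μ : Measure Ω) (B : Set Ω), μ Bᶜ = 0 →
    ∀ (f : Ω → X) (g : Ω → Y) (δ ε : ℝ), 0 < δ → 0 < ε →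
    (∀ x ∈ B, ∀ y ∈ B, dist (g x) (g y) ≤ 2 * ε → dist (f x) (f y) ≤ R * δ) →
    (∀ x ∈ B, ∀ y ∈ B, dist (f x) (f y) ≤ 2 * δ → dist (g x) (g y) ≤ R * ε) →
    partSum q μ (G.cell δ ∘ f) ≤ C * partSum q μ (H.cell ε ∘ g) := by
  obtain ⟨N, hN⟩ := H.exists_encard_image_le R
  obtain ⟨M, hM⟩ := G.exists_encard_image_le R
  refine ⟨(N : ℝ≥0∞) ^ q * M, ENNReal.mul_ne_top (ENNReal.rpow_ne_top_of_nonneg hq (by simp))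
    (by simp), fun μ B hB f g δ ε hδ hε h1 h2 => ?_⟩
  refine partSum_le_of_encard_le hq hB (fun k => ?_) (fun l => ?_)
  · rw [image_comp]
    refine hN ε hε _ ?_
    rintro _ ⟨x, ⟨hx, hxk⟩, rfl⟩ _ ⟨y, ⟨hy, hyk⟩, rfl⟩
    exact h2 x hx y hy (G.dist_le δ hδ _ _ (Eq.trans hxk (Eq.symm hyk)))
  · rw [image_comp]
    refine hM δ hδ _ ?_
    rintro _ ⟨x, ⟨hx, hxk⟩, rfl⟩ _ ⟨y, ⟨hy, hyk⟩, rfl⟩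
    exact h1 x hx y hy (H.dist_le ε hε _ _ (Eq.trans hxk (Eq.symm hyk)))

theorem exists_gridSum_le {q : ℝ} (hq : 0 ≤ q) {R : ℝ} :
    ∃ C : ℝ≥0∞, C ≠ ∞ ∧ ∀ (ν : Measure X) (δ ε : ℝ), 0 < δ → 0 < ε → δ ≤ R * ε → ε ≤ R * δ →
      G.gridSum q ν δ ≤ C * G.gridSum q ν ε := by
  obtain ⟨C, hC, h⟩ := G.exists_partSum_le G hq (2 * R)
  refine ⟨C, hC, fun ν δ ε hδ hε h1 h2 => ?_⟩
  refine h ν univ (by simp) id id δ ε hδ hε ?_ ?_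
  · intro x _ y _ hxy
    exact hxy.trans (by linarith)
  · intro x _ y _ hxy
    exact hxy.trans (by linarith)

theorem tsum_le_of_color {K : Type*} {n : ℕ} (col : K → Fin n) (a : K → ℝ≥0∞) {M : ℝ≥0∞}
    (h : ∀ c, ∑' k : {k | col k = c}, a k ≤ M) : ∑' k, a k ≤ n * M := by
  classical
  calc ∑' k, a k = ∑' k, ∑ c, {k | col k = c}.indicator a k := by
        congr 1; ext k
        simp [Set.indicator_apply]
    _ = ∑ c, ∑' k, {k | col k = c}.indicator a k :=
        Summable.tsum_finsetSum fun _ _ => ENNReal.summable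
    _ = ∑ c, ∑' k : {k | col k = c}, a k := by simp only [tsum_subtype]
    _ ≤ ∑ _c : Fin n, M := Finset.sum_le_sum fun c _ => h c
    _ = n * M := by simp

/-- Balls whose centres lie in distinct cells of a comparable size. -/
theorem exists_tsum_closedBall_le {q : ℝ} (hq : 0 ≤ q) : ∃ C : ℝ≥0∞, C ≠ ∞ ∧
    ∀ (ν : Measure X) (δ : ℝ) (A : Set X), 0 < δ → InjOn (G.cell (δ / 4)) A →
      ∑' x : A, posPow q (ν (Metric.closedBall x δ)) ≤ C * G.gridSum q ν δ := by
  obtain ⟨N, hN⟩ := G.exists_encard_image_le 2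
  -- If two balls meet the same cell of size `δ`, their centres are within `δ + 2 * δ + δ = 16 * (δ
  -- / 4)` of each other.
  obtain ⟨M, hM⟩ := G.exists_encard_image_le 16
  refine ⟨(N : ℝ≥0∞) ^ q * M, ENNReal.mul_ne_top (ENNReal.rpow_ne_top_of_nonneg hq (by simp))
    (by simp), fun ν δ A hδ hA => ?_⟩
  refine tsum_posPow_le_of_rel hq
    (fun (x : A) l => l ∈ G.cell δ '' (univ ∩ Metric.closedBall (x : X) δ)) (fun x => ?_)
    (fun l => ?_) (fun x => measure_le_tsum_indicator (by simp) _ _)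
  · refine hN δ hδ _ fun y hy z hz => ?_
    have h1 := Metric.mem_closedBall.1 hy.2
    have h2 := Metric.mem_closedBall.1 hz.2
    linarith [dist_triangle_right y z (x : X)]
  · have hinj : InjOn (fun x : A => G.cell (δ / 4) x)
        {x : A | l ∈ G.cell δ '' (univ ∩ Metric.closedBall (x : X) δ)} :=
      fun x _ y _ hxy => Subtype.ext (hA x.2 y.2 hxy)
    rw [← hinj.encard_image]
    rw [← image_image (G.cell (δ / 4)) (fun x : A => (x : X))]
    refine hM (δ / 4) (by positivity) _ ?_
    rintro _ ⟨x, ⟨u, hu, hul⟩, rfl⟩ _ ⟨y, ⟨v, hv, hvl⟩, rfl⟩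
    have h1 := Metric.mem_closedBall.1 hu.2
    have h2 := Metric.mem_closedBall.1 hv.2
    have h3 := G.dist_le δ hδ u v (hul.trans hvl.symm)
    have h4 := dist_triangle4_right (x : X) (y : X) u v
    have h5 := dist_triangle (x : X) u v
    have h6 := dist_triangle (x : X) v (y : X)
    rw [dist_comm] at h1
    linarith

end Basic

end Grid

/-! ### Packing sums, covering sums and `L^q`-integrals against grid sums -/

namespace Grid

section Compare

variable {X : Type*} [PseudoMetricSpace X] [MeasurableSpace X] (G : Grid X)

theorem measure_closedBall_ne_zero {ν : Measure X} {x : X} (hx : x ∈ ν.support) {δ : ℝ}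
    (hδ : 0 < δ) : ν (Metric.closedBall x δ) ≠ 0 :=
  ((Measure.mem_support_iff_forall x).1 hx _ (Metric.closedBall_mem_nhds x hδ)).ne'

theorem tsum_rpow_closedBall_eq {ν : Measure X} {A : Set X} (hA : A ⊆ ν.support) {δ : ℝ}
    (hδ : 0 < δ) (q : ℝ) :
    ∑' x : A, ν (Metric.closedBall (x : X) δ) ^ q =
      ∑' x : A, posPow q (ν (Metric.closedBall (x : X) δ)) :=
  tsum_congr fun x => (posPow_of_ne_zero (measure_closedBall_ne_zero (hA x.2) hδ)).symm

theorem cell_ball_subset {δ : ℝ} (hδ : 0 < δ) {x : X} {r : ℝ} (hr : 2 * δ ≤ r) :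
    G.cell δ ⁻¹' {G.cell δ x} ⊆ Metric.closedBall x r :=
  fun y hy => (G.dist_le δ hδ y x hy).trans hr

/-- A cell of size `δ / 4` has diameter at most `δ / 2`, so it contains at most one centre of a
packing by balls of radius `δ`. -/
theorem packingSum_subExpLE {q : ℝ} (hq : 0 ≤ q) (ν : Measure X) :
    SubExpLE (packingSum ν q) (G.gridSum q ν) := by
  obtain ⟨C, hC, h⟩ := G.exists_tsum_closedBall_le hq
  refine subExpLE_of_le_mul hC fun δ hδ => iSup₂_le fun A hA => ?_
  rw [tsum_rpow_closedBall_eq hA.1 hδ]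
  refine h ν δ A hδ fun x hx y hy hxy => ?_
  by_contra hne
  have hd : Disjoint (Metric.closedBall x δ) (Metric.closedBall y δ) := hA.2 hx hy hne
  have hmem : y ∈ Metric.closedBall x δ :=
    G.cell_ball_subset (δ := δ / 4) (by positivity) (by linarith) hxy.symm
  exact Set.disjoint_left.1 hd hmem (Metric.mem_closedBall_self hδ.le)

/-- One point of the support is chosen in each cell of size `δ / 4` that meets it; the balls of
radius `δ` about these points form an admissible cover. -/
theorem coveringSum_subExpLE [Nonempty X] {q : ℝ} (hq : 0 ≤ q) (ν : Measure X) :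
    SubExpLE (coveringSum ν q) (G.gridSum q ν) := by
  obtain ⟨C, hC, h⟩ := G.exists_tsum_closedBall_le hq
  refine subExpLE_of_le_mul hC fun δ hδ => ?_
  set c := G.cell (δ / 4) with hc
  choose! g hg hgc using fun (k : G.K) (hk : k ∈ c '' ν.support) => hk
  set A := g '' (c '' ν.support) with hA
  have hAs : A ⊆ ν.support := by
    rintro _ ⟨k, hk, rfl⟩
    exact hg k hk
  have hcov : ν.support ⊆ ⋃ x ∈ A, Metric.closedBall x δ := by
    intro y hy
    have hk : c y ∈ c '' ν.support := mem_image_of_mem c hy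
    refine mem_biUnion (mem_image_of_mem g hk) ?_
    exact G.cell_ball_subset (δ := δ / 4) (by positivity) (by linarith) (hgc _ hk).symm
  refine (iInf₂_le A ⟨hAs, hcov⟩).trans ?_
  rw [tsum_rpow_closedBall_eq hAs hδ]
  refine h ν δ A hδ ?_
  rintro _ ⟨k, hk, rfl⟩ _ ⟨l, hl, rfl⟩ hkl
  rw [← hc, hgc k hk, hgc l hl] at hkl
  rw [hkl]

/-- The balls of a cover may overlap without bound, so the argument rests on the subadditivity of
the concave power: each cell is covered by the balls that meet it, and each ball meets boundedly
many cells. This is where `q ≤ 1` enters. -/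
theorem gridSum_subExpLE_coveringSum {q : ℝ} (hq : 0 ≤ q) (hq1 : q ≤ 1) (ν : Measure X)
    (hν : ν ν.supportᶜ = 0) :
    SubExpLE (G.gridSum q ν) (coveringSum ν q) := by
  classical
  obtain ⟨N, hN⟩ := G.exists_encard_image_le 2
  -- `N + 1` instead of `N` keeps the constant nonzero, which is needed to move it through an
  -- infimum and to multiply it by `∞`.
  have hN1 : (N : ℝ≥0∞) + 1 ≠ ∞ := by simp
  refine subExpLE_of_le_mul hN1 fun δ hδ => ?_
  rw [coveringSum, ENNReal.mul_iInf_of_ne (by simp) hN1]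
  refine le_iInf fun A => ?_
  rw [ENNReal.mul_iInf_of_ne (by simp) hN1]
  refine le_iInf fun hA => ?_
  rw [tsum_rpow_closedBall_eq hA.1 hδ]
  set b : A → ℝ≥0∞ := fun x => posPow q (ν (Metric.closedBall (x : X) δ)) with hb
  by_cases hfin : ∑' x, b x = ∞
  · rw [hfin, ENNReal.mul_top (by simp)]
    exact le_top
  -- A sum of positive terms that is finite has a countable index set; the union bound below
  -- requires countability.
  have hcount : Countable A := by
    have h1 := Summable.countable_support_ennreal hfin
    have h2 : Function.support b = univ :=
      eq_univ_of_forall fun x => posPow_ne_zero hq (measure_closedBall_ne_zero (hA.1 x.2) hδ)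
    rw [h2] at h1
    exact countable_univ_iff.1 h1
  let R : G.K → A → Prop := fun k x => k ∈ G.cell δ '' Metric.closedBall (x : X) δ
  have h1 : ∀ k, posPow q (ν (G.cell δ ⁻¹' {k})) ≤ ∑' x, if R k x then b x else 0 := by
    intro k
    have hsub : G.cell δ ⁻¹' {k} ⊆
        (⋃ x ∈ {x : A | R k x}, Metric.closedBall (x : X) δ) ∪ ν.supportᶜ := by
      intro y hy
      by_cases hys : y ∈ ν.support
      · obtain ⟨x, hxA, hxy⟩ := mem_iUnion₂.1 (hA.2 hys)
        exact Or.inl (mem_biUnion (x := (⟨x, hxA⟩ : A)) ⟨y, hxy, hy⟩ hxy)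
      · exact Or.inr hys
    calc posPow q (ν (G.cell δ ⁻¹' {k}))
        ≤ posPow q (∑' x : {x : A | R k x}, ν (Metric.closedBall ((x : A) : X) δ)) := by
          refine posPow_mono hq ((measure_mono hsub).trans ((measure_union_le _ _).trans ?_))
          rw [hν, add_zero]
          exact measure_biUnion_le _ (to_countable _) _
      _ ≤ ∑' x : {x : A | R k x}, b x := posPow_tsum_le hq hq1 _
      _ = _ := by
          rw [tsum_subtype {x : A | R k x} b]
          simp [Set.indicator_apply]
  calc G.gridSum q ν δ ≤ ∑' k, ∑' x, if R k x then b x else 0 := ENNReal.tsum_le_tsum h1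
    _ = ∑' x, ∑' k, {k | R k x}.indicator (fun _ => b x) k := by
        rw [ENNReal.tsum_comm]
        simp [Set.indicator_apply]
    _ ≤ ∑' x, N * b x := by
        refine ENNReal.tsum_le_tsum fun x => tsum_indicator_le_of_encard_le ?_ _
        refine hN δ hδ _ fun y hy z hz => ?_
        have h1 := Metric.mem_closedBall.1 hy
        have h2 := Metric.mem_closedBall.1 hz
        linarith [dist_triangle_right y z (x : X)]
    _ = N * ∑' x, b x := ENNReal.tsum_mul_left
    _ ≤ (N + 1) * ∑' x, b x := by gcongr; exact le_self_add

/-- Every cell of positive mass contains a point of the support. -/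
theorem exists_center {ν : Measure X} (hν : ν ν.supportᶜ = 0) {F : X → G.K} {k : G.K}
    (hk : ν (F ⁻¹' {k}) ≠ 0) : ∃ x ∈ ν.support, F x = k := by
  by_contra! h
  exact hk (measure_mono_null (fun x hx hxs => h x hxs hx) hν)

theorem exists_gridSum_half_le {q : ℝ} (hq : 0 ≤ q) : ∃ C : ℝ≥0∞, C ≠ ∞ ∧
    ∀ (ν : Measure X) (δ : ℝ), 0 < δ → G.gridSum q ν δ ≤ C * G.gridSum q ν (δ / 2) := by
  obtain ⟨C, hC, h⟩ := G.exists_gridSum_le hq (R := 2)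
  exact ⟨C, hC, fun ν δ hδ => h ν δ (δ / 2) hδ (by positivity) (by linarith) (by linarith)⟩

/-- Cells of size `δ / 2` of the same colour are more than `4 * (δ / 2) = 2 * δ` apart. Choosing a
point of the support in every charged cell of one colour therefore gives a packing, and each ball
contains its cell. -/
theorem gridSum_subExpLE_packingSum [Nonempty X] {q : ℝ} (hq : 0 ≤ q) (ν : Measure X)
    (hν : ν ν.supportᶜ = 0) : SubExpLE (G.gridSum q ν) (packingSum ν q) := by
  obtain ⟨C, hC, h⟩ := G.exists_gridSum_half_le hq
  obtain ⟨n, col, hcol⟩ := G.coloring 4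
  have hCn : C * (n : ℝ≥0∞) ≠ ∞ := ENNReal.mul_ne_top hC (by simp)
  refine subExpLE_of_le_mul hCn fun δ hδ => (h ν δ hδ).trans ?_
  rw [mul_assoc]
  gcongr
  refine tsum_le_of_color col _ fun c => ?_
  set F := G.cell (δ / 2) with hF
  have hδ2 : 0 < δ / 2 := by positivity
  set T : Set G.K := {k | col k = c} ∩ {k | ν (F ⁻¹' {k}) ≠ 0} with hT
  choose! g hg hgF using fun (k : G.K) (hk : ν (F ⁻¹' {k}) ≠ 0) => G.exists_center hν hk
  have hinj : InjOn g T := fun k hk l hl hkl => by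
    rw [← hgF k hk.2, ← hgF l hl.2, hkl]
  have hmem : g '' T ⊆ ν.support ∧
      (g '' T).PairwiseDisjoint (fun x => Metric.closedBall x δ) := by
    constructor
    · rintro _ ⟨k, hk, rfl⟩
      exact hg k hk.2
    · rintro _ ⟨k, hk, rfl⟩ _ ⟨l, hl, rfl⟩ hne
      refine Metric.closedBall_disjoint_closedBall ?_
      have hne' : F (g k) ≠ F (g l) := by
        rw [hgF k hk.2, hgF l hl.2]
        exact fun h => hne (h ▸ rfl)
      have := hcol (δ / 2) hδ2 (g k) (g l) hne' (by
        rw [← hF, hgF k hk.2, hgF l hl.2]; exact hk.1.trans hl.1.symm)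
      linarith
  calc ∑' k : {k | col k = c}, posPow q (ν (F ⁻¹' {(k : G.K)}))
      = ∑' k : T, posPow q (ν (F ⁻¹' {(k : G.K)})) := by
        rw [tsum_subtype {k | col k = c} fun k => posPow q (ν (F ⁻¹' {k})),
          tsum_subtype T fun k => posPow q (ν (F ⁻¹' {k}))]
        refine tsum_congr fun k => ?_
        by_cases h0 : ν (F ⁻¹' {k}) = 0 <;> simp [hT, Set.indicator_apply, h0]
    _ ≤ ∑' k : T, ν (Metric.closedBall (g k) δ) ^ q := by
        refine ENNReal.tsum_le_tsum fun k => (posPow_le_rpow _ _).trans ?_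
        refine ENNReal.rpow_le_rpow (measure_mono ?_) hq
        have := G.cell_ball_subset hδ2 (x := g k) (r := δ) (by linarith)
        rwa [← hF, hgF k k.2.2] at this
    _ = ∑' x : g '' T, ν (Metric.closedBall (x : X) δ) ^ q :=
        (tsum_image (fun x => ν (Metric.closedBall x δ) ^ q) hinj).symm
    _ ≤ packingSum ν q δ := le_iSup₂_of_le (g '' T) hmem le_rfl

theorem lqIntegral_eq {ν : Measure X} (hν : ν ν.supportᶜ = 0) (q δ : ℝ) :
    lqIntegral ν q δ = ∫⁻ x, ν (Metric.closedBall x δ) ^ (q - 1) ∂ν := by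
  rw [lqIntegral, Measure.restrict_eq_self_of_ae_mem]
  exact hν

theorem lintegral_eq_tsum_cell (ν : Measure X) (δ : ℝ) (f : X → ℝ≥0∞) :
    ∫⁻ x, f x ∂ν = ∑' k, ∫⁻ x in G.cell δ ⁻¹' {k}, f x ∂ν := by
  rw [← lintegral_iUnion (G.measurableSet δ)]
  · have : ⋃ k, G.cell δ ⁻¹' {k} = univ := by ext; simp
    rw [this, Measure.restrict_univ]
  · intro k l hkl
    refine Set.disjoint_left.2 fun x hx hy => hkl ?_
    exact Eq.trans (Eq.symm hx) hy

/-- A cell of size `δ / 2` lies in the ball of radius `δ` about each of its points, and `t ↦ t ^ (q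
- 1)` is nondecreasing. -/
theorem gridSum_subExpLE_lqIntegral_of_one_le {q : ℝ} (hq : 1 ≤ q) (ν : Measure X)
    [IsFiniteMeasure ν] (hν : ν ν.supportᶜ = 0) :
    SubExpLE (G.gridSum q ν) (lqIntegral ν q) := by
  obtain ⟨C, hC, h⟩ := G.exists_gridSum_half_le (q := q) (by linarith)
  refine subExpLE_of_le_mul hC fun δ hδ => (h ν δ hδ).trans ?_
  gcongr
  rw [lqIntegral_eq hν, G.lintegral_eq_tsum_cell ν (δ / 2)]
  refine ENNReal.tsum_le_tsum fun k => ?_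
  set Q := G.cell (δ / 2) ⁻¹' {k} with hQ
  by_cases h0 : ν Q = 0
  · simp [h0]
  rw [← posPow_sub_one_mul h0 (measure_ne_top _ _), ← setLIntegral_const]
  refine setLIntegral_mono' (G.measurableSet _ _) fun x hx => ?_
  refine ENNReal.rpow_le_rpow (measure_mono ?_) (by linarith)
  have := G.cell_ball_subset (δ := δ / 2) (by positivity) (x := x) (r := δ) (by linarith)
  rwa [show G.cell (δ / 2) x = k from hx] at this

/-- The same inclusion of a cell in the balls about its points, used with a nonincreasing power. -/
theorem lqIntegral_subExpLE_of_le_one {q : ℝ} (hq : 0 ≤ q) (hq1 : q ≤ 1) (ν : Measure X)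
    [IsFiniteMeasure ν] (hν : ν ν.supportᶜ = 0) :
    SubExpLE (lqIntegral ν q) (G.gridSum q ν) := by
  obtain ⟨C, hC, h⟩ := G.exists_gridSum_le hq (R := 2)
  refine subExpLE_of_le_mul hC fun δ hδ => ?_
  refine le_trans ?_ (h ν (δ / 2) δ (by positivity) hδ (by linarith) (by linarith))
  rw [lqIntegral_eq hν, G.lintegral_eq_tsum_cell ν (δ / 2)]
  refine ENNReal.tsum_le_tsum fun k => ?_
  set Q := G.cell (δ / 2) ⁻¹' {k} with hQ
  by_cases h0 : ν Q = 0
  · rw [Measure.restrict_eq_zero.2 h0]; simp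
  rw [← posPow_sub_one_mul h0 (measure_ne_top _ _), ← setLIntegral_const]
  refine setLIntegral_mono' (G.measurableSet _ _) fun x hx => ?_
  refine rpow_le_rpow_of_exponent_nonpos (by linarith) (measure_mono ?_)
  have := G.cell_ball_subset (δ := δ / 2) (by positivity) (x := x) (r := δ) (by linarith)
  rwa [show G.cell (δ / 2) x = k from hx] at this

/-- The balls about the points of a cell all lie in the `δ`-neighbourhood of the cell, which meets
boundedly many cells. -/
theorem lqIntegral_subExpLE_of_one_le {q : ℝ} (hq : 1 ≤ q) (ν : Measure X)
    [IsFiniteMeasure ν] (hν : ν ν.supportᶜ = 0) :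
    SubExpLE (lqIntegral ν q) (G.gridSum q ν) := by
  have hq0 : 0 ≤ q := by linarith
  obtain ⟨N, hN⟩ := G.exists_encard_image_le 6
  refine subExpLE_of_le_mul (C := (N : ℝ≥0∞) ^ q * N)
    (ENNReal.mul_ne_top (ENNReal.rpow_ne_top_of_nonneg hq0 (by simp)) (by simp)) fun δ hδ => ?_
  rw [lqIntegral_eq hν, G.lintegral_eq_tsum_cell ν δ]
  let near : G.K → Set X := fun k => {y | ∃ x, G.cell δ x = k ∧ dist x y ≤ δ}
  have hnear : ∀ k, ∀ x ∈ near k, ∀ y ∈ near k, dist x y ≤ 6 * δ := by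
    rintro k x ⟨x', hx', hx⟩ y ⟨y', hy', hy⟩
    have h1 := G.dist_le δ hδ x' y' (hx'.trans hy'.symm)
    have h2 := dist_triangle4 x x' y' y
    rw [dist_comm] at hx
    linarith
  let R : G.K → G.K → Prop := fun k l => l ∈ G.cell δ '' (univ ∩ near k)
  set a : G.K → ℝ≥0∞ := fun k => ν (near k) with ha
  have hle : ∀ k, ∫⁻ x in G.cell δ ⁻¹' {k}, ν (Metric.closedBall x δ) ^ (q - 1) ∂ν ≤
      posPow q (a k) := by
    intro k
    by_cases h0 : ν (G.cell δ ⁻¹' {k}) = 0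
    · rw [Measure.restrict_eq_zero.2 h0]; simp
    have hsub : G.cell δ ⁻¹' {k} ⊆ near k := fun x hx => ⟨x, hx, by simpa using hδ.le⟩
    have ha0 : a k ≠ 0 := fun h => h0 (measure_mono_null hsub h)
    calc _ ≤ ∫⁻ _x in G.cell δ ⁻¹' {k}, a k ^ (q - 1) ∂ν := by
          refine setLIntegral_mono' (G.measurableSet _ _) fun x hx => ?_
          refine ENNReal.rpow_le_rpow (measure_mono fun y hy => ⟨x, hx, ?_⟩) (by linarith)
          rwa [dist_comm]
      _ = a k ^ (q - 1) * ν (G.cell δ ⁻¹' {k}) := setLIntegral_const _ _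
      _ ≤ a k ^ (q - 1) * a k := by gcongr; exact measure_mono hsub
      _ = posPow q (a k) := posPow_sub_one_mul ha0 (measure_ne_top _ _)
  refine (ENNReal.tsum_le_tsum hle).trans ?_
  refine tsum_posPow_le_of_rel hq0 R (fun k => ?_) (fun l => ?_)
    (fun k => measure_le_tsum_indicator (by simp) _ _)
  · refine hN δ hδ _ ?_
    rw [univ_inter]
    exact hnear k
  · refine (encard_le_encard ?_).trans (hN δ hδ (near l) (hnear l))
    rintro k ⟨y, ⟨-, x, hx, hxy⟩, hyl⟩
    exact ⟨x, ⟨y, hyl, by rwa [dist_comm]⟩, hx⟩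

/-- Among `K` concentric annuli of width `δ` one finds a scale at which the mass at most doubles. -/
theorem rpow_closedBall_le_lintegral [OpensMeasurableSpace X] {q : ℝ} (hq : 0 ≤ q) (hq1 : q ≤ 1)
    (ν : Measure X) [IsFiniteMeasure ν] (x : X) {s δ : ℝ} (hδ : 0 ≤ δ) (K : ℕ)
    (h0 : ν (Metric.closedBall x s) ≠ 0)
    (hK : ν (Metric.closedBall x (s + K * δ)) < 2 ^ K * ν (Metric.closedBall x s)) :
    ν (Metric.closedBall x s) ^ q ≤
      2 * ∫⁻ y in Metric.closedBall x (s + K * δ), ν (Metric.closedBall y δ) ^ (q - 1) ∂ν := by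
  set g : ℕ → ℝ≥0∞ := fun i => ν (Metric.closedBall x (s + i * δ)) with hg
  have hg0 : g 0 = ν (Metric.closedBall x s) := by simp [hg]
  have hmono : Monotone g := by
    intro i j hij
    refine measure_mono (Metric.closedBall_subset_closedBall ?_)
    gcongr
  have hpos : ∀ i, g i ≠ 0 := fun i h => h0 (by
    rw [← hg0]; exact le_antisymm (h ▸ hmono (Nat.zero_le i)) bot_le)
  -- If the mass more than doubled at each of the `K` steps, the largest ball would have at least `2
  -- ^ K` times the mass of the smallest.
  have hex : ∃ i < K, g (i + 1) ≤ 2 * g i := by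
    by_contra! hcon
    have : ∀ i ≤ K, 2 ^ i * g 0 ≤ g i := by
      intro i
      induction i with
      | zero => simp
      | succ i ih =>
        intro hi
        calc 2 ^ (i + 1) * g 0 = 2 * (2 ^ i * g 0) := by ring
          _ ≤ 2 * g i := by gcongr; exact ih (by omega)
          _ ≤ g (i + 1) := (hcon i (by omega)).le
    have h1 := this K le_rfl
    rw [hg0] at h1
    exact absurd hK (not_lt.2 h1)
  obtain ⟨i, hi, hdouble⟩ := hex
  have hfin : ∀ i, g i ≠ ∞ := fun i => measure_ne_top _ _
  rw [← hg0]
  calc g 0 ^ q ≤ g i ^ q := ENNReal.rpow_le_rpow (hmono (Nat.zero_le i)) hq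
    _ = g i ^ (q - 1) * g i := by
        rw [posPow_sub_one_mul (hpos i) (hfin i), posPow_of_ne_zero (hpos i)]
    _ = 2 * (2⁻¹ * g i ^ (q - 1)) * g i := by
        rw [← mul_assoc, ENNReal.mul_inv_cancel (by simp) (by simp), one_mul]
    -- Since `q - 1 ≥ -1`, one has `2⁻¹ ≤ 2 ^ (q - 1)`: a doubling of the mass costs at most the
    -- factor `2`.
    _ ≤ 2 * ((2 * g i) ^ (q - 1)) * g i := by
        gcongr
        rw [ENNReal.mul_rpow_of_ne_top (by simp) (hfin i)]
        gcongr
        rw [← ENNReal.rpow_neg_one]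
        exact ENNReal.rpow_le_rpow_of_exponent_le (by norm_num) (by linarith)
    _ ≤ 2 * (g (i + 1) ^ (q - 1)) * g i := by
        gcongr 2 * ?_ * _
        exact rpow_le_rpow_of_exponent_nonpos (by linarith) hdouble
    _ = 2 * ∫⁻ _y in Metric.closedBall x (s + i * δ), g (i + 1) ^ (q - 1) ∂ν := by
        rw [setLIntegral_const, mul_assoc]
    _ ≤ 2 * ∫⁻ y in Metric.closedBall x (s + i * δ), ν (Metric.closedBall y δ) ^ (q - 1) ∂ν := by
        gcongr 2 * ?_
        refine setLIntegral_mono' Metric.isClosed_closedBall.measurableSet fun y hy => ?_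
        refine rpow_le_rpow_of_exponent_nonpos (by linarith) (measure_mono ?_)
        refine Metric.closedBall_subset_closedBall' ?_
        have := Metric.mem_closedBall.1 hy
        push_cast
        linarith
    _ ≤ _ := by
        gcongr 2 * ?_
        refine lintegral_mono_set (Metric.closedBall_subset_closedBall ?_)
        gcongr

/-- For `q ≤ 1` a ball much heavier than its cell makes the integrand small. Passing to the larger
scale `s = K * δ` leaves room for a radius at which the mass at most doubles. Cells of size `s / 2`
of one colour are more than `8 * (s / 2) = 4 * s` apart, so the balls of radius `2 * s` used there
are disjoint and the local integrals add up to at most the whole one. -/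
theorem gridSum_le_lqIntegral [Nonempty X] [OpensMeasurableSpace X] {q : ℝ} (hq : 0 ≤ q) (hq1 : q ≤ 1) :
    ∃ n : ℕ, ∀ (ν : Measure X) [IsProbabilityMeasure ν], ν ν.supportᶜ = 0 →
      ∀ (δ : ℝ) (K : ℕ), 0 < δ → 1 ≤ K →
      (∀ x ∈ ν.support, 1 < 2 ^ K * ν (Metric.closedBall x (K * δ))) →
      G.gridSum q ν (K * δ / 2) ≤ n * (2 * lqIntegral ν q δ) := by
  obtain ⟨n, col, hcol⟩ := G.coloring 8
  refine ⟨n, fun ν _ hν δ K hδ hK hmass => tsum_le_of_color col _ fun c => ?_⟩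
  rw [lqIntegral_eq hν]
  have hK0 : (1 : ℝ) ≤ K := by exact_mod_cast hK
  set s := K * δ with hs
  have hspos : 0 < s := by positivity
  set F := G.cell (s / 2) with hF
  set T : Set G.K := {k | col k = c} ∩ {k | ν (F ⁻¹' {k}) ≠ 0} with hT
  choose! g hg hgF using fun (k : G.K) (hk : ν (F ⁻¹' {k}) ≠ 0) => G.exists_center hν hk
  have hdisj : Pairwise (Function.onFun Disjoint fun k : T => Metric.closedBall (g k) (2 * s)) := by
    intro k l hne
    refine Metric.closedBall_disjoint_closedBall ?_
    have hne' : F (g k) ≠ F (g l) := by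
      rw [hgF k k.2.2, hgF l l.2.2]
      exact fun h => hne (Subtype.ext h)
    have := hcol (s / 2) (by positivity) (g k) (g l) hne' (by
      rw [← hF, hgF k k.2.2, hgF l l.2.2]; exact k.2.1.trans l.2.1.symm)
    linarith
  calc ∑' k : {k | col k = c}, posPow q (ν (F ⁻¹' {(k : G.K)}))
      = ∑' k : T, posPow q (ν (F ⁻¹' {(k : G.K)})) := by
        rw [tsum_subtype {k | col k = c} fun k => posPow q (ν (F ⁻¹' {k})),
          tsum_subtype T fun k => posPow q (ν (F ⁻¹' {k}))]
        refine tsum_congr fun k => ?_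
        by_cases h0 : ν (F ⁻¹' {k}) = 0 <;> simp [hT, Set.indicator_apply, h0]
    _ ≤ ∑' k : T, 2 * ∫⁻ y in Metric.closedBall (g k) (2 * s),
          ν (Metric.closedBall y δ) ^ (q - 1) ∂ν := by
        refine ENNReal.tsum_le_tsum fun k => (posPow_le_rpow _ _).trans ?_
        have hgs := hg k k.2.2
        have h1 : ν (F ⁻¹' {(k : G.K)}) ≤ ν (Metric.closedBall (g k) s) := by
          refine measure_mono ?_
          have := G.cell_ball_subset (δ := s / 2) (by positivity) (x := g k) (r := s) (by linarith)
          rwa [← hF, hgF k k.2.2] at this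
        refine (ENNReal.rpow_le_rpow h1 hq).trans ?_
        have h2 := rpow_closedBall_le_lintegral hq hq1 ν (g k) (s := s) hδ.le K
          (measure_closedBall_ne_zero hgs hspos) (prob_le_one.trans_lt (hmass _ hgs))
        rwa [← hs, ← two_mul] at h2
    _ = 2 * ∫⁻ y in ⋃ k : T, Metric.closedBall (g k) (2 * s),
          ν (Metric.closedBall y δ) ^ (q - 1) ∂ν := by
        rw [ENNReal.tsum_mul_left,
          lintegral_iUnion (fun _ => Metric.isClosed_closedBall.measurableSet) hdisj]
    _ ≤ _ := by
        gcongr 2 * ?_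
        exact setLIntegral_le_lintegral _ _

end Compare

end Grid

/-! ### The `L^q`-integral from below for `q ≤ 1`; the grids of the line and of the plane -/

namespace Grid

/-- The number `K` of annuli is about `δ ^ (-η)`. This is large enough for `2 ^ K` to beat the
polynomial mass bound, and small enough that the passage from mesh `δ` to mesh `K * δ / 2` by
successive doublings, each at the cost of a factor `C`, loses only a small power of `δ`. -/
theorem gridSum_subExpLE_lqIntegral_of_le_one {X : Type*} [PseudoMetricSpace X] [MeasurableSpace X]
    [Nonempty X] [OpensMeasurableSpace X] (G : Grid X) {q : ℝ} (hq : 0 ≤ q) (hq1 : q ≤ 1)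
    (ν : Measure X) [IsProbabilityMeasure ν] (hν : ν ν.supportᶜ = 0) {c A : ℝ} (hc : 0 < c)
    (hA : 0 ≤ A) (hmass : ∀ x ∈ ν.support, ∀ r : ℝ, 0 < r → r ≤ 1 →
      ENNReal.ofReal (c * r ^ A) ≤ ν (Metric.closedBall x r)) :
    SubExpLE (G.gridSum q ν) (lqIntegral ν q) := by
  intro ε hε
  obtain ⟨n, hn⟩ := G.gridSum_le_lqIntegral hq hq1
  obtain ⟨C, hC, hscale⟩ := G.exists_gridSum_le hq (R := 2)
  obtain ⟨m, hm⟩ := pow_unbounded_of_one_lt C.toReal (one_lt_two)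
  have hCm : C ≤ 2 ^ m := by
    rw [← ENNReal.ofReal_toReal hC]
    refine (ENNReal.ofReal_le_ofReal hm.le).trans ?_
    rw [ENNReal.ofReal_pow (by norm_num)]
    simp
  -- The bound `1 / 2` keeps `K * δ ≤ 2 * δ ^ (1 / 2) ≤ 1` for `δ < 1 / 4`; the other bound makes
  -- the cost of the doublings, at most `δ ^ (-(η * m))`, no larger than `δ ^ (-(ε / 2))`.
  set η : ℝ := min (1 / 2) (ε / (2 * (m + 1))) with hη
  have hη0 : 0 < η := lt_min (by norm_num) (by positivity)
  have hη2 : η ≤ 1 / 2 := min_le_left _ _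
  have hηm : η * m ≤ ε / 2 := by
    have h1 : η ≤ ε / (2 * (m + 1)) := min_le_right _ _
    calc η * m ≤ ε / (2 * (m + 1)) * (m + 1) := by gcongr; linarith
      _ = ε / 2 := by field_simp
  have ht : Tendsto (fun δ : ℝ => δ ^ (-η)) (𝓝[>] 0) atTop :=
    tendsto_rpow_neg_nhdsGT_zero (neg_lt_zero.2 hη0)
  -- With `t = δ ^ (-η)`, the factor `2 ^ (-t)` outweighs `t ^ (A / η) = δ ^ (-A)`.
  have hexp := (tendsto_rpow_mul_exp_neg_mul_atTop_nhds_zero (A / η) (Real.log 2)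
    (Real.log_pos one_lt_two)).comp ht
  have h4 : ∀ᶠ δ in 𝓝[>] (0 : ℝ), δ < 1 / 4 :=
    eventually_nhdsWithin_of_eventually_nhds (eventually_lt_nhds (by norm_num))
  have hconst : ((n : ℝ≥0∞) * 2) ≠ ∞ := ENNReal.mul_ne_top (by simp) (by simp)
  filter_upwards [h4, hexp.eventually_lt_const hc, self_mem_nhdsWithin,
    eventually_le_ofReal_rpow_neg hconst (half_pos hε)] with δ hδ4 hδexp hδ hδn
  have hpos : (0 : ℝ) < δ := hδ
  have h1t : 1 ≤ δ ^ (-η) :=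
    Real.one_le_rpow_of_pos_of_le_one_of_nonpos hpos (by linarith) (by linarith)
  obtain ⟨k, hk1, hk2⟩ := exists_nat_pow_near h1t one_lt_two
  have hiter : ∀ j : ℕ, G.gridSum q ν δ ≤ C ^ j * G.gridSum q ν (2 ^ j * δ) := by
    intro j
    induction j with
    | zero => simp
    | succ j ih =>
      have hj : (0 : ℝ) < 2 ^ j * δ := by positivity
      have h := hscale ν (2 ^ j * δ) (2 ^ (j + 1) * δ) hj (by positivity)
        (by rw [pow_succ]; linarith) (by rw [pow_succ]; linarith)
      calc _ ≤ C ^ j * G.gridSum q ν (2 ^ j * δ) := ih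
        _ ≤ C ^ j * (C * G.gridSum q ν (2 ^ (j + 1) * δ)) := by gcongr
        _ = _ := by ring
  have hKδ : ((2 ^ (k + 1) : ℕ) : ℝ) * δ ≤ 1 := by
    push_cast
    calc (2 : ℝ) ^ (k + 1) * δ = 2 * 2 ^ k * δ := by ring
      _ ≤ 2 * δ ^ (-η) * δ := by gcongr
      _ = 2 * δ ^ (1 - η) := by
          rw [mul_assoc]; nth_rewrite 2 [← Real.rpow_one δ]
          rw [← Real.rpow_add hpos]; congr 2; ring
      _ ≤ 2 * δ ^ (1 / 2 : ℝ) := by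
          gcongr 2 * ?_
          exact Real.rpow_le_rpow_of_exponent_ge hpos (by linarith) (by linarith)
      _ ≤ 2 * (1 / 4) ^ (1 / 2 : ℝ) := by gcongr
      _ = 1 := by
          rw [show (1 / 4 : ℝ) = (1 / 2) ^ (2 : ℝ) by norm_num, ← Real.rpow_mul (by norm_num)]
          norm_num
  have hbig : 1 < 2 ^ (2 ^ (k + 1)) * (c * δ ^ A) := by
    have h1 : (δ ^ (-η)) ^ (A / η) = δ ^ (-A) := by
      rw [← Real.rpow_mul hpos.le]; congr 1; field_simp
    have h2 : Real.exp (-Real.log 2 * δ ^ (-η)) = ((2 : ℝ) ^ (δ ^ (-η)))⁻¹ := by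
      generalize δ ^ (-η) = t
      rw [Real.rpow_def_of_pos two_pos, ← Real.exp_neg]; congr 1; ring
    simp only [Function.comp_apply] at hδexp
    rw [h1, h2, Real.rpow_neg hpos.le, ← mul_inv, inv_lt_comm₀ (by positivity) hc] at hδexp
    have h3 : (2 : ℝ) ^ (δ ^ (-η)) ≤ 2 ^ (2 ^ (k + 1)) := by
      rw [← Real.rpow_natCast 2 (2 ^ (k + 1))]
      refine Real.rpow_le_rpow_of_exponent_le one_le_two ?_
      push_cast
      exact hk2.le
    have h4 : c * c⁻¹ < c * (δ ^ A * 2 ^ (δ ^ (-η))) := by gcongr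
    rw [mul_inv_cancel₀ hc.ne'] at h4
    calc 1 < c * (δ ^ A * 2 ^ (δ ^ (-η))) := h4
      _ ≤ c * (δ ^ A * 2 ^ (2 ^ (k + 1))) := by gcongr
      _ = _ := by ring
  have hmain := hn ν hν δ (2 ^ (k + 1)) hpos Nat.one_le_two_pow (by
    intro x hx
    have h1 := hmass x hx _ (by positivity) hKδ
    have h2 : ENNReal.ofReal (c * δ ^ A) ≤
        ν (Metric.closedBall x (((2 ^ (k + 1) : ℕ) : ℝ) * δ)) := by
      refine le_trans (ENNReal.ofReal_le_ofReal ?_) h1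
      gcongr
      have : (1 : ℝ) ≤ ((2 ^ (k + 1) : ℕ) : ℝ) := by exact_mod_cast Nat.one_le_two_pow
      nlinarith
    calc (1 : ℝ≥0∞) < ENNReal.ofReal (2 ^ (2 ^ (k + 1)) * (c * δ ^ A)) := by
          rw [← ENNReal.ofReal_one]
          exact (ENNReal.ofReal_lt_ofReal_iff (by linarith)).2 hbig
      _ = 2 ^ (2 ^ (k + 1)) * ENNReal.ofReal (c * δ ^ A) := by
          rw [ENNReal.ofReal_mul (by positivity), ENNReal.ofReal_pow (by norm_num)]
          simp
      _ ≤ _ := by gcongr)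
  have hKe : ((2 ^ (k + 1) : ℕ) : ℝ) * δ / 2 = 2 ^ k * δ := by push_cast; ring
  rw [hKe] at hmain
  have hCk : C ^ k ≤ ENNReal.ofReal (δ ^ (-(ε / 2))) := by
    calc C ^ k ≤ (2 ^ m) ^ k := by gcongr
      _ = ENNReal.ofReal ((2 ^ k) ^ m) := by
          rw [← pow_mul, ← pow_mul, mul_comm, ENNReal.ofReal_pow (by norm_num)]
          simp
      _ ≤ ENNReal.ofReal (δ ^ (-(ε / 2))) := by
          refine ENNReal.ofReal_le_ofReal ?_
          calc ((2 : ℝ) ^ k) ^ m ≤ (δ ^ (-η)) ^ m := by gcongr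
            _ = δ ^ (-(η * m)) := by
                rw [← Real.rpow_natCast, ← Real.rpow_mul hpos.le, neg_mul]
            _ ≤ δ ^ (-(ε / 2)) :=
                Real.rpow_le_rpow_of_exponent_ge hpos (by linarith) (by linarith)
  calc G.gridSum q ν δ ≤ C ^ k * G.gridSum q ν (2 ^ k * δ) := hiter k
    _ ≤ ENNReal.ofReal (δ ^ (-(ε / 2))) * (n * (2 * lqIntegral ν q δ)) := by gcongr
    _ = ENNReal.ofReal (δ ^ (-(ε / 2))) * (n * 2) * lqIntegral ν q δ := by ring
    _ ≤ ENNReal.ofReal (δ ^ (-(ε / 2))) * ENNReal.ofReal (δ ^ (-(ε / 2))) *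
        lqIntegral ν q δ := by gcongr
    _ = _ := by
        rw [← ENNReal.ofReal_mul (by positivity), ← Real.rpow_add hpos]
        congr 3; ring

/-- The half-open intervals `[kδ, (k+1)δ)`. -/
def real : Grid ℝ where
  K := ℤ
  countable := inferInstance
  cell δ x := ⌊x / δ⌋
  measurableSet δ k := measurableSet_preimage (by fun_prop) (measurableSet_singleton k)
  dist_le δ hδ x y h := by
    have h1 := Int.abs_sub_lt_one_of_floor_eq_floor h
    rw [← sub_div, abs_div, abs_of_pos hδ, div_lt_one hδ] at h1
    rw [Real.dist_eq]
    linarith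
  -- The colour is the residue of the index modulo some `m > |R| + 1`. Distinct congruent indices
  -- differ by at least `m`, so the points are at least `(m - 1) * δ > R * δ` apart.
  coloring R := by
    obtain ⟨m, hm⟩ := exists_nat_gt (|R| + 1)
    have hm0 : m ≠ 0 := by
      rintro rfl
      have := abs_nonneg R
      norm_num at hm
      linarith
    have : NeZero m := ⟨hm0⟩
    refine ⟨m, fun k => ZMod.finEquiv m |>.symm (k : ZMod m), fun δ hδ x y hne hcol => ?_⟩
    have h1 := (ZMod.intCast_eq_intCast_iff_dvd_sub _ _ _).1 ((ZMod.finEquiv m).symm.injective hcol)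
    have h2 : (m : ℤ) ≤ |⌊y / δ⌋ - ⌊x / δ⌋| :=
      Int.le_of_dvd (abs_pos.2 (sub_ne_zero.2 (Ne.symm hne))) ((dvd_abs _ _).2 h1)
    have h3 : (m : ℝ) ≤ |(⌊y / δ⌋ : ℝ) - ⌊x / δ⌋| := by exact_mod_cast h2
    have h4 : |(⌊y / δ⌋ : ℝ) - ⌊x / δ⌋| ≤ |y / δ - x / δ| + 1 := by
      have a1 := Int.floor_le (y / δ)
      have a2 := Int.lt_floor_add_one (y / δ)
      have b1 := Int.floor_le (x / δ)
      have b2 := Int.lt_floor_add_one (x / δ)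
      rw [abs_le]
      constructor
      · linarith [neg_abs_le (y / δ - x / δ)]
      · linarith [le_abs_self (y / δ - x / δ)]
    rw [← sub_div, abs_div, abs_of_pos hδ] at h4
    have h5 : R < |y - x| / δ := by linarith [le_abs_self R]
    rw [lt_div_iff₀ hδ] at h5
    rwa [dist_comm, Real.dist_eq]

theorem _root_.abs_coord_le_dist (x y : Plane) (j : Fin 2) : |x j - y j| ≤ dist x y := by
  rw [← Real.dist_eq]
  exact PiLp.dist_apply_le x y j

theorem _root_.dist_le_of_coord {x y : Plane} {r : ℝ} (h : ∀ j, |x j - y j| ≤ r) :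
    dist x y ≤ 2 * r := by
  have h0 := h 0
  have h1 := h 1
  have hr : 0 ≤ r := (abs_nonneg _).trans h0
  rw [EuclideanSpace.dist_eq, Fin.sum_univ_two, Real.dist_eq, Real.dist_eq]
  refine Real.sqrt_le_iff.2 ⟨by positivity, ?_⟩
  have h0' := pow_le_pow_left₀ (abs_nonneg _) h0 2
  have h1' := pow_le_pow_left₀ (abs_nonneg _) h1 2
  nlinarith [sq_nonneg r]

theorem _root_.measurable_coordProj (j : Fin 2) : Measurable (coordProj j) := by
  unfold coordProj; fun_prop

/-- Half-open squares of side `δ`. -/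
def plane : Grid Plane where
  K := Fin 2 → real.K
  countable := inferInstance
  cell δ x := fun j => real.cell δ (x j)
  measurableSet δ k := by
    have : (fun (x : Plane) (j : Fin 2) => real.cell δ (x j)) ⁻¹' {k} =
        ⋂ j, coordProj j ⁻¹' (real.cell δ ⁻¹' {k j}) := by
      ext x
      rw [mem_iInter]
      exact funext_iff
    rw [this]
    exact MeasurableSet.iInter fun j => measurable_coordProj j (real.measurableSet δ (k j))
  dist_le δ hδ x y h := by
    refine dist_le_of_coord fun j => ?_
    have h1 := Int.abs_sub_lt_one_of_floor_eq_floor (congrFun h j)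
    rw [← sub_div, abs_div, abs_of_pos hδ, div_lt_one hδ] at h1
    exact h1.le
  coloring R := by
    obtain ⟨n, col, hcol⟩ := real.coloring R
    refine ⟨_, fun k => Fintype.equivFin (Fin 2 → Fin n) fun j => col (k j),
      fun δ hδ x y hne h => ?_⟩
    have h' := congrFun ((Fintype.equivFin (Fin 2 → Fin n)).injective h)
    obtain ⟨j, hj⟩ := Function.ne_iff.1 hne
    exact (hcol δ hδ (x j) (y j) hj (h' j)).trans_le (PiLp.dist_apply_le x y j)

end Grid

/-! ### The coordinate form of the maps -/

/-- A linear isometry of the plane preserving the square `[-1,1]²` is a signed permutation of the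
coordinates. -/
theorem exists_signed_perm (L : Plane ≃ₗᵢ[ℝ] Plane)
    (hL : L '' {x : Plane | ∀ j, x j ∈ Icc (-1 : ℝ) 1} = {x : Plane | ∀ j, x j ∈ Icc (-1 : ℝ) 1}) :
    ∃ (σ : Equiv.Perm (Fin 2)) (ε : Fin 2 → ℝ), (∀ j, |ε j| = 1) ∧
      ∀ x j, L x j = ε j * x (σ j) := by
  -- The vertices `e` and `f` have norm `√2`, and so do their images, which lie in the square; hence
  -- the images are vertices too. Being orthogonal, they agree in one coordinate and are opposite in
  -- the other.
  set e : Plane := !₂[1, 1] with he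
  set f : Plane := !₂[1, -1] with hf
  have hmem : ∀ x : Plane, (∀ j, x j ∈ Icc (-1 : ℝ) 1) → ∀ j, L x j ∈ Icc (-1 : ℝ) 1 := by
    intro x hx
    have : L x ∈ L '' {x : Plane | ∀ j, x j ∈ Icc (-1 : ℝ) 1} := mem_image_of_mem _ hx
    rw [hL] at this
    exact this
  have hsq : ∀ x : Plane, (∀ j, x j ∈ Icc (-1 : ℝ) 1) → x 0 ^ 2 + x 1 ^ 2 = 2 →
      L x 0 ^ 2 = 1 ∧ L x 1 ^ 2 = 1 := by
    intro x hx h2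
    have h0 := hmem x hx 0
    have h1 := hmem x hx 1
    have hn : ‖L x‖ ^ 2 = ‖x‖ ^ 2 := by rw [L.norm_map]
    rw [EuclideanSpace.norm_sq_eq, EuclideanSpace.norm_sq_eq, Fin.sum_univ_two, Fin.sum_univ_two]
      at hn
    simp only [Real.norm_eq_abs, sq_abs] at hn
    have a0 : L x 0 ^ 2 ≤ 1 := by nlinarith [h0.1, h0.2]
    have a1 : L x 1 ^ 2 ≤ 1 := by nlinarith [h1.1, h1.2]
    constructor <;> linarith
  have hue := hsq e (by intro j; fin_cases j <;> simp [he]) (by simp [he]; norm_num)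
  have huf := hsq f (by intro j; fin_cases j <;> simp [hf]) (by simp [hf]; norm_num)
  have hinner : L e 0 * L f 0 + L e 1 * L f 1 = 0 := by
    have h := L.inner_map_map e f
    rw [PiLp.inner_apply, PiLp.inner_apply, Fin.sum_univ_two, Fin.sum_univ_two] at h
    simp [he, hf] at h
    linarith
  have hdecomp : ∀ x : Plane, ∀ j,
      L x j = (x 0 + x 1) / 2 * L e j + (x 0 - x 1) / 2 * L f j := by
    intro x j
    have hx : x = ((x 0 + x 1) / 2) • e + ((x 0 - x 1) / 2) • f := by
      ext j
      fin_cases j <;> simp [he, hf] <;> ring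
    conv_lhs => rw [hx]
    simp
  have habs : ∀ t : ℝ, t ^ 2 = 1 → |t| = 1 := fun t ht => by
    rw [← sq_abs] at ht
    nlinarith [abs_nonneg t]
  have hpm : ∀ a b : ℝ, a ^ 2 = 1 → b ^ 2 = 1 → b = a ∨ b = -a := fun a b ha hb =>
    sq_eq_sq_iff_eq_or_eq_neg.1 (by rw [ha, hb])
  -- The coordinate in which the images of `e` and `f` agree depends on `x 0` only, the other one on
  -- `x 1` only.
  refine ⟨if L f 0 = L e 0 then 1 else Equiv.swap 0 1, fun j => L e j, ?_, ?_⟩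
  · intro j
    fin_cases j
    · exact habs _ hue.1
    · exact habs _ hue.2
  · intro x j
    rw [hdecomp x j]
    rcases hpm _ _ hue.1 huf.1 with h0 | h0
    · rw [if_pos h0]
      rw [h0] at hinner
      have h1 : L f 1 = -L e 1 := by
        rcases hpm _ _ hue.2 huf.2 with h | h
        · rw [h] at hinner; nlinarith [hue.1, hue.2]
        · exact h
      fin_cases j
      · simp [h0]; ring
      · simp [h1]; ring
    · have hne : L f 0 ≠ L e 0 := by
        intro h; rw [h] at h0
        have : L e 0 = 0 := by linarith
        have h2 := hue.1
        rw [this] at h2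
        norm_num at h2
      rw [if_neg hne]
      rw [h0] at hinner
      have h1 : L f 1 = L e 1 := by
        rcases hpm _ _ hue.2 huf.2 with h | h
        · exact h
        · rw [h] at hinner; nlinarith [hue.1, hue.2]
      fin_cases j
      · simp [h0]; ring
      · simp [h1]; ring

namespace BoxLikeIFS

variable {ι : Type*} [Fintype ι] (Φ : BoxLikeIFS ι)

/-- The contraction ratio of `Sᵢ` in the target coordinate `j`. -/
def ratio (i : ι) (j : Fin 2) : ℝ := if j = 0 then Φ.c i else Φ.d i

theorem ratio_mem (i : ι) (j : Fin 2) : Φ.ratio i j ∈ Ioo (0 : ℝ) 1 := by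
  unfold ratio; split_ifs
  exacts [Φ.c_mem i, Φ.d_mem i]

theorem exists_lin_apply (i : ι) : ∃ (σ : Equiv.Perm (Fin 2)) (a : Fin 2 → ℝ),
    (∀ j, |a j| = Φ.ratio i j) ∧ ∀ x j, Φ.lin i x j = a j * x (σ j) := by
  obtain ⟨σ, ε, hε, h⟩ := exists_signed_perm (Φ.L i) (Φ.L_square i)
  refine ⟨σ, fun j => Φ.ratio i j * ε j, fun j => ?_, fun x j => ?_⟩
  · rw [abs_mul, hε, mul_one, abs_of_pos (Φ.ratio_mem i j).1]
  · have : Φ.lin i x j = Φ.ratio i j * Φ.L i x j := by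
      fin_cases j <;> simp [lin, ratio, Matrix.toLpLin_apply, dotProduct]
    rw [this, h, mul_assoc]

/-- The permutation of the coordinates underlying `Sᵢ`. -/
def perm (i : ι) : Equiv.Perm (Fin 2) := (Φ.exists_lin_apply i).choose

/-- The permutation of the coordinates underlying `S_w`. -/
def wordPerm : List ι → Equiv.Perm (Fin 2)
  | [] => 1
  -- Coordinate `j` of `S_i` reads coordinate `perm i j` of its argument, so the permutation of the
  -- first letter acts first.
  | i :: w => wordPerm w * Φ.perm i

/-- The contraction ratio of `S_w` in the target coordinate `j`. -/
def wordRatio : List ι → Fin 2 → ℝ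
  | [], _ => 1
  | i :: w, j => Φ.ratio i j * wordRatio w (Φ.perm i j)

theorem wordRatio_append (u v : List ι) (j : Fin 2) :
    Φ.wordRatio (u ++ v) j = Φ.wordRatio u j * Φ.wordRatio v (Φ.wordPerm u j) := by
  induction u generalizing j with
  | nil => simp [wordRatio, wordPerm]
  | cons i u ih =>
    simp only [List.cons_append, wordRatio, ih]
    rw [mul_assoc]; rfl

theorem wordMap_append (u v : List ι) : Φ.wordMap (u ++ v) = Φ.wordMap u ∘ Φ.wordMap v := by
  induction u with
  | nil => rfl
  | cons i u ih => simp only [List.cons_append, wordMap, ih, Function.comp_assoc]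

theorem wordRatio_pos (w : List ι) (j : Fin 2) : 0 < Φ.wordRatio w j := by
  induction w generalizing j with
  | nil => simp [wordRatio]
  | cons i w ih => exact mul_pos (Φ.ratio_mem i j).1 (ih _)

theorem wordRatio_singleton (i : ι) (j : Fin 2) : Φ.wordRatio [i] j = Φ.ratio i j := by
  simp [wordRatio]

theorem exists_wordLin_apply (w : List ι) : ∃ a : Fin 2 → ℝ,
    (∀ j, |a j| = Φ.wordRatio w j) ∧ ∀ x j, Φ.wordLin w x j = a j * x (Φ.wordPerm w j) := by
  induction w with
  | nil => exact ⟨fun _ => 1, by simp [wordRatio], by simp [wordLin, wordPerm]⟩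
  | cons i w ih =>
    obtain ⟨a, ha, h⟩ := ih
    obtain ⟨b, hb, h'⟩ := (Φ.exists_lin_apply i).choose_spec
    refine ⟨fun j => b j * a (Φ.perm i j), fun j => ?_, fun x j => ?_⟩
    · rw [abs_mul, hb, ha]; rfl
    · simp only [wordLin, LinearMap.comp_apply]
      rw [h', h, mul_assoc]
      rfl

theorem exists_wordMap_apply (w : List ι) : ∃ a t : Fin 2 → ℝ,
    (∀ j, |a j| = Φ.wordRatio w j) ∧
      ∀ x j, Φ.wordMap w x j = a j * x (Φ.wordPerm w j) + t j := by
  obtain ⟨a, ha, h⟩ := Φ.exists_wordLin_apply w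
  refine ⟨a, fun j => Φ.wordMap w 0 j, ha, fun x j => ?_⟩
  have h1 := Φ.wordMap_sub w x 0
  rw [sub_zero] at h1
  rw [← h, ← h1]
  simp

theorem abs_wordMap_sub (w : List ι) (x y : Plane) (j : Fin 2) :
    |Φ.wordMap w x j - Φ.wordMap w y j| =
      Φ.wordRatio w j * |x (Φ.wordPerm w j) - y (Φ.wordPerm w j)| := by
  obtain ⟨a, t, ha, h⟩ := Φ.exists_wordMap_apply w
  rw [h, h, ← ha, ← abs_mul]
  congr 1; ring

theorem measurable_wordMap (w : List ι) : Measurable (Φ.wordMap w) := by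
  obtain ⟨a, t, ha, h⟩ := Φ.exists_wordMap_apply w
  have : Φ.wordMap w = fun x => WithLp.toLp 2 fun j => a j * x (Φ.wordPerm w j) + t j := by
    ext x j; simp [h]
  rw [this]
  fun_prop

theorem wordMap_singleton (i : ι) : Φ.wordMap [i] = Φ.S i := rfl

theorem measurable_S (i : ι) : Measurable (Φ.S i) := Φ.measurable_wordMap [i]

theorem wordMap_surjective (w : List ι) : Function.Surjective (Φ.wordMap w) := by
  obtain ⟨a, t, ha, h⟩ := Φ.exists_wordMap_apply w
  have ha0 : ∀ j, a j ≠ 0 := fun j h0 => by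
    have := ha j
    rw [h0, abs_zero] at this
    exact (Φ.wordRatio_pos w j).ne this
  intro y
  refine ⟨WithLp.toLp 2 fun l => (y ((Φ.wordPerm w).symm l) - t ((Φ.wordPerm w).symm l)) /
    a ((Φ.wordPerm w).symm l), ?_⟩
  ext j
  rw [h]
  simp only [Equiv.symm_apply_apply]
  rw [mul_div_cancel₀ _ (ha0 j)]
  ring

theorem perm_eq_one_or_swap (σ : Equiv.Perm (Fin 2)) : σ = 1 ∨ σ = Equiv.swap 0 1 := by
  revert σ; decide

/-- If the coordinates were swapped, the second coordinate of the image would vary along a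
horizontal line, since no contraction ratio vanishes. -/
theorem isTypeA_iff (w : List ι) : Φ.IsTypeA w ↔ Φ.wordPerm w = 1 := by
  obtain ⟨a, t, ha, h⟩ := Φ.exists_wordMap_apply w
  constructor
  · intro hA
    obtain ⟨b, hb⟩ := hA 0
    rcases perm_eq_one_or_swap (Φ.wordPerm w) with h1 | h1
    · exact h1
    · exfalso
      have hm : ∀ s : ℝ, Φ.wordMap w !₂[s, 0] 1 = b := by
        intro s
        have : Φ.wordMap w !₂[s, 0] ∈ Φ.wordMap w '' {x : Plane | x 1 = 0} :=
          mem_image_of_mem _ (by simp)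
        rw [hb] at this
        exact this
      have h2 := (hm 1).trans (hm 0).symm
      rw [h, h, h1] at h2
      simp at h2
      have := ha 1
      rw [h2, abs_zero] at this
      exact (Φ.wordRatio_pos w 1).ne this
  · intro h1 s
    refine ⟨a 1 * s + t 1, ?_⟩
    ext y
    constructor
    · rintro ⟨x, hx, rfl⟩
      have hx' : x 1 = s := hx
      simp [h, h1, hx']
    · intro hy
      obtain ⟨x, rfl⟩ := Φ.wordMap_surjective w y
      refine ⟨x, ?_, rfl⟩
      have hy' : Φ.wordMap w x 1 = a 1 * s + t 1 := hy
      rw [h, h1] at hy'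
      have ha1 : a 1 ≠ 0 := fun h0 => by
        have := ha 1
        rw [h0, abs_zero] at this
        exact (Φ.wordRatio_pos w 1).ne this
      simpa [ha1] using hy'

theorem isTypeB_iff (w : List ι) : Φ.IsTypeB w ↔ Φ.wordPerm w = Equiv.swap 0 1 := by
  obtain ⟨a, t, ha, h⟩ := Φ.exists_wordMap_apply w
  constructor
  · intro hA
    obtain ⟨b, hb⟩ := hA 0
    rcases perm_eq_one_or_swap (Φ.wordPerm w) with h1 | h1
    · exfalso
      have hm : ∀ s : ℝ, Φ.wordMap w !₂[s, 0] 0 = b := by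
        intro s
        have : Φ.wordMap w !₂[s, 0] ∈ Φ.wordMap w '' {x : Plane | x 1 = 0} :=
          mem_image_of_mem _ (by simp)
        rw [hb] at this
        exact this
      have h2 := (hm 1).trans (hm 0).symm
      rw [h, h, h1] at h2
      simp at h2
      have := ha 0
      rw [h2, abs_zero] at this
      exact (Φ.wordRatio_pos w 0).ne this
    · exact h1
  · intro h1 s
    refine ⟨a 0 * s + t 0, ?_⟩
    ext y
    constructor
    · rintro ⟨x, hx, rfl⟩
      have hx' : x 1 = s := hx
      simp [h, h1, hx']
    · intro hy
      obtain ⟨x, rfl⟩ := Φ.wordMap_surjective w y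
      refine ⟨x, ?_, rfl⟩
      have hy' : Φ.wordMap w x 0 = a 0 * s + t 0 := hy
      rw [h, h1] at hy'
      have ha1 : a 0 ≠ 0 := fun h0 => by
        have := ha 0
        rw [h0, abs_zero] at this
        exact (Φ.wordRatio_pos w 0).ne this
      simpa [ha1] using hy'

theorem side_eq (j : Fin 2) (w : List ι) : Φ.side j w = Φ.wordRatio w j := by
  set Q : Set Plane := {x : Plane | ∀ l, x l ∈ Icc (0 : ℝ) 1} with hQ
  have hdist : ∀ x ∈ Q, ∀ y ∈ Q,
      dist (coordProj j (Φ.wordMap w x)) (coordProj j (Φ.wordMap w y)) ≤ Φ.wordRatio w j := by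
    intro x hx y hy
    rw [Real.dist_eq]
    unfold coordProj
    rw [Φ.abs_wordMap_sub]
    have h1 := hx (Φ.wordPerm w j)
    have h2 := hy (Φ.wordPerm w j)
    have h3 : |x (Φ.wordPerm w j) - y (Φ.wordPerm w j)| ≤ 1 := by
      rw [abs_le]; constructor <;> linarith [h1.1, h1.2, h2.1, h2.2]
    exact mul_le_of_le_one_right (Φ.wordRatio_pos w j).le h3
  unfold side
  apply le_antisymm
  · refine Metric.diam_le_of_forall_dist_le (Φ.wordRatio_pos w j).le ?_
    rintro _ ⟨_, ⟨x, hx, rfl⟩, rfl⟩ _ ⟨_, ⟨y, hy, rfl⟩, rfl⟩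
    exact hdist x hx y hy
  · have hb : Bornology.IsBounded (coordProj j '' (Φ.wordMap w '' Q)) := by
      rw [Metric.isBounded_iff]
      refine ⟨Φ.wordRatio w j, ?_⟩
      rintro _ ⟨_, ⟨x, hx, rfl⟩, rfl⟩ _ ⟨_, ⟨y, hy, rfl⟩, rfl⟩
      exact hdist x hx y hy
    have h0 : (0 : Plane) ∈ Q := by intro l; simp
    have h1 : (!₂[1, 1] : Plane) ∈ Q := by intro l; fin_cases l <;> simp
    have := Metric.dist_le_diam_of_mem hb (mem_image_of_mem _ (mem_image_of_mem _ h1))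
      (mem_image_of_mem _ (mem_image_of_mem _ h0))
    refine le_trans ?_ this
    rw [Real.dist_eq]
    unfold coordProj
    rw [Φ.abs_wordMap_sub]
    generalize Φ.wordPerm w j = l
    fin_cases l <;> simp

/-- The coordinate direction of a longer side of the rectangle `S_w([0,1]²)`. -/
def longIndex (w : List ι) : Fin 2 := if Φ.wordRatio w 1 ≤ Φ.wordRatio w 0 then 0 else 1

/-- The case distinction defining `π_w` amounts to a single rule: project to the coordinate that
`S_w` carries to the longer side of the rectangle. -/
theorem projIndex_eq (w : List ι) : Φ.projIndex w = Φ.wordPerm w (Φ.longIndex w) := by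
  unfold projIndex longIndex
  rw [Φ.isTypeA_iff, Φ.isTypeB_iff, Φ.side_eq, Φ.side_eq]
  have hne : (1 : Equiv.Perm (Fin 2)) ≠ Equiv.swap 0 1 := by decide
  rcases perm_eq_one_or_swap (Φ.wordPerm w) with h | h
  · rw [h]
    by_cases h1 : Φ.wordRatio w 1 ≤ Φ.wordRatio w 0 <;> simp [h1, hne]
  · rw [h]
    by_cases h1 : Φ.wordRatio w 1 ≤ Φ.wordRatio w 0
    · simp [h1, hne.symm, not_lt.2 h1]
    · simp [h1, not_le.1 h1]

end BoxLikeIFS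

/-! ### Singular values and uniform bounds for the contraction ratios -/

namespace BoxLikeIFS

variable {ι : Type*} [Fintype ι] (Φ : BoxLikeIFS ι)

/-- The composite of the linear part with its adjoint is diagonal in the standard basis, with the
squared ratios as entries. Testing an eigenvector against the basis shows that each singular value
is one of the two ratios; the trace shows that both ratios occur, and the ordering of the singular
values does the rest. -/
theorem alpha_eq (w : List ι) :
    Φ.alpha₁ w = max (Φ.wordRatio w 0) (Φ.wordRatio w 1) ∧
    Φ.alpha₂ w = min (Φ.wordRatio w 0) (Φ.wordRatio w 1) := by
  obtain ⟨a, ha, h⟩ := Φ.exists_wordLin_apply w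
  set T := Φ.wordLin w with hT
  set r := Φ.wordRatio w with hr
  have hrank : Module.finrank ℝ Plane = 2 := by simp
  have hinner : ∀ x y : Plane,
      inner ℝ (T.adjoint (T x)) y = r 0 ^ 2 * (x (Φ.wordPerm w 0) * y (Φ.wordPerm w 0)) +
        r 1 ^ 2 * (x (Φ.wordPerm w 1) * y (Φ.wordPerm w 1)) := by
    intro x y
    rw [LinearMap.adjoint_inner_left, PiLp.inner_apply, Fin.sum_univ_two, h, h, h, h, ← ha, ← ha,
      sq_abs, sq_abs]
    simp only [RCLike.inner_apply, conj_trivial]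
    ring
  have hmem : ∀ n : ℕ, n < 2 → T.singularValues n = r 0 ∨ T.singularValues n = r 1 := by
    intro n hn
    have hev := T.hasEigenvalue_adjoint_comp_self_sq_singularValues (n := n) (by rw [hrank]; exact hn)
    obtain ⟨x, hx⟩ := hev.exists_hasEigenvector
    have hx1 : T.adjoint (T x) = T.singularValues n ^ 2 • x := hx.apply_eq_smul
    have key : ∀ j, x (Φ.wordPerm w j) ≠ 0 → T.singularValues n = r j := by
      intro j hj
      have h1 := hinner x (EuclideanSpace.single (Φ.wordPerm w j) 1)
      rw [hx1, inner_smul_left, PiLp.inner_apply, Fin.sum_univ_two] at h1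
      have hne : Φ.wordPerm w 0 ≠ Φ.wordPerm w 1 := by
        simp
      have h2 : T.singularValues n ^ 2 = r j ^ 2 := by
        refine mul_right_cancel₀ hj ?_
        have hsum : (x : Plane) 0 * (EuclideanSpace.single (Φ.wordPerm w j) (1 : ℝ) : Plane) 0 +
            x 1 * (EuclideanSpace.single (Φ.wordPerm w j) (1 : ℝ) : Plane) 1 =
            x (Φ.wordPerm w j) := by
          generalize Φ.wordPerm w j = l
          fin_cases l <;> simp
        simp only [RCLike.inner_apply, conj_trivial] at h1
        rw [mul_comm ((EuclideanSpace.single (Φ.wordPerm w j) (1 : ℝ) : Plane) 0),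
          mul_comm ((EuclideanSpace.single (Φ.wordPerm w j) (1 : ℝ) : Plane) 1), hsum] at h1
        rw [h1]
        fin_cases j <;> simp
      exact (pow_left_inj₀ (T.singularValues_nonneg n) (Φ.wordRatio_pos w j).le two_ne_zero).1 h2
    by_contra! hcon
    have hz : ∀ j, x (Φ.wordPerm w j) = 0 := by
      intro j
      by_contra hj
      have := key j hj
      fin_cases j
      · exact hcon.1 this
      · exact hcon.2 this
    apply hx.2
    ext l
    have := hz ((Φ.wordPerm w).symm l)
    rwa [Equiv.apply_symm_apply] at this
  have htrace : T.singularValues 0 ^ 2 + T.singularValues 1 ^ 2 = r 0 ^ 2 + r 1 ^ 2 := by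
    have h1 := T.isSymmetric_adjoint_comp_self.trace_eq_sum_eigenvalues hrank
    rw [LinearMap.trace_eq_sum_inner _ (EuclideanSpace.basisFun (Fin 2) ℝ), Fin.sum_univ_two,
      Fin.sum_univ_two] at h1
    have e0 := T.sq_singularValues_fin hrank 0
    have e1 := T.sq_singularValues_fin hrank 1
    simp only [LinearMap.comp_apply] at h1
    rw [real_inner_comm, hinner, real_inner_comm, hinner] at h1
    simp only [RCLike.ofReal_real_eq_id, id] at h1
    rw [← e0, ← e1] at h1
    simp only [Fin.val_zero, Fin.val_one] at h1
    rw [← h1]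
    rcases perm_eq_one_or_swap (Φ.wordPerm w) with h2 | h2 <;> simp [h2]
    ring
  have hanti : T.singularValues 1 ≤ T.singularValues 0 := T.singularValues_antitone zero_le_one
  have hp0 := Φ.wordRatio_pos w 0
  have hp1 := Φ.wordRatio_pos w 1
  have h0 := hmem 0 (by norm_num)
  have h1 := hmem 1 (by norm_num)
  have hsq : ∀ x y : ℝ, 0 ≤ x → 0 ≤ y → x ^ 2 = y ^ 2 → x = y := fun x y hx hy h =>
    (pow_left_inj₀ hx hy two_ne_zero).1 h
  change T.singularValues 0 = _ ∧ T.singularValues 1 = _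
  have n0 := T.singularValues_nonneg 0
  have n1 := T.singularValues_nonneg 1
  rcases h0 with h0 | h0
  · have e1 : T.singularValues 1 = r 1 := hsq _ _ n1 hp1.le (by rw [h0] at htrace; linarith)
    rw [h0, e1] at hanti ⊢
    exact ⟨(max_eq_left hanti).symm, (min_eq_right hanti).symm⟩
  · have e1 : T.singularValues 1 = r 0 := hsq _ _ n1 hp0.le (by rw [h0] at htrace; linarith)
    rw [h0, e1] at hanti ⊢
    exact ⟨(max_eq_right hanti).symm, (min_eq_left hanti).symm⟩

theorem alpha₁_eq (w : List ι) : Φ.alpha₁ w = Φ.wordRatio w (Φ.longIndex w) := by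
  rw [(Φ.alpha_eq w).1, longIndex]
  split_ifs with h
  · exact max_eq_left h
  · exact max_eq_right (not_le.1 h).le

theorem alpha₂_eq (w : List ι) : Φ.alpha₂ w = Φ.wordRatio w (1 - Φ.longIndex w) := by
  rw [(Φ.alpha_eq w).2, longIndex]
  split_ifs with h
  · simpa using h
  · simpa using (not_le.1 h).le

theorem alpha₂_le (w : List ι) (j : Fin 2) : Φ.alpha₂ w ≤ Φ.wordRatio w j := by
  rw [(Φ.alpha_eq w).2]
  fin_cases j
  · exact min_le_left _ _
  · exact min_le_right _ _

theorem alpha₂_pos (w : List ι) : 0 < Φ.alpha₂ w := by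
  rw [alpha₂_eq]; exact Φ.wordRatio_pos _ _

theorem alpha₂_le_alpha₁ (w : List ι) : Φ.alpha₂ w ≤ Φ.alpha₁ w := by
  rw [alpha₁_eq]; exact Φ.alpha₂_le _ _

theorem alpha₁_pos (w : List ι) : 0 < Φ.alpha₁ w := (Φ.alpha₂_pos w).trans_le (Φ.alpha₂_le_alpha₁ w)

theorem le_alpha₂ (w : List ι) {x : ℝ} (h : ∀ j, x ≤ Φ.wordRatio w j) : x ≤ Φ.alpha₂ w := by
  rw [alpha₂_eq]; exact h _

theorem alpha₁_le (w : List ι) {x : ℝ} (h : ∀ j, Φ.wordRatio w j ≤ x) : Φ.alpha₁ w ≤ x := by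
  rw [alpha₁_eq]; exact h _

theorem nonempty_index {ι : Type*} [Fintype ι] (Φ : BoxLikeIFS ι) : Nonempty ι :=
  Fintype.card_pos_iff.1 (by have := Φ.two_le_card; omega)

theorem exists_ratio_bounds : ∃ a b : ℝ, 0 < a ∧ a < 1 ∧ 0 < b ∧ b < 1 ∧
    ∀ i j, a ≤ Φ.ratio i j ∧ Φ.ratio i j ≤ b := by
  have : Nonempty ι := Φ.nonempty_index
  obtain ⟨m, hm⟩ := Finite.exists_min fun x : ι × Fin 2 => Φ.ratio x.1 x.2
  obtain ⟨M, hM⟩ := Finite.exists_max fun x : ι × Fin 2 => Φ.ratio x.1 x.2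
  have h1 := Φ.ratio_mem m.1 m.2
  have h2 := Φ.ratio_mem M.1 M.2
  exact ⟨_, _, h1.1, h1.2, h2.1, h2.2, fun i j => ⟨hm (i, j), hM (i, j)⟩⟩

/-- A lower bound for all contraction ratios. -/
def ratioMin : ℝ := Φ.exists_ratio_bounds.choose

/-- An upper bound for all contraction ratios. -/
def ratioMax : ℝ := Φ.exists_ratio_bounds.choose_spec.choose

theorem ratioMin_pos : 0 < Φ.ratioMin := Φ.exists_ratio_bounds.choose_spec.choose_spec.1
theorem ratioMin_lt_one : Φ.ratioMin < 1 := Φ.exists_ratio_bounds.choose_spec.choose_spec.2.1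
theorem ratioMax_pos : 0 < Φ.ratioMax := Φ.exists_ratio_bounds.choose_spec.choose_spec.2.2.1
theorem ratioMax_lt_one : Φ.ratioMax < 1 := Φ.exists_ratio_bounds.choose_spec.choose_spec.2.2.2.1
theorem ratioMin_le (i : ι) (j : Fin 2) : Φ.ratioMin ≤ Φ.ratio i j :=
  (Φ.exists_ratio_bounds.choose_spec.choose_spec.2.2.2.2 i j).1
theorem le_ratioMax (i : ι) (j : Fin 2) : Φ.ratio i j ≤ Φ.ratioMax :=
  (Φ.exists_ratio_bounds.choose_spec.choose_spec.2.2.2.2 i j).2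

theorem wordRatio_le (w : List ι) (j : Fin 2) : Φ.wordRatio w j ≤ Φ.ratioMax ^ w.length := by
  induction w generalizing j with
  | nil => simp [wordRatio]
  | cons i w ih =>
    rw [wordRatio, List.length_cons, pow_succ']
    exact mul_le_mul (Φ.le_ratioMax i j) (ih _) (Φ.wordRatio_pos _ _).le Φ.ratioMax_pos.le

theorem wordRatio_le_one (w : List ι) (j : Fin 2) : Φ.wordRatio w j ≤ 1 :=
  (Φ.wordRatio_le w j).trans (pow_le_one₀ Φ.ratioMax_pos.le Φ.ratioMax_lt_one.le)

theorem le_wordRatio (w : List ι) (j : Fin 2) : Φ.ratioMin ^ w.length ≤ Φ.wordRatio w j := by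
  induction w generalizing j with
  | nil => simp [wordRatio]
  | cons i w ih =>
    rw [wordRatio, List.length_cons, pow_succ']
    exact mul_le_mul (Φ.ratioMin_le i j) (ih _) (pow_nonneg Φ.ratioMin_pos.le _)
      (Φ.ratio_mem i j).1.le

theorem wordRatio_append_singleton_ge (w : List ι) (i : ι) (j : Fin 2) :
    Φ.ratioMin * Φ.wordRatio w j ≤ Φ.wordRatio (w ++ [i]) j := by
  rw [wordRatio_append, wordRatio_singleton, mul_comm]
  exact mul_le_mul_of_nonneg_left (Φ.ratioMin_le _ _) (Φ.wordRatio_pos _ _).le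

theorem alpha₂_append_singleton_ge (w : List ι) (i : ι) :
    Φ.ratioMin * Φ.alpha₂ w ≤ Φ.alpha₂ (w ++ [i]) := by
  refine Φ.le_alpha₂ _ fun j => le_trans ?_ (Φ.wordRatio_append_singleton_ge w i j)
  exact mul_le_mul_of_nonneg_left (Φ.alpha₂_le w j) Φ.ratioMin_pos.le

theorem wordProb_append (u v : List ι) :
    Φ.wordProb (u ++ v) = Φ.wordProb u * Φ.wordProb v := by simp [wordProb]

theorem wordProb_pos (w : List ι) : 0 < Φ.wordProb w := by
  induction w with
  | nil => simp [wordProb]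
  | cons i w ih =>
    have : Φ.wordProb (i :: w) = Φ.p i * Φ.wordProb w := by simp [wordProb]
    rw [this]
    exact mul_pos (Φ.p_mem i).1 ih

end BoxLikeIFS

/-! ### Stopping families of words -/

section Stop

variable {ι : Type*} [Fintype ι]

open Classical in
/-- The words at which the predicate `p` first holds along the tree of words, truncated at
length `n`. -/
def stopWords : ℕ → (List ι → Prop) → Finset (List ι)
  | 0, _ => {[]}
  | n + 1, p => if p [] then {[]} else
      Finset.univ.biUnion fun i => (stopWords n fun w => p (i :: w)).image (i :: ·)

theorem stopWords_succ_of_pos {n : ℕ} {p : List ι → Prop} (h : p []) : stopWords (n + 1) p = {[]} := by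
  simp [stopWords, h]

theorem sum_stopWords_succ {M : Type*} [AddCommMonoid M] {n : ℕ} {p : List ι → Prop} (h : ¬ p [])
    (F : List ι → M) :
    ∑ w ∈ stopWords (n + 1) p, F w = ∑ i, ∑ w ∈ stopWords n (fun w => p (i :: w)), F (i :: w) := by
  classical
  rw [stopWords, if_neg h, Finset.sum_biUnion]
  · refine Finset.sum_congr rfl fun i _ => ?_
    rw [Finset.sum_image]
    intro u _ v _ huv
    exact (List.cons.inj huv).2
  · intro i _ j _ hij
    refine Finset.disjoint_left.2 fun w hi hj => hij ?_
    obtain ⟨u, -, rfl⟩ := Finset.mem_image.1 hi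
    obtain ⟨v, -, hv⟩ := Finset.mem_image.1 hj
    exact (List.cons.inj hv).1.symm

theorem mem_stopWords_succ {n : ℕ} {p : List ι → Prop} (h : ¬ p []) {w : List ι} :
    w ∈ stopWords (n + 1) p ↔ ∃ i v, v ∈ stopWords n (fun w => p (i :: w)) ∧ w = i :: v := by
  classical
  rw [stopWords, if_neg h]
  simp only [Finset.mem_biUnion, Finset.mem_univ, true_and, Finset.mem_image]
  constructor
  · rintro ⟨i, v, hv, rfl⟩; exact ⟨i, v, hv, rfl⟩
  · rintro ⟨i, v, hv, rfl⟩; exact ⟨i, v, hv, rfl⟩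

theorem length_le_of_mem_stopWords {n : ℕ} {p : List ι → Prop} {w : List ι} (hw : w ∈ stopWords n p) :
    w.length ≤ n := by
  induction n generalizing p w with
  | zero => simp [stopWords] at hw; simp [hw]
  | succ n ih =>
    by_cases h : p []
    · rw [stopWords_succ_of_pos h, Finset.mem_singleton] at hw; simp [hw]
    · obtain ⟨i, v, hv, rfl⟩ := (mem_stopWords_succ h).1 hw
      simpa using ih hv

theorem prop_or_length_of_mem_stopWords {n : ℕ} {p : List ι → Prop} {w : List ι} (hw : w ∈ stopWords n p) :
    p w ∨ w.length = n := by
  induction n generalizing p w with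
  | zero => simp [stopWords] at hw; simp [hw]
  | succ n ih =>
    by_cases h : p []
    · rw [stopWords_succ_of_pos h, Finset.mem_singleton] at hw; simp [hw, h]
    · obtain ⟨i, v, hv, rfl⟩ := (mem_stopWords_succ h).1 hw
      simpa using ih hv

theorem not_of_append_mem_stopWords {n : ℕ} {p : List ι → Prop} {u : List ι} {i : ι}
    (hw : u ++ [i] ∈ stopWords n p) : ¬ p u := by
  induction n generalizing p u with
  | zero => simp [stopWords] at hw
  | succ n ih =>
    by_cases h : p []
    · rw [stopWords_succ_of_pos h, Finset.mem_singleton] at hw; simp at hw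
    · obtain ⟨k, v, hv, hk⟩ := (mem_stopWords_succ h).1 hw
      cases u with
      | nil => exact h
      | cons l u =>
        rw [List.cons_append] at hk
        obtain ⟨rfl, rfl⟩ := List.cons.inj hk
        exact ih (p := fun w => p (l :: w)) hv

/-- A function on the tree of words that is additive over children has the same total on every cut.
Additivity is required only above depth `n`, which admits functions that make sense only up to a
fixed word length. -/
theorem sum_stopWords_eq {M : Type*} [AddCommMonoid M] (n : ℕ) (p : List ι → Prop) (F : List ι → M)
    (hF : ∀ w, w.length < n → F w = ∑ i, F (w ++ [i])) : ∑ w ∈ stopWords n p, F w = F [] := by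
  induction n generalizing p F with
  | zero => simp [stopWords]
  | succ n ih =>
    by_cases h : p []
    · rw [stopWords_succ_of_pos h, Finset.sum_singleton]
    · rw [sum_stopWords_succ h, hF [] (by simp)]
      refine Finset.sum_congr rfl fun i _ => ?_
      rw [ih (fun w => p (i :: w)) (fun w => F (i :: w))
        (fun w hw => hF (i :: w) (by simpa using hw))]
      rfl

theorem le_sum_stopWords (n : ℕ) (p : List ι → Prop) (F : List ι → ℝ)
    (hF : ∀ w, F w ≤ ∑ i, F (w ++ [i])) : F [] ≤ ∑ w ∈ stopWords n p, F w := by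
  induction n generalizing p F with
  | zero => simp [stopWords]
  | succ n ih =>
    by_cases h : p []
    · rw [stopWords_succ_of_pos h, Finset.sum_singleton]
    · rw [sum_stopWords_succ h]
      refine (hF []).trans (Finset.sum_le_sum fun i _ => ?_)
      exact ih (fun w => p (i :: w)) (fun w => F (i :: w)) (fun w => hF (i :: w))

/-- The words of length `n`. -/
def words (ι : Type*) [Fintype ι] (n : ℕ) : Finset (List ι) := stopWords n fun _ => False

theorem length_of_mem_words {n : ℕ} {w : List ι} (hw : w ∈ words ι n) : w.length = n :=
  (prop_or_length_of_mem_stopWords hw).resolve_left id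

theorem sum_words_zero {M : Type*} [AddCommMonoid M] (F : List ι → M) :
    ∑ w ∈ words ι 0, F w = F [] := by simp [words, stopWords]

theorem sum_words_succ {M : Type*} [AddCommMonoid M] (n : ℕ) (F : List ι → M) :
    ∑ w ∈ words ι (n + 1), F w = ∑ i, ∑ w ∈ words ι n, F (i :: w) :=
  sum_stopWords_succ id F

theorem mem_words (w : List ι) : w ∈ words ι w.length := by
  induction w with
  | nil => simp [words, stopWords]
  | cons i w ih => exact (mem_stopWords_succ id).2 ⟨i, w, ih, rfl⟩

theorem sum_words_add {M : Type*} [AddCommMonoid M] (m n : ℕ) (F : List ι → M) :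
    ∑ w ∈ words ι (m + n), F w = ∑ u ∈ words ι m, ∑ v ∈ words ι n, F (u ++ v) := by
  induction m generalizing F with
  | zero => simp [sum_words_zero]
  | succ m ih =>
    rw [sum_words_succ, Nat.add_right_comm, sum_words_succ]
    exact Finset.sum_congr rfl fun i _ => ih _

theorem sum_words_one {M : Type*} [AddCommMonoid M] (F : List ι → M) :
    ∑ w ∈ words ι 1, F w = ∑ i, F [i] := by
  rw [sum_words_succ]; simp [sum_words_zero]

theorem sum_words_eq {M : Type*} [AddCommMonoid M] (n : ℕ) (F : List ι → M) :
    ∑ w ∈ words ι n, F w = ∑ w : Fin n → ι, F (List.ofFn w) := by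
  induction n generalizing F with
  | zero => simp [sum_words_zero]
  | succ n ih =>
    rw [sum_words_succ, ← (Fin.consEquiv fun _ => ι).sum_comp, Fintype.sum_prod_type]
    refine Finset.sum_congr rfl fun i _ => ?_
    rw [ih]
    refine Finset.sum_congr rfl fun w _ => ?_
    simp [Fin.consEquiv, List.ofFn_succ]

/-- Distinct words of a stopping family are incomparable: any relation that holds between words
branching at a common vertex holds between them. -/
theorem stopWords_pairwise {n : ℕ} {p : List ι → Prop} {u v : List ι} (hu : u ∈ stopWords n p)
    (hv : v ∈ stopWords n p) (huv : u ≠ v) :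
    ∃ (t : List ι) (i j : ι) (u' v' : List ι), i ≠ j ∧ u = t ++ i :: u' ∧ v = t ++ j :: v' := by
  induction n generalizing p u v with
  | zero => simp [stopWords] at hu hv; exact absurd (hu.trans hv.symm) huv
  | succ n ih =>
    by_cases h : p []
    · rw [stopWords_succ_of_pos h, Finset.mem_singleton] at hu hv
      exact absurd (hu.trans hv.symm) huv
    · obtain ⟨i, u', hu', rfl⟩ := (mem_stopWords_succ h).1 hu
      obtain ⟨j, v', hv', rfl⟩ := (mem_stopWords_succ h).1 hv
      by_cases hij : i = j
      · subst hij
        obtain ⟨t, k, l, u'', v'', hkl, e1, e2⟩ := ih hu' hv' (fun h => huv (by rw [h]))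
        exact ⟨i :: t, k, l, u'', v'', hkl, by rw [e1]; rfl, by rw [e2]; rfl⟩
      · exact ⟨[], i, j, u', v', hij, rfl, rfl⟩

end Stop

/-! ### The self-affine measure -/

/-- The square `[-ρ, ρ]²`. -/
def coordBox (ρ : ℝ) : Set Plane := {x | ∀ j, |x j| ≤ ρ}

namespace BoxLikeIFS

variable {ι : Type*} [Fintype ι] {Φ : BoxLikeIFS ι} {μ : Measure Plane}

theorem dist_S_le (Φ : BoxLikeIFS ι) (i : ι) (x y : Plane) :
    dist (Φ.S i x) (Φ.S i y) ≤ Φ.ratioMax * dist x y := by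
  rw [EuclideanSpace.dist_eq, EuclideanSpace.dist_eq, ← Real.sqrt_sq Φ.ratioMax_pos.le,
    ← Real.sqrt_mul (sq_nonneg _)]
  refine Real.sqrt_le_sqrt ?_
  rw [Finset.mul_sum,
    ← Equiv.sum_comp (Φ.wordPerm [i]) fun j => Φ.ratioMax ^ 2 * dist (x j) (y j) ^ 2]
  refine Finset.sum_le_sum fun j _ => ?_
  rw [Real.dist_eq, Real.dist_eq, ← wordMap_singleton, Φ.abs_wordMap_sub, mul_pow]
  gcongr
  · exact (Φ.wordRatio_pos _ _).le
  · rw [wordRatio_singleton]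
    exact Φ.le_ratioMax i j

theorem IsSelfAffineMeasure.measure_eq (hμ : Φ.IsSelfAffineMeasure μ) {s : Set Plane}
    (hs : MeasurableSet s) : μ s = ∑ i, ENNReal.ofReal (Φ.p i) * μ (Φ.S i ⁻¹' s) := by
  conv_lhs => rw [hμ.eq_sum]
  rw [Measure.finsetSum_apply]
  refine Finset.sum_congr rfl fun i _ => ?_
  rw [Measure.smul_apply, smul_eq_mul, Measure.map_apply (Φ.measurable_S i) hs]

theorem sum_ofReal_p (Φ : BoxLikeIFS ι) : ∑ i, ENNReal.ofReal (Φ.p i) = 1 := by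
  rw [← ENNReal.ofReal_sum_of_nonneg fun i _ => (Φ.p_mem i).1.le, Φ.p_sum, ENNReal.ofReal_one]

/-- A nonempty closed set mapped into itself by all maps has full measure. -/
theorem IsSelfAffineMeasure.measure_compl_of_invariant (hμ : Φ.IsSelfAffineMeasure μ)
    {K : Set Plane} (hK : IsClosed K) (hne : K.Nonempty) (hinv : ∀ i, Φ.S i '' K ⊆ K) :
    μ Kᶜ = 0 := by
  have := hμ.isProbabilityMeasure
  -- `A η` is the closed `η`-neighbourhood of `K`. Every map sends it into `A (ratioMax * η)`, so
  -- the mass of `A η` is at most that of a smaller neighbourhood, and in the limit at most that of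
  -- `K`; as `η → ∞` these sets exhaust the plane.
  set A : ℝ → Set Plane := fun η => {x | Metric.infDist x K ≤ η} with hA
  have hAm : ∀ η, MeasurableSet (A η) := fun η =>
    (isClosed_le (Metric.continuous_infDist_pt K) continuous_const).measurableSet
  have hAmono : Monotone A := fun a b hab x hx => le_trans hx hab
  have hstep : ∀ η, μ (A η) ≤ μ (A (Φ.ratioMax * η)) := by
    intro η
    rw [hμ.measure_eq (hAm (Φ.ratioMax * η))]
    calc μ (A η) = ∑ i, ENNReal.ofReal (Φ.p i) * μ (A η) := by
          rw [← Finset.sum_mul, sum_ofReal_p, one_mul]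
      _ ≤ _ := by
          refine Finset.sum_le_sum fun i _ => ?_
          gcongr
          intro x hx
          obtain ⟨y, hy, hxy⟩ := hK.exists_infDist_eq_dist hne x
          calc Metric.infDist (Φ.S i x) K ≤ dist (Φ.S i x) (Φ.S i y) :=
                Metric.infDist_le_dist_of_mem (hinv i (mem_image_of_mem _ hy))
            _ ≤ Φ.ratioMax * dist x y := Φ.dist_S_le i x y
            _ ≤ Φ.ratioMax * η := by
                rw [← hxy]; exact mul_le_mul_of_nonneg_left hx Φ.ratioMax_pos.le
  have hiter : ∀ (η : ℝ) (n : ℕ), μ (A η) ≤ μ (A (Φ.ratioMax ^ n * η)) := by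
    intro η n
    induction n with
    | zero => simp
    | succ n ih =>
      refine ih.trans ((hstep _).trans (le_of_eq ?_))
      rw [pow_succ', mul_assoc]
  have hle : ∀ η : ℝ, 0 ≤ η → μ (A η) ≤ μ K := by
    intro η hη
    have hanti : Antitone fun n : ℕ => A (Φ.ratioMax ^ n * η) := fun m n hmn => hAmono (by
      gcongr ?_ * _
      exact pow_le_pow_of_le_one Φ.ratioMax_pos.le Φ.ratioMax_lt_one.le hmn)
    have hlim := tendsto_measure_iInter_atTop (μ := μ)
      (fun n : ℕ => (hAm (Φ.ratioMax ^ n * η)).nullMeasurableSet) hanti ⟨0, measure_ne_top _ _⟩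
    have hI : ⋂ n : ℕ, A (Φ.ratioMax ^ n * η) ⊆ K := by
      intro x hx
      have h0 : Tendsto (fun n : ℕ => Φ.ratioMax ^ n * η) atTop (𝓝 (0 * η)) :=
        (tendsto_pow_atTop_nhds_zero_of_lt_one Φ.ratioMax_pos.le Φ.ratioMax_lt_one).mul_const η
      rw [zero_mul] at h0
      have h1 : Metric.infDist x K ≤ 0 := ge_of_tendsto' h0 fun n => mem_iInter.1 hx n
      rw [← hK.closure_eq, Metric.mem_closure_iff_infDist_zero hne]
      exact le_antisymm h1 Metric.infDist_nonneg
    exact (ge_of_tendsto' hlim (hiter η)).trans (measure_mono hI)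
  have hU : Tendsto (fun n : ℕ => μ (A n)) atTop (𝓝 (μ (⋃ n : ℕ, A n))) :=
    tendsto_measure_iUnion_atTop fun m n hmn => hAmono (by exact_mod_cast hmn)
  have hUniv : ⋃ n : ℕ, A n = univ := by
    refine eq_univ_of_forall fun x => mem_iUnion.2 ?_
    obtain ⟨n, hn⟩ := exists_nat_ge (Metric.infDist x K)
    exact ⟨n, hn⟩
  rw [hUniv, measure_univ] at hU
  have h1 : 1 ≤ μ K := le_of_tendsto' hU fun n => hle n (Nat.cast_nonneg n)
  rw [prob_compl_eq_zero_iff hK.measurableSet]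
  exact le_antisymm prob_le_one h1

theorem IsSelfAffineMeasure.exists_coordBox (hμ : Φ.IsSelfAffineMeasure μ) :
    ∃ ρ : ℝ, 1 ≤ ρ ∧ μ (coordBox ρ)ᶜ = 0 := by
  obtain ⟨M, hM⟩ := (Set.finite_range fun i => ‖Φ.S i 0‖).bddAbove
  have h1κ : 0 < 1 - Φ.ratioMax := sub_pos.2 Φ.ratioMax_lt_one
  -- With this choice `ratioMax * ρ + M ≤ ρ`, so the ball of radius `ρ` is mapped into itself.
  set ρ : ℝ := max 1 (M / (1 - Φ.ratioMax)) with hρ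
  have hρ1 : 1 ≤ ρ := le_max_left _ _
  refine ⟨ρ, hρ1, measure_mono_null ?_ (hμ.measure_compl_of_invariant
    (K := Metric.closedBall 0 ρ) Metric.isClosed_closedBall ⟨0, by simp; linarith⟩ ?_)⟩
  · refine compl_subset_compl.2 fun x hx j => ?_
    have h := abs_coord_le_dist x 0 j
    simp only [PiLp.zero_apply, sub_zero] at h
    exact h.trans hx
  · rintro i _ ⟨x, hx, rfl⟩
    rw [mem_closedBall_zero_iff] at hx ⊢
    have h2 : ‖Φ.S i 0‖ ≤ M := hM (mem_range_self i)
    have h3 : M ≤ ρ * (1 - Φ.ratioMax) := by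
      rw [← div_le_iff₀ h1κ]; exact le_max_right _ _
    calc ‖Φ.S i x‖ ≤ ‖Φ.S i x - Φ.S i 0‖ + ‖Φ.S i 0‖ := norm_le_norm_sub_add _ _
      _ ≤ Φ.ratioMax * ‖x‖ + M := by
          have := Φ.dist_S_le i x 0
          rw [dist_eq_norm, dist_zero_right] at this
          linarith
      _ ≤ Φ.ratioMax * ρ + M := by gcongr; exact Φ.ratioMax_pos.le
      _ ≤ ρ := by linarith

/-- Self-affinity says that `p(w) * μ (S_w⁻¹ s)` is additive over the children of `w`, so its total
is the same on every cut. -/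
theorem IsSelfAffineMeasure.measure_eq_sum_stopWords (hμ : Φ.IsSelfAffineMeasure μ) (n : ℕ)
    (p : List ι → Prop) {s : Set Plane} (hs : MeasurableSet s) :
    μ s = ∑ w ∈ stopWords n p, ENNReal.ofReal (Φ.wordProb w) * μ (Φ.wordMap w ⁻¹' s) := by
  have h := sum_stopWords_eq n p (fun w => ENNReal.ofReal (Φ.wordProb w) * μ (Φ.wordMap w ⁻¹' s)) ?_
  · rw [h]; simp [wordProb, wordMap]
  · intro w _
    rw [hμ.measure_eq (Φ.measurable_wordMap w hs), Finset.mul_sum]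
    refine Finset.sum_congr rfl fun i _ => ?_
    rw [wordProb_append, wordMap_append, ENNReal.ofReal_mul (Φ.wordProb_pos w).le, mul_assoc,
      preimage_comp, wordMap_singleton]
    simp [wordProb]

theorem abs_wordMap_sub_le {ρ : ℝ} {x y : Plane} (hx : x ∈ coordBox ρ) (hy : y ∈ coordBox ρ)
    (w : List ι) (j : Fin 2) :
    |Φ.wordMap w x j - Φ.wordMap w y j| ≤ Φ.wordRatio w j * (2 * ρ) := by
  rw [Φ.abs_wordMap_sub]
  have h1 := abs_le.1 (hx (Φ.wordPerm w j))
  have h2 := abs_le.1 (hy (Φ.wordPerm w j))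
  refine mul_le_mul_of_nonneg_left (abs_le.2 ⟨?_, ?_⟩) (Φ.wordRatio_pos w j).le <;> linarith

theorem exists_pow_le_wordProb (Φ : BoxLikeIFS ι) :
    ∃ m : ℝ, 0 < m ∧ m < 1 ∧ ∀ w, m ^ w.length ≤ Φ.wordProb w := by
  have := Φ.nonempty_index
  obtain ⟨i, hi⟩ := Finite.exists_min Φ.p
  refine ⟨Φ.p i, (Φ.p_mem i).1, (Φ.p_mem i).2, fun w => ?_⟩
  induction w with
  | nil => simp [wordProb]
  | cons k w ih =>
    have : Φ.wordProb (k :: w) = Φ.p k * Φ.wordProb w := by simp [wordProb]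
    rw [this, List.length_cons, pow_succ']
    exact mul_le_mul (hi k) ih (pow_nonneg (Φ.p_mem i).1.le _) (Φ.p_mem k).1.le

/-- Balls centred in the support have at least polynomial mass. -/
theorem IsSelfAffineMeasure.exists_mass_lower_bound (hμ : Φ.IsSelfAffineMeasure μ) {X : Type*}
    [PseudoMetricSpace X] [MeasurableSpace X] [OpensMeasurableSpace X] {f : Plane → X}
    (hf : Measurable f) (hlip : ∀ x y, dist (f x) (f y) ≤ dist x y) :
    ∃ c A : ℝ, 0 < c ∧ 0 ≤ A ∧ ∀ x ∈ (μ.map f).support, ∀ r : ℝ, 0 < r → r ≤ 1 →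
      ENNReal.ofReal (c * r ^ A) ≤ μ.map f (Metric.closedBall x r) := by
  have := hμ.isProbabilityMeasure
  obtain ⟨ρ, hρ1, hρ⟩ := hμ.exists_coordBox
  obtain ⟨m, hm0, hm1, hm⟩ := Φ.exists_pow_le_wordProb
  set κ := Φ.ratioMax with hκ
  have hκ0 : 0 < κ := Φ.ratioMax_pos
  have hκ1 : κ < 1 := Φ.ratioMax_lt_one
  -- The exponent for which `m = κ ^ A`, turning the bound `m ^ n` for probabilities into a power of
  -- the size `κ ^ n` of the pieces.
  set A : ℝ := Real.log m / Real.log κ with hA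
  have hA0 : 0 ≤ A := div_nonneg_of_nonpos (Real.log_nonpos hm0.le hm1.le)
    (Real.log_nonpos hκ0.le hκ1.le)
  have hmA : m = κ ^ A := by
    rw [Real.rpow_def_of_pos hκ0, hA, mul_div_cancel₀ _ (Real.log_neg hκ0 hκ1).ne,
      Real.exp_log hm0]
  refine ⟨m * (1 / (8 * ρ)) ^ A, A, by positivity, hA0, fun x hx r hr0 hr1 => ?_⟩
  -- For words of length `n + 1` the image of the box has diameter at most `4 * ρ * κ ^ (n + 1) < r
  -- / 2`, so a piece that charges the ball of radius `r / 2` lies, up to mass zero, in the ball of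
  -- radius `r`.
  obtain ⟨n, hn1, hn2⟩ := exists_nat_pow_near_of_lt_one (x := r / (8 * ρ)) (by positivity)
    (by rw [div_le_one (by positivity)]; linarith) hκ0 hκ1
  have hBm : MeasurableSet (f ⁻¹' Metric.ball x (r / 2)) := hf Metric.isOpen_ball.measurableSet
  have hCm : MeasurableSet (f ⁻¹' Metric.closedBall x r) :=
    hf Metric.isClosed_closedBall.measurableSet
  have hpos : μ (f ⁻¹' Metric.ball x (r / 2)) ≠ 0 := by
    rw [← Measure.map_apply hf Metric.isOpen_ball.measurableSet]
    exact ((Measure.mem_support_iff_forall x).1 hx _ (Metric.ball_mem_nhds x (by positivity))).ne'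
  rw [hμ.measure_eq_sum_stopWords (n + 1) (fun _ => False) hBm] at hpos
  obtain ⟨w, hw, hw0⟩ := Finset.exists_ne_zero_of_sum_ne_zero hpos
  have hlen : w.length = n + 1 := length_of_mem_words hw
  have hw1 : μ (Φ.wordMap w ⁻¹' (f ⁻¹' Metric.ball x (r / 2))) ≠ 0 := right_ne_zero_of_mul hw0
  have hex : ∃ y ∈ coordBox ρ, f (Φ.wordMap w y) ∈ Metric.ball x (r / 2) := by
    by_contra! hcon
    exact hw1 (measure_mono_null (fun y hy hyb => hcon y hyb hy) hρ)
  obtain ⟨y, hy, hyx⟩ := hex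
  have hsub : coordBox ρ ⊆ Φ.wordMap w ⁻¹' (f ⁻¹' Metric.closedBall x r) := by
    intro z hz
    have h1 : dist (Φ.wordMap w z) (Φ.wordMap w y) ≤ 2 * (κ ^ (n + 1) * (2 * ρ)) := by
      refine dist_le_of_coord fun j => (abs_wordMap_sub_le hz hy w j).trans ?_
      gcongr
      rw [← hlen]
      exact Φ.wordRatio_le w j
    have h2 : κ ^ (n + 1) * (8 * ρ) < r := by rwa [← lt_div_iff₀ (by positivity)]
    have h3 := hlip (Φ.wordMap w z) (Φ.wordMap w y)
    have h4 := Metric.mem_ball.1 hyx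
    have h5 := dist_triangle (f (Φ.wordMap w z)) (f (Φ.wordMap w y)) x
    rw [mem_preimage, mem_preimage, Metric.mem_closedBall]
    linarith
  have hone : μ (Φ.wordMap w ⁻¹' (f ⁻¹' Metric.closedBall x r)) = 1 := by
    rw [← prob_compl_eq_zero_iff (Φ.measurable_wordMap w hCm)]
    exact measure_mono_null (compl_subset_compl.2 hsub) hρ
  rw [Measure.map_apply hf Metric.isClosed_closedBall.measurableSet,
    hμ.measure_eq_sum_stopWords (n + 1) (fun _ => False) hCm]
  calc ENNReal.ofReal (m * (1 / (8 * ρ)) ^ A * r ^ A) ≤ ENNReal.ofReal (Φ.wordProb w) := by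
        refine ENNReal.ofReal_le_ofReal (le_trans ?_ (hm w))
        rw [hlen, pow_succ', mul_assoc, ← Real.mul_rpow (by positivity) hr0.le]
        gcongr
        calc (1 / (8 * ρ) * r) ^ A = (r / (8 * ρ)) ^ A := by congr 1; ring
          _ ≤ (κ ^ n) ^ A := by gcongr
          _ = m ^ n := by
              rw [hmA, ← Real.rpow_natCast, ← Real.rpow_natCast, ← Real.rpow_mul hκ0.le,
                ← Real.rpow_mul hκ0.le, mul_comm]
    _ = ENNReal.ofReal (Φ.wordProb w) *
          μ (Φ.wordMap w ⁻¹' (f ⁻¹' Metric.closedBall x r)) := by rw [hone, mul_one]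
    _ ≤ _ := Finset.single_le_sum (f := fun w => ENNReal.ofReal (Φ.wordProb w) *
          μ (Φ.wordMap w ⁻¹' (f ⁻¹' Metric.closedBall x r))) (fun _ _ => bot_le) hw

end BoxLikeIFS

/-! ### Grid sums of the projections -/

namespace BoxLikeIFS

variable {ι : Type*} [Fintype ι] {Φ : BoxLikeIFS ι} {μ : Measure Plane}

/-- The grid sum of the projection of `μ` to the `j`-th coordinate. -/
def coordSum (q : ℝ) (μ : Measure Plane) (j : Fin 2) (δ : ℝ) : ℝ≥0∞ :=
  partSum q μ (Grid.real.cell δ ∘ coordProj j)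

theorem gridSum_map_coordProj (q : ℝ) (μ : Measure Plane) (j : Fin 2) :
    Grid.real.gridSum q (μ.map (coordProj j)) = coordSum q μ j :=
  funext fun δ => partSum_map (measurable_coordProj j) (Grid.real.measurableSet δ)

theorem exists_coordSum_le {q : ℝ} (hq : 0 ≤ q) (R : ℝ) : ∃ C : ℝ≥0∞, C ≠ ∞ ∧
    ∀ (μ : Measure Plane) (j : Fin 2) (δ ε : ℝ), 0 < δ → 0 < ε → δ ≤ R * ε → ε ≤ R * δ →
      coordSum q μ j δ ≤ C * coordSum q μ j ε := by
  obtain ⟨C, hC, h⟩ := Grid.real.exists_gridSum_le hq (R := R)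
  refine ⟨C, hC, fun μ j δ ε => ?_⟩
  rw [← gridSum_map_coordProj]
  exact h _ δ ε

theorem coordSum_ne_zero {q : ℝ} (hq : 0 ≤ q) [IsProbabilityMeasure μ] (j : Fin 2) (δ : ℝ) :
    coordSum q μ j δ ≠ 0 := partSum_ne_zero hq (IsProbabilityMeasure.ne_zero μ) _

theorem IsSelfAffineMeasure.coordSum_ne_top (hμ : Φ.IsSelfAffineMeasure μ) {q : ℝ} (hq : 0 ≤ q)
    (j : Fin 2) {δ : ℝ} (hδ : 0 < δ) : coordSum q μ j δ ≠ ∞ := by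
  have := hμ.isProbabilityMeasure
  obtain ⟨ρ, hρ1, hρ⟩ := hμ.exists_coordBox
  refine partSum_ne_top hq hρ ?_
  obtain ⟨N, hN⟩ := Grid.real.exists_encard_image_le (2 * ρ / δ)
  rw [image_comp]
  refine finite_of_encard_le_coe (hN δ hδ _ ?_)
  rintro _ ⟨x, hx, rfl⟩ _ ⟨y, hy, rfl⟩
  rw [div_mul_cancel₀ _ hδ.ne', Real.dist_eq]
  have h1 := abs_le.1 (hx j)
  have h2 := abs_le.1 (hy j)
  unfold coordProj
  rw [abs_le]; constructor <;> linarith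

/-- The mass distribution of the piece `S_w` at scale `r_w * ε` is that of a projection of `μ` at
scale `ε`. -/
theorem exists_piece_le {q : ℝ} (hq : 0 ≤ q) (R : ℝ) : ∃ C : ℝ≥0∞, C ≠ ∞ ∧
    ∀ (Φ : BoxLikeIFS ι) (μ : Measure Plane) (w : List ι) (j : Fin 2) (δ ε : ℝ), 0 < δ → 0 < ε →
      δ ≤ R * (Φ.wordRatio w j * ε) → Φ.wordRatio w j * ε ≤ R * δ →
      partSum q μ (Grid.real.cell δ ∘ coordProj j ∘ Φ.wordMap w) ≤
        C * coordSum q μ (Φ.wordPerm w j) ε ∧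
      coordSum q μ (Φ.wordPerm w j) ε ≤
        C * partSum q μ (Grid.real.cell δ ∘ coordProj j ∘ Φ.wordMap w) := by
  obtain ⟨C, hC, h⟩ := Grid.real.exists_partSum_le Grid.real hq (2 * R)
  refine ⟨C, hC, fun Φ μ w j δ ε hδ hε h1 h2 => ?_⟩
  have hr := Φ.wordRatio_pos w j
  have e1 : ∀ x ∈ (univ : Set Plane), ∀ y ∈ (univ : Set Plane),
      dist (coordProj (Φ.wordPerm w j) x) (coordProj (Φ.wordPerm w j) y) ≤ 2 * ε →
      dist ((coordProj j ∘ Φ.wordMap w) x) ((coordProj j ∘ Φ.wordMap w) y) ≤ 2 * R * δ := by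
    intro x _ y _ hxy
    rw [Real.dist_eq] at hxy ⊢
    simp only [Function.comp_apply, coordProj] at hxy ⊢
    rw [Φ.abs_wordMap_sub]
    have := mul_le_mul_of_nonneg_left hxy hr.le
    linarith
  have e2 : ∀ x ∈ (univ : Set Plane), ∀ y ∈ (univ : Set Plane),
      dist ((coordProj j ∘ Φ.wordMap w) x) ((coordProj j ∘ Φ.wordMap w) y) ≤ 2 * δ →
      dist (coordProj (Φ.wordPerm w j) x) (coordProj (Φ.wordPerm w j) y) ≤ 2 * R * ε := by
    intro x _ y _ hxy
    rw [Real.dist_eq] at hxy ⊢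
    simp only [Function.comp_apply, coordProj] at hxy ⊢
    rw [Φ.abs_wordMap_sub] at hxy
    refine le_of_mul_le_mul_left ?_ hr
    linarith
  exact ⟨h μ univ (by simp) _ _ δ ε hδ hε e1 e2, h μ univ (by simp) _ _ ε δ hε hδ e2 e1⟩

theorem IsSelfAffineMeasure.posPow_mul_partSum_le (hμ : Φ.IsSelfAffineMeasure μ) {q : ℝ}
    (hq : 0 ≤ q) (i : ι) {K : Type*} {F : Plane → K} (hF : ∀ k, MeasurableSet (F ⁻¹' {k})) :
    posPow q (ENNReal.ofReal (Φ.p i)) * partSum q μ (F ∘ Φ.S i) ≤ partSum q μ F := by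
  unfold partSum
  rw [← ENNReal.tsum_mul_left]
  refine ENNReal.tsum_le_tsum fun k => ?_
  rw [← posPow_mul hq]
  refine posPow_mono hq ?_
  rw [hμ.measure_eq (hF k)]
  exact Finset.single_le_sum (f := fun i => ENNReal.ofReal (Φ.p i) * μ (Φ.S i ⁻¹' (F ⁻¹' {k})))
    (fun _ _ => bot_le) (Finset.mem_univ i)

theorem measurableSet_cell_coordProj (δ : ℝ) (j : Fin 2) (k : Grid.real.K) :
    MeasurableSet ((Grid.real.cell δ ∘ coordProj j) ⁻¹' {k}) :=
  measurable_coordProj j (Grid.real.measurableSet δ k)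

/-- The `j`-th projection of the piece `S_i` is an affine copy of the projection of `μ` to
coordinate `perm i j`, and the piece carries the fixed share `p_i` of `μ`. If some map swaps the
axes, the two projections of `μ` thus have comparable grid sums. -/
theorem IsSelfAffineMeasure.exists_coordSum_perm_le (hμ : Φ.IsSelfAffineMeasure μ) {q : ℝ}
    (hq : 0 ≤ q) (i : ι) (j : Fin 2) : ∃ C : ℝ≥0∞, C ≠ ∞ ∧ ∀ δ : ℝ, 0 < δ →
      coordSum q μ (Φ.perm i j) δ ≤ C * coordSum q μ j δ := by
  have hr := Φ.ratio_mem i j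
  obtain ⟨C, hC, h⟩ := exists_piece_le (ι := ι) hq (Φ.ratio i j)⁻¹
  set P := posPow q (ENNReal.ofReal (Φ.p i)) with hP
  have hP0 : P ≠ 0 := posPow_ne_zero hq (by simpa using (Φ.p_mem i).1)
  have hPt : P ≠ ∞ := posPow_ne_top hq ENNReal.ofReal_ne_top
  refine ⟨C * P⁻¹, ENNReal.mul_ne_top hC (ENNReal.inv_ne_top.2 hP0), fun δ hδ => ?_⟩
  have h1 := (h Φ μ [i] j δ δ hδ hδ (by
      rw [wordRatio_singleton, ← mul_assoc, inv_mul_cancel₀ hr.1.ne', one_mul]) (by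
      rw [wordRatio_singleton]
      refine mul_le_mul_of_nonneg_right ?_ hδ.le
      exact hr.2.le.trans ((one_le_inv₀ hr.1).2 hr.2.le))).2
  have h2 := hμ.posPow_mul_partSum_le hq i (measurableSet_cell_coordProj δ j)
  calc coordSum q μ (Φ.perm i j) δ ≤
        C * partSum q μ (Grid.real.cell δ ∘ coordProj j ∘ Φ.wordMap [i]) := h1
    _ = C * (P⁻¹ * (P * partSum q μ ((Grid.real.cell δ ∘ coordProj j) ∘ Φ.S i))) := by
        rw [← mul_assoc P⁻¹, ENNReal.inv_mul_cancel hP0 hPt, one_mul]; rfl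
    _ ≤ C * (P⁻¹ * coordSum q μ j δ) := by gcongr; exact h2
    _ = _ := by rw [mul_assoc]

theorem wordPerm_eq_one (w : List ι) (h : ∀ i ∈ w, Φ.perm i = 1) : Φ.wordPerm w = 1 := by
  induction w with
  | nil => rfl
  | cons i w ih =>
    rw [wordPerm, h i (by simp), ih fun k hk => h k (by simp [hk]), one_mul]

/-- A word that moves `j` contains a letter that moves `j`. Hence finitely many constants, one for
each letter and coordinate, serve all words. -/
theorem wordPerm_apply_eq (Φ : BoxLikeIFS ι) (w : List ι) (j : Fin 2) :
    Φ.wordPerm w j = j ∨ ∃ i, Φ.wordPerm w j = Φ.perm i j := by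
  by_cases h : ∀ i ∈ w, Φ.perm i = 1
  · left; rw [wordPerm_eq_one w h]; rfl
  · push Not at h
    obtain ⟨i, -, hi⟩ := h
    rcases perm_eq_one_or_swap (Φ.wordPerm w) with h1 | h1
    · left; rw [h1]; rfl
    · right
      exact ⟨i, by rw [h1, (perm_eq_one_or_swap (Φ.perm i)).resolve_left hi]⟩

theorem wordPerm_wordPerm (Φ : BoxLikeIFS ι) (w : List ι) (j : Fin 2) :
    Φ.wordPerm w (Φ.wordPerm w j) = j := by
  rcases perm_eq_one_or_swap (Φ.wordPerm w) with h | h <;> simp [h]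

theorem IsSelfAffineMeasure.exists_coordSum_wordPerm_le (hμ : Φ.IsSelfAffineMeasure μ) {q : ℝ}
    (hq : 0 ≤ q) : ∃ C : ℝ≥0∞, C ≠ ∞ ∧ ∀ (w : List ι) (j : Fin 2) (δ : ℝ), 0 < δ →
      coordSum q μ (Φ.wordPerm w j) δ ≤ C * coordSum q μ j δ := by
  choose C hC h using fun x : ι × Fin 2 => hμ.exists_coordSum_perm_le hq x.1 x.2
  refine ⟨1 + ∑ x, C x, ?_, fun w j δ hδ => ?_⟩
  · exact ENNReal.add_ne_top.2 ⟨by simp, ENNReal.sum_ne_top.2 fun x _ => hC x⟩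
  · rcases wordPerm_apply_eq Φ w j with h1 | ⟨i, h1⟩
    · rw [h1]
      exact le_mul_of_one_le_left bot_le le_self_add
    · rw [h1]
      refine (h (i, j) δ hδ).trans ?_
      gcongr
      exact (Finset.single_le_sum (f := C) (fun _ _ => bot_le) (Finset.mem_univ (i, j))).trans
        le_add_self

/-- Stopping families at which a multiplicatively decreasing function of words reaches `ρ`. -/
theorem exists_stopWords (Φ : BoxLikeIFS ι) (g : List ι → ℝ) (hg0 : g [] = 1)
    (hg : ∀ w i, Φ.ratioMin * g w ≤ g (w ++ [i])) (hgle : ∀ w, g w ≤ Φ.ratioMax ^ w.length)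
    {ρ : ℝ} (hρ : 0 < ρ) (hρ1 : ρ ≤ 1) : ∃ (n : ℕ) (p : List ι → Prop),
      ∀ w ∈ stopWords n p, Φ.ratioMin * ρ ≤ g w ∧ g w ≤ ρ := by
  obtain ⟨n, hn⟩ := exists_pow_lt_of_lt_one hρ Φ.ratioMax_lt_one
  refine ⟨n, fun w => g w ≤ ρ, fun w hw => ⟨?_, ?_⟩⟩
  · rcases List.eq_nil_or_concat' w with rfl | ⟨u, i, rfl⟩
    · rw [hg0]
      exact mul_le_one₀ Φ.ratioMin_lt_one.le hρ.le hρ1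
    -- The parent of a stopping word has not stopped, so its value still exceeds `ρ`, and one more
    -- letter costs at most the factor `ratioMin`.
    · have h1 := not_le.1 (not_of_append_mem_stopWords (p := fun w => g w ≤ ρ) hw)
      exact (mul_le_mul_of_nonneg_left h1.le Φ.ratioMin_pos.le).trans (hg u i)
  · rcases prop_or_length_of_mem_stopWords hw with h | h
    · exact h
    · exact (hgle w).trans (h ▸ hn.le)

theorem exists_stopWords_wordRatio (Φ : BoxLikeIFS ι) (j : Fin 2) {ρ : ℝ} (hρ : 0 < ρ) (hρ1 : ρ ≤ 1) :
    ∃ (n : ℕ) (p : List ι → Prop), ∀ w ∈ stopWords n p,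
      Φ.ratioMin * ρ ≤ Φ.wordRatio w j ∧ Φ.wordRatio w j ≤ ρ :=
  Φ.exists_stopWords (fun w => Φ.wordRatio w j) rfl
    (fun w i => Φ.wordRatio_append_singleton_ge w i j) (fun w => Φ.wordRatio_le w j) hρ hρ1

theorem exists_stopWords_alpha₂ (Φ : BoxLikeIFS ι) {ρ : ℝ} (hρ : 0 < ρ) (hρ1 : ρ ≤ 1) :
    ∃ (n : ℕ) (p : List ι → Prop), ∀ w ∈ stopWords n p,
      Φ.ratioMin * ρ ≤ Φ.alpha₂ w ∧ Φ.alpha₂ w ≤ ρ :=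
  Φ.exists_stopWords Φ.alpha₂ (by rw [(Φ.alpha_eq []).2]; simp [wordRatio])
    Φ.alpha₂_append_singleton_ge (fun w => (Φ.alpha₂_le w 0).trans (Φ.wordRatio_le w 0)) hρ hρ1

/-- Comparison of the sums over the pieces of a stopping family with the projection. -/
theorem IsSelfAffineMeasure.exists_stopWords_piece_le (hμ : Φ.IsSelfAffineMeasure μ) {q : ℝ}
    (hq : 0 ≤ q) : ∃ C : ℝ≥0∞, C ≠ ∞ ∧ ∀ (w : List ι) (j : Fin 2) (ρ δ : ℝ), 0 < ρ → 0 < δ →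
      Φ.ratioMin * ρ ≤ Φ.wordRatio w j → Φ.wordRatio w j ≤ ρ →
      partSum q μ ((Grid.real.cell (ρ * δ) ∘ coordProj j) ∘ Φ.wordMap w) ≤
        C * coordSum q μ j δ ∧
      coordSum q μ j δ ≤
        C * partSum q μ ((Grid.real.cell (ρ * δ) ∘ coordProj j) ∘ Φ.wordMap w) := by
  obtain ⟨C, hC, h⟩ := exists_piece_le (ι := ι) hq Φ.ratioMin⁻¹
  obtain ⟨D, hD, h'⟩ := hμ.exists_coordSum_wordPerm_le hq
  have hm := Φ.ratioMin_pos
  refine ⟨C * D, ENNReal.mul_ne_top hC hD, fun w j ρ δ hρ hδ h1 h2 => ?_⟩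
  obtain ⟨h3, h4⟩ := h Φ μ w j (ρ * δ) δ (by positivity) hδ (by
      rw [← mul_assoc]
      refine mul_le_mul_of_nonneg_right ?_ hδ.le
      rw [inv_mul_eq_div, le_div_iff₀ hm]; linarith) (by
      rw [← mul_assoc]
      refine mul_le_mul_of_nonneg_right (h2.trans ?_) hδ.le
      exact le_mul_of_one_le_left hρ.le ((one_le_inv₀ hm).2 Φ.ratioMin_lt_one.le))
  constructor
  · calc _ ≤ C * coordSum q μ (Φ.wordPerm w j) δ := h3
      _ ≤ C * (D * coordSum q μ j δ) := by gcongr; exact h' w j δ hδ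
      _ = _ := by rw [mul_assoc]
  · have h5 := h' w (Φ.wordPerm w j) δ hδ
    rw [wordPerm_wordPerm] at h5
    calc _ ≤ D * coordSum q μ (Φ.wordPerm w j) δ := h5
      _ ≤ D * (C * partSum q μ (Grid.real.cell (ρ * δ) ∘ coordProj j ∘ Φ.wordMap w)) := by
          gcongr
      _ = _ := by rw [← mul_assoc, mul_comm D]; rfl

theorem preimage_eq_zero_of_forall {B : Set Plane} (hB : μ Bᶜ = 0) {s : Set Plane}
    (h : ∀ x ∈ B, x ∉ s) : μ s = 0 :=
  measure_mono_null (fun _ hx hxB => h _ hxB hx) hB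

theorem sum_wordProb_ne_top (Φ : BoxLikeIFS ι) (s : Finset (List ι)) :
    ∑ w ∈ s, ENNReal.ofReal (Φ.wordProb w) ≠ ∞ :=
  ENNReal.sum_ne_top.2 fun _ _ => ENNReal.ofReal_ne_top

/-- Supermultiplicativity of the grid sums of the projections for `q ≤ 1`. -/
theorem IsSelfAffineMeasure.exists_coordSum_mul_le (hμ : Φ.IsSelfAffineMeasure μ) {q : ℝ}
    (hq : 0 ≤ q) (hq1 : q ≤ 1) (j : Fin 2) : ∃ C : ℝ≥0∞, C ≠ ∞ ∧ ∀ ρ δ : ℝ, 0 < ρ → ρ ≤ 1 →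
      0 < δ → δ ≤ 1 → coordSum q μ j ρ * coordSum q μ j δ ≤ C * coordSum q μ j (ρ * δ) := by
  classical
  have := hμ.isProbabilityMeasure
  obtain ⟨b, hb1, hb⟩ := hμ.exists_coordBox
  obtain ⟨C, hC, hpiece⟩ := hμ.exists_stopWords_piece_le hq
  -- Two pieces of length at most `2 * b * ρ` that meet the same cell of mesh `ρ * δ ≤ ρ` have their
  -- points within `(2 * b + 2 + 2 * b) * ρ`.
  obtain ⟨N, hN⟩ := Grid.real.exists_encard_image_le (4 * b + 2)
  refine ⟨C * N, ENNReal.mul_ne_top hC (by simp), fun ρ δ hρ hρ1 hδ hδ1 => ?_⟩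
  obtain ⟨n, p, hwords⟩ := Φ.exists_stopWords_wordRatio j hρ hρ1
  set A := stopWords n p with hA
  have hρδ : 0 < ρ * δ := mul_pos hρ hδ
  set F : Plane → Grid.real.K := Grid.real.cell (ρ * δ) ∘ coordProj j with hF
  set G : Plane → Grid.real.K := Grid.real.cell ρ ∘ coordProj j with hG
  let P : List ι → ℝ≥0∞ := fun w => ENNReal.ofReal (Φ.wordProb w)
  let x : List ι → Grid.real.K → ℝ≥0∞ := fun w m => μ (Φ.wordMap w ⁻¹' (F ⁻¹' {m}))
  -- The words whose pieces can charge the coarse cell `k`; a fine cell `m` is related to `k` when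
  -- one of these pieces meets `m`.
  let W : Grid.real.K → Finset (List ι) := fun k =>
    A.filter fun w => ∃ y ∈ coordBox b, G (Φ.wordMap w y) = k
  let rel : Grid.real.K → Grid.real.K → Prop := fun k m =>
    ∃ w ∈ W k, ∃ y ∈ coordBox b, F (Φ.wordMap w y) = m
  have hcount : ∀ m, {k | rel k m}.encard ≤ N := by
    intro m
    refine (encard_le_encard ?_).trans (hN ρ hρ {t | ∃ w ∈ A, ∃ z ∈ coordBox b, ∃ y ∈ coordBox b,
      F (Φ.wordMap w y) = m ∧ t = Φ.wordMap w z j} ?_)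
    · rintro k ⟨w, hw, y, hy, hym⟩
      obtain ⟨hwA, z, hz, hzk⟩ := Finset.mem_filter.1 hw
      exact ⟨Φ.wordMap w z j, ⟨w, hwA, z, hz, y, hy, hym, rfl⟩, hzk⟩
    · rintro _ ⟨w, hw, z, hz, y, hy, hym, rfl⟩ _ ⟨w', hw', z', hz', y', hy', hym', rfl⟩
      have h1 := Grid.real.dist_le (ρ * δ) hρδ _ _ (hym.trans hym'.symm)
      have h2 := abs_wordMap_sub_le (Φ := Φ) hz hy w j
      have h3 := abs_wordMap_sub_le (Φ := Φ) hz' hy' w' j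
      have h4 : Φ.wordRatio w j * (2 * b) ≤ ρ * (2 * b) := by gcongr; exact (hwords w hw).2
      have h5 : Φ.wordRatio w' j * (2 * b) ≤ ρ * (2 * b) := by gcongr; exact (hwords w' hw').2
      have h6 : ρ * δ ≤ ρ := mul_le_of_le_one_right hρ.le hδ1
      have h7 := dist_triangle4 (Φ.wordMap w z j) (Φ.wordMap w y j) (Φ.wordMap w' y' j)
        (Φ.wordMap w' z' j)
      rw [abs_sub_comm] at h3
      simp only [Real.dist_eq] at h1 h7 ⊢
      simp only [coordProj] at h1
      linarith
  have hxle : ∀ w m, x w m ≤ 1 := fun w m => prob_le_one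
  have hmass : ∀ k, μ (G ⁻¹' {k}) ≤ ∑ w ∈ W k, P w := by
    intro k
    rw [hμ.measure_eq_sum_stopWords n p (measurableSet_cell_coordProj ρ j k), ← hA, Finset.sum_filter]
    refine Finset.sum_le_sum fun w _ => ?_
    split_ifs with hw
    · exact mul_le_of_le_one_right bot_le prob_le_one
    · have h0 : μ (Φ.wordMap w ⁻¹' (G ⁻¹' {k})) = 0 :=
        preimage_eq_zero_of_forall hb fun y hy hyk => hw ⟨y, hy, hyk⟩
      rw [h0, mul_zero]
  have hk : ∀ k, posPow q (μ (G ⁻¹' {k})) * coordSum q μ j δ ≤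
      C * ∑' m, {k | rel k m}.indicator (fun _ => posPow q (μ (F ⁻¹' {m}))) k := by
    intro k
    set Pk := ∑ w ∈ W k, P w with hPk
    by_cases hP0 : Pk = 0
    · have : μ (G ⁻¹' {k}) = 0 := le_antisymm ((hmass k).trans hP0.le) bot_le
      simp [this]
    have hPt : Pk ≠ ∞ := sum_wordProb_ne_top Φ _
    calc posPow q (μ (G ⁻¹' {k})) * coordSum q μ j δ
        ≤ posPow q Pk * coordSum q μ j δ := by gcongr; exact posPow_mono hq (hmass k)
      _ = Pk ^ (q - 1) * ∑ w ∈ W k, P w * coordSum q μ j δ := by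
          rw [← posPow_sub_one_mul hP0 hPt, ← Finset.sum_mul, mul_assoc]
      _ ≤ Pk ^ (q - 1) * ∑ w ∈ W k, P w * (C * ∑' m, posPow q (x w m)) := by
          gcongr with w hw
          have hs := hwords w (Finset.mem_filter.1 hw).1
          exact (hpiece w j ρ δ hρ hδ hs.1 hs.2).2
      _ = C * ∑' m, Pk ^ (q - 1) * ∑ w ∈ W k, P w * posPow q (x w m) := by
          rw [ENNReal.tsum_mul_left, Summable.tsum_finsetSum fun _ _ => ENNReal.summable]
          simp only [ENNReal.tsum_mul_left, Finset.mul_sum]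
          exact Finset.sum_congr rfl fun w _ => by ring
      -- Concave Jensen with weights `p(w)`: the weighted sum of the masses `x w m` is part of the
      -- mass of the fine cell `m`, and it vanishes unless `m` is related to `k`.
      _ ≤ C * ∑' m, {k | rel k m}.indicator (fun _ => posPow q (μ (F ⁻¹' {m}))) k := by
          gcongr with m
          refine (le_posPow_sum_mul hq hq1 (W k) P (fun w => x w m) hP0 hPt).trans ?_
          by_cases hr : rel k m
          · rw [indicator_of_mem (show k ∈ {k | rel k m} from hr)]
            refine posPow_mono hq ?_
            rw [hμ.measure_eq_sum_stopWords n p (measurableSet_cell_coordProj (ρ * δ) j m)]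
            exact Finset.sum_le_sum_of_subset (Finset.filter_subset _ _)
          · rw [indicator_of_notMem (show k ∉ {k | rel k m} from hr)]
            rw [Finset.sum_eq_zero, posPow_zero]
            intro w hw
            rw [show x w m = 0 from preimage_eq_zero_of_forall hb
              (s := Φ.wordMap w ⁻¹' _) (fun y hy hyk => hr ⟨w, hw, y, hy, hyk⟩), mul_zero]
  calc coordSum q μ j ρ * coordSum q μ j δ
      = ∑' k, posPow q (μ (G ⁻¹' {k})) * coordSum q μ j δ := ENNReal.tsum_mul_right.symm
    _ ≤ ∑' k, C * ∑' m, {k | rel k m}.indicator (fun _ => posPow q (μ (F ⁻¹' {m}))) k :=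
        ENNReal.tsum_le_tsum hk
    _ = C * ∑' m, ∑' k, {k | rel k m}.indicator (fun _ => posPow q (μ (F ⁻¹' {m}))) k := by
        rw [ENNReal.tsum_mul_left, ENNReal.tsum_comm]
    _ ≤ C * ∑' m, N * posPow q (μ (F ⁻¹' {m})) := by
        gcongr with m
        exact tsum_indicator_le_of_encard_le (hcount m) _
    _ = C * N * coordSum q μ j (ρ * δ) := by rw [ENNReal.tsum_mul_left, mul_assoc]; rfl

/-- Submultiplicativity of the grid sums of the projections for `q ≥ 1`. -/
theorem IsSelfAffineMeasure.exists_coordSum_le_mul (hμ : Φ.IsSelfAffineMeasure μ) {q : ℝ}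
    (hq1 : 1 ≤ q) (j : Fin 2) : ∃ C : ℝ≥0∞, C ≠ ∞ ∧ ∀ ρ δ : ℝ, 0 < ρ → ρ ≤ 1 →
      0 < δ → δ ≤ 1 → coordSum q μ j (ρ * δ) ≤ C * (coordSum q μ j ρ * coordSum q μ j δ) := by
  classical
  have hq : 0 ≤ q := by linarith
  have := hμ.isProbabilityMeasure
  obtain ⟨b, hb1, hb⟩ := hμ.exists_coordBox
  obtain ⟨C, hC, hpiece⟩ := hμ.exists_stopWords_piece_le hq
  -- In units of `ρ`, each of two pieces reaches at most `2 * b + 2` from a point of its coarse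
  -- cell, and a common coarse cell adds `2`.
  obtain ⟨N, hN⟩ := Grid.real.exists_encard_image_le (4 * b + 6)
  refine ⟨C * ((N : ℝ≥0∞) ^ q * N), ENNReal.mul_ne_top hC (ENNReal.mul_ne_top
    (ENNReal.rpow_ne_top_of_nonneg hq (by simp)) (by simp)), fun ρ δ hρ hρ1 hδ hδ1 => ?_⟩
  obtain ⟨n, p, hwords⟩ := Φ.exists_stopWords_wordRatio j hρ hρ1
  set A := stopWords n p with hA
  have hρδ : 0 < ρ * δ := mul_pos hρ hδ
  set F : Plane → Grid.real.K := Grid.real.cell (ρ * δ) ∘ coordProj j with hF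
  set G : Plane → Grid.real.K := Grid.real.cell ρ ∘ coordProj j with hG
  let P : List ι → ℝ≥0∞ := fun w => ENNReal.ofReal (Φ.wordProb w)
  let x : List ι → Grid.real.K → ℝ≥0∞ := fun w m => μ (Φ.wordMap w ⁻¹' (F ⁻¹' {m}))
  -- The cells of the two meshes need not be nested, so the coarse cell `k` is linked with every
  -- fine cell that it meets.
  let near : Grid.real.K → Grid.real.K → Prop := fun k m => ∃ z, G z = k ∧ F z = m
  let V : Grid.real.K → Finset (List ι) := fun k =>
    A.filter fun w => ∃ y ∈ coordBox b, near k (F (Φ.wordMap w y))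
  let rel : Grid.real.K → Grid.real.K → Prop := fun k l =>
    ∃ w ∈ V k, ∃ y ∈ coordBox b, G (Φ.wordMap w y) = l
  have hρδ1 : ρ * δ ≤ ρ := mul_le_of_le_one_right hρ.le hδ1
  have hdist : ∀ k, ∀ w ∈ V k, ∃ z, G z = k ∧ ∀ y ∈ coordBox b,
      |z j - Φ.wordMap w y j| ≤ (2 * b + 2) * ρ := by
    intro k w hw
    obtain ⟨hwA, y, hy, z, hzk, hzm⟩ := Finset.mem_filter.1 hw
    refine ⟨z, hzk, fun y' hy' => ?_⟩
    have h1 := Grid.real.dist_le (ρ * δ) hρδ _ _ hzm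
    rw [Real.dist_eq] at h1
    simp only [coordProj] at h1
    have h2 := abs_wordMap_sub_le (Φ := Φ) hy hy' w j
    have h4 : Φ.wordRatio w j * (2 * b) ≤ ρ * (2 * b) := by gcongr; exact (hwords w hwA).2
    have h5 := abs_sub_le (z j) (Φ.wordMap w y j) (Φ.wordMap w y' j)
    linarith
  have hG2 : ∀ z z', G z = G z' → |z j - z' j| ≤ 2 * ρ := by
    intro z z' h
    have h1 := Grid.real.dist_le ρ hρ _ _ h
    rwa [Real.dist_eq] at h1
  have hcount1 : ∀ k, {l | rel k l}.encard ≤ N := by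
    intro k
    refine (encard_le_encard ?_).trans (hN ρ hρ {t | ∃ w ∈ V k, ∃ y ∈ coordBox b,
      t = Φ.wordMap w y j} ?_)
    · rintro l ⟨w, hw, y, hy, hyl⟩
      exact ⟨_, ⟨w, hw, y, hy, rfl⟩, hyl⟩
    · rintro _ ⟨w, hw, y, hy, rfl⟩ _ ⟨w', hw', y', hy', rfl⟩
      obtain ⟨z, hz, h1⟩ := hdist k w hw
      obtain ⟨z', hz', h2⟩ := hdist k w' hw'
      have h1 := h1 y hy
      have h2 := h2 y' hy'
      have h3 := hG2 z z' (hz.trans hz'.symm)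
      rw [Real.dist_eq]
      rw [abs_le] at *
      constructor <;> linarith
  have hcount2 : ∀ l, {k | rel k l}.encard ≤ N := by
    intro l
    refine (encard_le_encard ?_).trans (hN ρ hρ {t | ∃ k, ∃ w ∈ V k, ∃ y ∈ coordBox b, ∃ z,
      G (Φ.wordMap w y) = l ∧ G z = k ∧ |z j - Φ.wordMap w y j| ≤ (2 * b + 2) * ρ ∧ t = z j} ?_)
    · rintro k ⟨w, hw, y, hy, hyl⟩
      obtain ⟨z, hz, h1⟩ := hdist k w hw
      exact ⟨z j, ⟨k, w, hw, y, hy, z, hyl, hz, h1 y hy, rfl⟩, hz⟩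
    · rintro _ ⟨k, w, hw, y, hy, z, hyl, hz, h1, rfl⟩ _ ⟨k', w', hw', y', hy', z', hyl', hz', h1',
        rfl⟩
      have h3 := hG2 _ _ (hyl.trans hyl'.symm)
      rw [Real.dist_eq]
      rw [abs_le] at *
      constructor <;> linarith
  have hle : ∀ k, ∑ w ∈ V k, P w ≤ ∑' l, {l | rel k l}.indicator (fun l => μ (G ⁻¹' {l})) l := by
    intro k
    have hmeas : MeasurableSet (⋃ l ∈ {l | rel k l}, G ⁻¹' {l}) :=
      MeasurableSet.biUnion (to_countable _) fun l _ => measurableSet_cell_coordProj ρ j l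
    rw [← tsum_subtype]
    refine le_trans ?_ (measure_biUnion_le μ (to_countable {l | rel k l}) fun l => G ⁻¹' {l})
    rw [hμ.measure_eq_sum_stopWords n p hmeas, ← hA]
    refine le_trans (Finset.sum_le_sum fun w hw => ?_)
      (Finset.sum_le_sum_of_subset (Finset.filter_subset _ _))
    have hone : μ (Φ.wordMap w ⁻¹' ⋃ l ∈ {l | rel k l}, G ⁻¹' {l}) = 1 := by
      rw [← prob_compl_eq_zero_iff (Φ.measurable_wordMap w hmeas)]
      refine measure_mono_null (compl_subset_compl.2 fun y hy => ?_) hb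
      exact mem_biUnion (x := G (Φ.wordMap w y)) ⟨w, hw, y, hy, rfl⟩ rfl
    rw [hone, mul_one]
  have hm : ∀ m, posPow q (μ (F ⁻¹' {m})) ≤
      ∑' k, (∑ w ∈ V k, P w) ^ (q - 1) * ∑ w ∈ V k, P w * posPow q (x w m) := by
    intro m
    by_cases h0 : μ (F ⁻¹' {m}) = 0
    · simp [h0]
    -- Any point `z` of the fine cell `m` selects a coarse cell `G z`. Every word charging `m`
    -- belongs to `V (G z)`, so this one term of the sum over `k` already dominates.
    obtain ⟨z, hz⟩ := nonempty_of_measure_ne_zero h0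
    refine le_trans ?_ (ENNReal.le_tsum (G z))
    have hsum : μ (F ⁻¹' {m}) = ∑ w ∈ V (G z), P w * x w m := by
      rw [hμ.measure_eq_sum_stopWords n p (measurableSet_cell_coordProj (ρ * δ) j m), ← hA,
        Finset.sum_filter]
      refine Finset.sum_congr rfl fun w _ => ?_
      split_ifs with hw
      · rfl
      · have h0 : μ (Φ.wordMap w ⁻¹' (F ⁻¹' {m})) = 0 := preimage_eq_zero_of_forall hb
          fun y hy hyk => hw ⟨y, hy, z, rfl, Eq.trans hz (Eq.symm hyk)⟩
        rw [h0, mul_zero]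
    rw [hsum]
    refine posPow_sum_mul_le hq1 _ P (fun w => x w m) (fun hP => h0 ?_) (sum_wordProb_ne_top Φ _)
    rw [hsum, Finset.sum_eq_zero]
    intro w hw
    rw [Finset.sum_eq_zero_iff.1 hP w hw, zero_mul]
  calc coordSum q μ j (ρ * δ)
      ≤ ∑' m, ∑' k, (∑ w ∈ V k, P w) ^ (q - 1) * ∑ w ∈ V k, P w * posPow q (x w m) :=
        ENNReal.tsum_le_tsum hm
    _ = ∑' k, (∑ w ∈ V k, P w) ^ (q - 1) * ∑ w ∈ V k, P w * ∑' m, posPow q (x w m) := by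
        rw [ENNReal.tsum_comm]
        refine tsum_congr fun k => ?_
        rw [ENNReal.tsum_mul_left, Summable.tsum_finsetSum fun _ _ => ENNReal.summable]
        simp only [ENNReal.tsum_mul_left]
    _ ≤ ∑' k, (∑ w ∈ V k, P w) ^ (q - 1) * ∑ w ∈ V k, P w * (C * coordSum q μ j δ) := by
        gcongr with k w hw
        have hs := hwords w (Finset.mem_filter.1 hw).1
        exact (hpiece w j ρ δ hρ hδ hs.1 hs.2).1
    _ = ∑' k, posPow q (∑ w ∈ V k, P w) * (C * coordSum q μ j δ) := by
        refine tsum_congr fun k => ?_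
        rw [← Finset.sum_mul, ← mul_assoc]
        by_cases hP0 : ∑ w ∈ V k, P w = 0
        · simp [hP0]
        · rw [posPow_sub_one_mul hP0 (sum_wordProb_ne_top Φ _)]
    _ = (∑' k, posPow q (∑ w ∈ V k, P w)) * (C * coordSum q μ j δ) := ENNReal.tsum_mul_right
    _ ≤ ((N : ℝ≥0∞) ^ q * N * coordSum q μ j ρ) * (C * coordSum q μ j δ) := by
        gcongr
        exact tsum_posPow_le_of_rel hq rel hcount1 hcount2 hle
    _ = _ := by ring

end BoxLikeIFS

/-! ### Existence of the spectra of the projections -/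

/-- Fekete's lemma for `a n + c`; the bounded increments supply a linear lower bound, which keeps
the limit finite. -/
theorem exists_tendsto_div_of_almost_subadditive {a : ℕ → ℝ} {c K : ℝ}
    (hK : ∀ n, |a (n + 1) - a n| ≤ K) (h : ∀ m n, a (m + n) ≤ a m + a n + c) :
    ∃ L : ℝ, Tendsto (fun n : ℕ => a n / n) atTop (𝓝 L) := by
  have hsub : Subadditive fun n => a n + c := fun m n => by
    have := h m n
    change a (m + n) + c ≤ a m + c + (a n + c)
    linarith
  have hK0 : 0 ≤ K := (abs_nonneg _).trans (hK 0)
  have hlow : ∀ n : ℕ, a 0 - K * n ≤ a n := by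
    intro n
    induction n with
    | zero => simp
    | succ n ih =>
      have := abs_le.1 (hK n)
      push_cast
      linarith [this.1]
  have hbdd : BddBelow (range fun n : ℕ => (a n + c) / n) := by
    refine ⟨-(|a 0 + c| + K), ?_⟩
    rintro _ ⟨n, rfl⟩
    rcases n.eq_zero_or_pos with rfl | hn
    · simp only [Nat.cast_zero, div_zero]
      have := abs_nonneg (a 0 + c)
      linarith
    · have hn' : (1 : ℝ) ≤ n := by exact_mod_cast hn
      simp only
      rw [le_div_iff₀ (by linarith)]
      have h1 := hlow n
      have h2 := neg_abs_le (a 0 + c)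
      have h3 := abs_nonneg (a 0 + c)
      nlinarith
  refine ⟨hsub.lim, ?_⟩
  have h1 := (hsub.tendsto_lim hbdd).sub (tendsto_const_div_atTop_nhds_zero_nat c)
  rw [sub_zero] at h1
  refine h1.congr fun n => ?_
  rw [← sub_div, add_sub_cancel_right]

theorem exists_tendsto_div_of_almost_superadditive {a : ℕ → ℝ} {c K : ℝ}
    (hK : ∀ n, |a (n + 1) - a n| ≤ K) (h : ∀ m n, a m + a n ≤ a (m + n) + c) :
    ∃ L : ℝ, Tendsto (fun n : ℕ => a n / n) atTop (𝓝 L) := by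
  obtain ⟨L, hL⟩ := exists_tendsto_div_of_almost_subadditive (a := fun n => -a n) (c := c) (K := K)
    (fun n => by rw [← abs_neg]; convert hK n using 2; ring) (fun m n => by
      have := h m n
      linarith)
  refine ⟨-L, hL.neg.congr fun n => ?_⟩
  rw [neg_div, neg_neg]

theorem log_toReal_le {x y C : ℝ≥0∞} (hx : x ≠ 0) (hy : y ≠ ∞) (hC : C ≠ ∞) (h : x ≤ C * y) :
    Real.log x.toReal ≤ Real.log C.toReal + Real.log y.toReal := by
  have hCy : C * y ≠ ∞ := ENNReal.mul_ne_top hC hy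
  have hxt : x ≠ ∞ := ne_top_of_le_ne_top hCy h
  have h0 : C * y ≠ 0 := fun h0 => hx (le_antisymm (h.trans h0.le) bot_le)
  rw [← Real.log_mul (ENNReal.toReal_ne_zero.2 ⟨left_ne_zero_of_mul h0, hC⟩)
    (ENNReal.toReal_ne_zero.2 ⟨right_ne_zero_of_mul h0, hy⟩), ← ENNReal.toReal_mul]
  exact Real.log_le_log (ENNReal.toReal_pos hx hxt) (ENNReal.toReal_mono hCy h)

namespace BoxLikeIFS

variable {ι : Type*} [Fintype ι] {Φ : BoxLikeIFS ι} {μ : Measure Plane}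

/-- Along `δ = 2 ^ (-n)` almost sub- or superadditivity gives the limit, and comparable scales
differ by a bounded factor. The finitely many `n` before the error is small are absorbed in `C`. -/
theorem IsSelfAffineMeasure.exists_log_coordSum (hμ : Φ.IsSelfAffineMeasure μ) {q : ℝ}
    (hq : 0 ≤ q) (j : Fin 2) : ∃ τ : ℝ, ∀ ε : ℝ, 0 < ε → ∃ C : ℝ, ∀ δ : ℝ, 0 < δ → δ ≤ 1 →
      |Real.log (coordSum q μ j δ).toReal + τ * Real.log δ| ≤ -ε * Real.log δ + C := by
  have := hμ.isProbabilityMeasure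
  have hl2 : 0 < Real.log 2 := Real.log_pos one_lt_two
  have hpos : ∀ n : ℕ, (0 : ℝ) < (1 / 2) ^ n := fun n => by positivity
  have hle1 : ∀ n : ℕ, (1 / 2 : ℝ) ^ n ≤ 1 := fun n => pow_le_one₀ (by norm_num) (by norm_num)
  have hne0 : ∀ δ : ℝ, coordSum q μ j δ ≠ 0 := fun δ => coordSum_ne_zero hq j δ
  have hnet : ∀ δ : ℝ, 0 < δ → coordSum q μ j δ ≠ ∞ := fun δ => hμ.coordSum_ne_top hq j
  obtain ⟨K, hK, hscale⟩ := exists_coordSum_le hq 2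
  set k := Real.log K.toReal with hk
  have hclose : ∀ δ ε : ℝ, 0 < δ → 0 < ε → δ ≤ 2 * ε → ε ≤ 2 * δ →
      |Real.log (coordSum q μ j δ).toReal - Real.log (coordSum q μ j ε).toReal| ≤ k := by
    intro δ ε hδ hε h1 h2
    have a1 := log_toReal_le (hne0 δ) (hnet ε hε) hK (hscale μ j δ ε hδ hε h1 h2)
    have a2 := log_toReal_le (hne0 ε) (hnet δ hδ) hK (hscale μ j ε δ hε hδ h2 h1)
    rw [abs_le]; constructor <;> linarith
  set a : ℕ → ℝ := fun n => Real.log (coordSum q μ j ((1 / 2) ^ n)).toReal with ha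
  have hstep : ∀ n, |a (n + 1) - a n| ≤ k := fun n =>
    hclose _ _ (hpos _) (hpos _) (by rw [pow_succ]; linarith [hpos n])
      (by rw [pow_succ]; linarith [hpos n])
  obtain ⟨L, hL⟩ : ∃ L : ℝ, Tendsto (fun n : ℕ => a n / n) atTop (𝓝 L) := by
    rcases le_total q 1 with hq1 | hq1
    · obtain ⟨C, hC, h⟩ := hμ.exists_coordSum_mul_le hq hq1 j
      refine exists_tendsto_div_of_almost_superadditive (c := Real.log C.toReal) hstep
        fun m n => ?_
      have h1 := log_toReal_le (mul_ne_zero (hne0 _) (hne0 _)) (hnet _ (mul_pos (hpos m) (hpos n)))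
        hC (h _ _ (hpos m) (hle1 m) (hpos n) (hle1 n))
      rw [ENNReal.toReal_mul, Real.log_mul, ← pow_add] at h1
      · simp only [ha]; linarith
      · exact ENNReal.toReal_ne_zero.2 ⟨hne0 _, hnet _ (hpos _)⟩
      · exact ENNReal.toReal_ne_zero.2 ⟨hne0 _, hnet _ (hpos _)⟩
    · obtain ⟨C, hC, h⟩ := hμ.exists_coordSum_le_mul hq1 j
      refine exists_tendsto_div_of_almost_subadditive (c := Real.log C.toReal) hstep
        fun m n => ?_
      have h1 := log_toReal_le (hne0 _) (ENNReal.mul_ne_top (hnet _ (hpos m)) (hnet _ (hpos n)))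
        hC (h _ _ (hpos m) (hle1 m) (hpos n) (hle1 n))
      rw [ENNReal.toReal_mul, Real.log_mul, ← pow_add] at h1
      · simp only [ha]; linarith
      · exact ENNReal.toReal_ne_zero.2 ⟨hne0 _, hnet _ (hpos _)⟩
      · exact ENNReal.toReal_ne_zero.2 ⟨hne0 _, hnet _ (hpos _)⟩
  refine ⟨L / Real.log 2, fun ε hε => ?_⟩
  have hlin : ∃ C : ℝ, ∀ n : ℕ, |a n - n * L| ≤ ε * Real.log 2 * n + C := by
    have hev := Metric.tendsto_atTop.1 hL (ε * Real.log 2) (by positivity)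
    obtain ⟨N, hN⟩ := hev
    obtain ⟨C, hC⟩ := ((Finset.range (N + 1)).image fun n : ℕ => |a n - n * L|).bddAbove
    refine ⟨max C 0, fun n => ?_⟩
    by_cases hn : n ≤ N
    · have h1 : |a n - n * L| ≤ C := hC (by
        simp only [Finset.coe_image, mem_image, Finset.mem_coe, Finset.mem_range]
        exact ⟨n, by omega, rfl⟩)
      have h2 : 0 ≤ ε * Real.log 2 * n := by positivity
      linarith [le_max_left C 0]
    · have hn0 : (0 : ℝ) < n := by
        have : 0 < n := by omega
        exact_mod_cast this
      have h1 := hN n (by omega)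
      rw [Real.dist_eq] at h1
      have h2 : a n - n * L = (a n / n - L) * n := by field_simp
      rw [h2, abs_mul, abs_of_pos hn0]
      have h3 := mul_le_mul_of_nonneg_right h1.le hn0.le
      linarith [le_max_right C 0]
  obtain ⟨C, hC⟩ := hlin
  refine ⟨k + C + |L|, fun δ hδ hδ1 => ?_⟩
  obtain ⟨n, hn1, hn2⟩ := exists_nat_pow_near_of_lt_one hδ hδ1 (y := (1 / 2 : ℝ)) (by norm_num)
    (by norm_num)
  have h1 := hclose δ ((1 / 2) ^ n) hδ (hpos n) (by linarith) (by rw [pow_succ] at hn1; linarith)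
  have h2 := hC n
  have hlogp : ∀ m : ℕ, Real.log ((1 / 2 : ℝ) ^ m) = -(m * Real.log 2) := fun m => by
    rw [Real.log_pow, one_div, Real.log_inv]; ring
  have h3 : Real.log δ ≤ -(n * Real.log 2) := by
    rw [← hlogp]; exact Real.log_le_log hδ hn2
  have h4 : -((n + 1) * Real.log 2) ≤ Real.log δ := by
    have := hlogp (n + 1)
    push_cast at this
    rw [← this]; exact Real.log_le_log (hpos _) hn1.le
  -- By the choice of `n`, the number `n * log 2 + log δ` lies in `[-log 2, 0]`.
  have h5 : |n * L + L / Real.log 2 * Real.log δ| ≤ |L| := by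
    have e : n * L + L / Real.log 2 * Real.log δ =
        L * ((n * Real.log 2 + Real.log δ) / Real.log 2) := by field_simp
    rw [e, abs_mul]
    refine mul_le_of_le_one_right (abs_nonneg _) ?_
    rw [abs_le, le_div_iff₀ hl2, div_le_iff₀ hl2]
    constructor <;> linarith
  have h6 : ε * Real.log 2 * n ≤ -ε * Real.log δ := by nlinarith
  have h7 : Real.log (coordSum q μ j δ).toReal + L / Real.log 2 * Real.log δ =
      (Real.log (coordSum q μ j δ).toReal - Real.log (coordSum q μ j ((1 / 2) ^ n)).toReal) +
      (a n - n * L) + (n * L + L / Real.log 2 * Real.log δ) := by simp only [ha]; ring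
  rw [h7]
  refine (abs_add_three _ _ _).trans ?_
  linarith

/-- The exponent of the grid sums of the `j`-th projection. -/
def IsCoordExponent (q : ℝ) (μ : Measure Plane) (j : Fin 2) (τ : ℝ) : Prop :=
  ∀ T ε : ℝ, 1 ≤ T → 0 < ε → ∃ C : ℝ, 0 < C ∧ ∀ δ : ℝ, 0 < δ → δ ≤ T →
    coordSum q μ j δ ≤ ENNReal.ofReal (C * δ ^ (-τ - ε)) ∧
    ENNReal.ofReal (δ ^ (-τ + ε)) ≤ ENNReal.ofReal C * coordSum q μ j δ

/-- The range of scales extends up to an arbitrary `T` because `δ / α₁(w)` may exceed `1` by a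
bounded factor on a cut; scale `δ` is compared with `δ / T`. -/
theorem IsSelfAffineMeasure.exists_isCoordExponent (hμ : Φ.IsSelfAffineMeasure μ) {q : ℝ}
    (hq : 0 ≤ q) (j : Fin 2) : ∃ τ : ℝ, IsCoordExponent q μ j τ := by
  have := hμ.isProbabilityMeasure
  obtain ⟨τ, h⟩ := hμ.exists_log_coordSum hq j
  refine ⟨τ, fun T ε hT hε => ?_⟩
  obtain ⟨C, hC⟩ := h ε hε
  obtain ⟨D, hD, hscale⟩ := exists_coordSum_le hq T
  have hT0 : 0 < T := by linarith
  have hne0 : ∀ δ : ℝ, coordSum q μ j δ ≠ 0 := fun δ => coordSum_ne_zero hq j δ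
  have hnet : ∀ δ : ℝ, 0 < δ → coordSum q μ j δ ≠ ∞ := fun δ => hμ.coordSum_ne_top hq j
  have hsmall : ∀ δ : ℝ, 0 < δ → δ ≤ 1 →
      coordSum q μ j δ ≤ ENNReal.ofReal (Real.exp C * δ ^ (-τ - ε)) ∧
      ENNReal.ofReal (δ ^ (-τ + ε)) ≤ ENNReal.ofReal (Real.exp C) * coordSum q μ j δ := by
    intro δ hδ hδ1
    have h1 := abs_le.1 (hC δ hδ hδ1)
    have hp : 0 < (coordSum q μ j δ).toReal := ENNReal.toReal_pos (hne0 δ) (hnet δ hδ)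
    rw [← ENNReal.ofReal_toReal (hnet δ hδ), ← ENNReal.ofReal_mul (Real.exp_pos C).le]
    generalize (coordSum q μ j δ).toReal = x at *
    constructor
    · refine ENNReal.ofReal_le_ofReal ?_
      rw [Real.rpow_def_of_pos hδ, ← Real.exp_add, ← Real.log_le_iff_le_exp hp]
      linarith [h1.2]
    · refine ENNReal.ofReal_le_ofReal ?_
      have e : Real.exp C * x = Real.exp (C + Real.log x) := by rw [Real.exp_add, Real.exp_log hp]
      rw [e, Real.rpow_def_of_pos hδ, Real.exp_le_exp]
      linarith [h1.1]
  set E := Real.exp C with hE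
  have hE0 : 0 < E := Real.exp_pos C
  set M : ℝ := max 1 (max (T ^ (τ + ε)) (T ^ (-τ + ε))) with hM
  have hM1 : 1 ≤ M := le_max_left _ _
  have hTM1 : T ^ (τ + ε) ≤ M := (le_max_left _ _).trans (le_max_right _ _)
  have hTM2 : T ^ (-τ + ε) ≤ M := (le_max_right _ _).trans (le_max_right _ _)
  have hDE : ENNReal.ofReal (D.toReal + 1) ≥ D := by
    rw [← ENNReal.ofReal_toReal hD, ENNReal.toReal_ofReal ENNReal.toReal_nonneg]
    exact ENNReal.ofReal_le_ofReal (by linarith)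
  have hDr : 0 < D.toReal + 1 := by have := ENNReal.toReal_nonneg (a := D); linarith
  refine ⟨(D.toReal + 1) * E * M, by positivity, fun δ hδ hδT => ?_⟩
  have hδ' : 0 < δ / T := by positivity
  obtain ⟨h1, h2⟩ := hsmall (δ / T) hδ' (by rwa [div_le_one hT0])
  have hs1 : δ / T ≤ T * δ := (div_le_self hδ.le hT).trans (le_mul_of_one_le_left hδ.le hT)
  have hs2 : δ ≤ T * (δ / T) := by rw [mul_div_cancel₀ _ hT0.ne']
  constructor
  · calc coordSum q μ j δ ≤ D * coordSum q μ j (δ / T) := hscale μ j δ _ hδ hδ' hs2 hs1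
      _ ≤ ENNReal.ofReal (D.toReal + 1) * ENNReal.ofReal (E * (δ / T) ^ (-τ - ε)) := by
          gcongr
      _ = ENNReal.ofReal ((D.toReal + 1) * (E * (T ^ (τ + ε) * δ ^ (-τ - ε)))) := by
          have e : (δ / T) ^ (-τ - ε) = T ^ (τ + ε) * δ ^ (-τ - ε) := by
            rw [Real.div_rpow hδ.le hT0.le, div_eq_mul_inv, ← Real.rpow_neg hT0.le, mul_comm]
            congr 2
            ring
          rw [← ENNReal.ofReal_mul hDr.le, e]
      _ ≤ ENNReal.ofReal ((D.toReal + 1) * (E * (M * δ ^ (-τ - ε)))) := by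
          refine ENNReal.ofReal_le_ofReal ?_
          gcongr
      _ = _ := by congr 1; ring
  · have e1 : δ ^ (-τ + ε) = T ^ (-τ + ε) * (δ / T) ^ (-τ + ε) := by
      rw [← Real.mul_rpow hT0.le hδ'.le, mul_div_cancel₀ _ hT0.ne']
    calc ENNReal.ofReal (δ ^ (-τ + ε)) ≤ ENNReal.ofReal (M * (δ / T) ^ (-τ + ε)) := by
          rw [e1]
          refine ENNReal.ofReal_le_ofReal ?_
          gcongr
      _ = ENNReal.ofReal M * ENNReal.ofReal ((δ / T) ^ (-τ + ε)) :=
          ENNReal.ofReal_mul (by positivity)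
      _ ≤ ENNReal.ofReal M * (ENNReal.ofReal E * (D * coordSum q μ j δ)) := by
          gcongr
          refine h2.trans ?_
          gcongr
          exact hscale μ j _ δ hδ' hδ hs1 hs2
      _ ≤ ENNReal.ofReal M * (ENNReal.ofReal E *
            (ENNReal.ofReal (D.toReal + 1) * coordSum q μ j δ)) := by gcongr
      _ = _ := by
          rw [ENNReal.ofReal_mul (by positivity), ENNReal.ofReal_mul hDr.le]
          ring

theorem IsCoordExponent.subExpLE {q τ : ℝ} {j : Fin 2} (h : IsCoordExponent q μ j τ) :
    SubExpLE (coordSum q μ j) (fun δ => ENNReal.ofReal (δ ^ (-τ))) ∧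
    SubExpLE (fun δ => ENNReal.ofReal (δ ^ (-τ))) (coordSum q μ j) := by
  have h1 : ∀ᶠ δ in 𝓝[>] (0 : ℝ), δ < 1 :=
    eventually_nhdsWithin_of_eventually_nhds (eventually_lt_nhds one_pos)
  constructor
  · intro ε hε
    obtain ⟨C, hC, hb⟩ := h 1 (ε / 2) le_rfl (by positivity)
    filter_upwards [h1, self_mem_nhdsWithin, eventually_le_ofReal_rpow_neg
      (ENNReal.ofReal_ne_top (r := C)) (half_pos hε)] with δ hδ1 hδ hCδ
    have hpos : (0 : ℝ) < δ := hδ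
    calc coordSum q μ j δ ≤ ENNReal.ofReal (C * δ ^ (-τ - ε / 2)) := (hb δ hδ hδ1.le).1
      _ = ENNReal.ofReal C * ENNReal.ofReal (δ ^ (-τ - ε / 2)) := ENNReal.ofReal_mul hC.le
      _ ≤ ENNReal.ofReal (δ ^ (-(ε / 2))) * ENNReal.ofReal (δ ^ (-τ - ε / 2)) := by gcongr
      _ = _ := by
          rw [← ENNReal.ofReal_mul (by positivity), ← ENNReal.ofReal_mul (by positivity),
            ← Real.rpow_add hpos, ← Real.rpow_add hpos]
          congr 2; ring
  · intro ε hε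
    obtain ⟨C, hC, hb⟩ := h 1 (ε / 2) le_rfl (by positivity)
    filter_upwards [h1, self_mem_nhdsWithin, eventually_le_ofReal_rpow_neg
      (ENNReal.ofReal_ne_top (r := C)) (half_pos hε)] with δ hδ1 hδ hCδ
    have hpos : (0 : ℝ) < δ := hδ
    calc ENNReal.ofReal (δ ^ (-τ))
        = ENNReal.ofReal (δ ^ (-(ε / 2))) * ENNReal.ofReal (δ ^ (-τ + ε / 2)) := by
          rw [← ENNReal.ofReal_mul (by positivity), ← Real.rpow_add hpos]
          congr 2; ring
      _ ≤ ENNReal.ofReal (δ ^ (-(ε / 2))) * (ENNReal.ofReal C * coordSum q μ j δ) := by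
          gcongr
          exact (hb δ hδ hδ1.le).2
      _ ≤ ENNReal.ofReal (δ ^ (-(ε / 2))) * (ENNReal.ofReal (δ ^ (-(ε / 2))) *
            coordSum q μ j δ) := by gcongr
      _ = _ := by
          rw [← mul_assoc, ← ENNReal.ofReal_mul (by positivity), ← Real.rpow_add hpos]
          congr 3; ring

end BoxLikeIFS

/-! ### The pressure of an almost multiplicative function on words -/

section Pressure

variable {ι : Type*} [Fintype ι] {ψ : List ι → ℝ}

/-- The sum of `ψ` over the words of length `n`. -/
def levelSum (ψ : List ι → ℝ) (n : ℕ) : ℝ := ∑ w ∈ words ι n, ψ w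

/-- A positive sub- or supermultiplicative function on words that changes by bounded factors when
a letter is appended. -/
structure IsQuasiMul (ψ : List ι → ℝ) : Prop where
  pos : ∀ w, 0 < ψ w
  sub_or_super : (∀ u v, ψ (u ++ v) ≤ ψ u * ψ v) ∨ (∀ u v, ψ u * ψ v ≤ ψ (u ++ v))
  step : ∃ c C : ℝ, 0 < c ∧ 0 < C ∧ ∀ w i, c * ψ w ≤ ψ (w ++ [i]) ∧ ψ (w ++ [i]) ≤ C * ψ w

theorem levelSum_succ (ψ : List ι → ℝ) (n : ℕ) :
    levelSum ψ (n + 1) = ∑ w ∈ words ι n, ∑ i, ψ (w ++ [i]) := by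
  rw [levelSum, sum_words_add]
  exact Finset.sum_congr rfl fun w _ => sum_words_one _

theorem IsQuasiMul.exists_levelSum_succ [Nonempty ι] (h : IsQuasiMul ψ) :
    ∃ a b : ℝ, 0 < a ∧ 0 < b ∧
      ∀ n, a * levelSum ψ n ≤ levelSum ψ (n + 1) ∧ levelSum ψ (n + 1) ≤ b * levelSum ψ n := by
  obtain ⟨c, C, hc, hC, hst⟩ := h.step
  have hcard : (0 : ℝ) < Fintype.card ι := by exact_mod_cast Fintype.card_pos
  refine ⟨Fintype.card ι * c, Fintype.card ι * C, by positivity, by positivity, fun n => ?_⟩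
  rw [levelSum_succ, levelSum, Finset.mul_sum, Finset.mul_sum]
  constructor
  · refine Finset.sum_le_sum fun w _ => ?_
    calc Fintype.card ι * c * ψ w = ∑ _i : ι, c * ψ w := by
          rw [Finset.sum_const, Finset.card_univ, nsmul_eq_mul]; ring
      _ ≤ _ := Finset.sum_le_sum fun i _ => (hst w i).1
  · refine Finset.sum_le_sum fun w _ => ?_
    calc _ ≤ ∑ _i : ι, C * ψ w := Finset.sum_le_sum fun i _ => (hst w i).2
      _ = Fintype.card ι * C * ψ w := by
          rw [Finset.sum_const, Finset.card_univ, nsmul_eq_mul]; ring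

theorem IsQuasiMul.levelSum_pos [Nonempty ι] (h : IsQuasiMul ψ) (n : ℕ) : 0 < levelSum ψ n := by
  obtain ⟨a, b, ha, -, hab⟩ := h.exists_levelSum_succ
  induction n with
  | zero => rw [levelSum, sum_words_zero]; exact h.pos []
  | succ n ih => exact (mul_pos ha ih).trans_le (hab n).1

theorem levelSum_mul (ψ : List ι → ℝ) (m n : ℕ) :
    levelSum ψ m * levelSum ψ n = ∑ u ∈ words ι m, ∑ v ∈ words ι n, ψ u * ψ v :=
  Finset.sum_mul_sum _ _ _ _

theorem IsQuasiMul.exists_tendsto [Nonempty ι] (h : IsQuasiMul ψ) :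
    ∃ L : ℝ, 0 < L ∧ Tendsto (fun n : ℕ => levelSum ψ n ^ (1 / (n : ℝ))) atTop (𝓝 L) := by
  obtain ⟨a, b, ha, hb, hab⟩ := h.exists_levelSum_succ
  have hK : ∀ n, |Real.log (levelSum ψ (n + 1)) - Real.log (levelSum ψ n)| ≤
      max |Real.log a| |Real.log b| := by
    intro n
    have hn := h.levelSum_pos n
    have h1 := Real.log_le_log (mul_pos ha hn) (hab n).1
    have h2 := Real.log_le_log (h.levelSum_pos (n + 1)) (hab n).2
    rw [Real.log_mul ha.ne' hn.ne'] at h1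
    rw [Real.log_mul hb.ne' hn.ne'] at h2
    rw [abs_le]
    constructor
    · linarith [neg_abs_le (Real.log a), le_max_left |Real.log a| |Real.log b|]
    · linarith [le_abs_self (Real.log b), le_max_right |Real.log a| |Real.log b|]
  obtain ⟨L, hL⟩ : ∃ L : ℝ, Tendsto (fun n : ℕ => Real.log (levelSum ψ n) / n) atTop (𝓝 L) := by
    rcases h.sub_or_super with hs | hs
    · refine exists_tendsto_div_of_almost_subadditive (c := 0) hK fun m n => ?_
      rw [add_zero, ← Real.log_mul (h.levelSum_pos m).ne' (h.levelSum_pos n).ne']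
      refine Real.log_le_log (h.levelSum_pos _) ?_
      rw [levelSum_mul, levelSum, sum_words_add]
      exact Finset.sum_le_sum fun u _ => Finset.sum_le_sum fun v _ => hs u v
    · refine exists_tendsto_div_of_almost_superadditive (c := 0) hK fun m n => ?_
      rw [add_zero, ← Real.log_mul (h.levelSum_pos m).ne' (h.levelSum_pos n).ne']
      refine Real.log_le_log (mul_pos (h.levelSum_pos _) (h.levelSum_pos _)) ?_
      rw [levelSum_mul, levelSum, sum_words_add]
      exact Finset.sum_le_sum fun u _ => Finset.sum_le_sum fun v _ => hs u v
  refine ⟨Real.exp L, Real.exp_pos L, ((Real.continuous_exp.tendsto L).comp hL).congr fun n => ?_⟩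
  rw [Function.comp_apply, Real.rpow_def_of_pos (h.levelSum_pos n), mul_one_div]

/-- By the root test `ψ` is summable over all words, and a stopping family is a set of words. -/
theorem exists_sum_stopWords_le (hpos : ∀ w, 0 ≤ ψ w) {L : ℝ} (hL : L < 1)
    (h : Tendsto (fun n : ℕ => levelSum ψ n ^ (1 / (n : ℝ))) atTop (𝓝 L)) :
    ∃ C : ℝ, 0 < C ∧ ∀ (n : ℕ) (p : List ι → Prop), ∑ w ∈ stopWords n p, ψ w ≤ C := by
  classical
  have hZ : ∀ n, 0 ≤ levelSum ψ n := fun n => Finset.sum_nonneg fun w _ => hpos w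
  obtain ⟨r, hr, hr1⟩ := exists_between (max_lt hL one_pos)
  have hr0 : 0 < r := (le_max_right _ _).trans_lt hr
  have hsum : Summable (levelSum ψ) := by
    refine (summable_geometric_of_lt_one hr0.le hr1).of_norm_bounded_eventually_nat ?_
    filter_upwards [h.eventually_lt_const ((le_max_left _ _).trans_lt hr),
      eventually_gt_atTop 0] with n hn hn0
    have hn' : (n : ℝ) ≠ 0 := by exact_mod_cast hn0.ne'
    rw [Real.norm_of_nonneg (hZ n)]
    calc levelSum ψ n = (levelSum ψ n ^ (1 / (n : ℝ))) ^ n := by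
          rw [← Real.rpow_natCast, ← Real.rpow_mul (hZ n), one_div_mul_cancel hn', Real.rpow_one]
      _ ≤ r ^ n := pow_le_pow_left₀ (Real.rpow_nonneg (hZ n) _) hn.le n
  have h0 : 0 ≤ ∑' n, levelSum ψ n := tsum_nonneg hZ
  refine ⟨∑' n, levelSum ψ n + 1, by linarith, fun n p => ?_⟩
  have h1 : ∑ w ∈ stopWords n p, ψ w =
      ∑ k ∈ Finset.range (n + 1), ∑ w ∈ stopWords n p with w.length = k, ψ w :=
    (Finset.sum_fiberwise_of_maps_to (fun w hw => Finset.mem_range.2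
      (Nat.lt_succ_of_le (length_le_of_mem_stopWords hw))) _).symm
  have h2 : ∑ k ∈ Finset.range (n + 1), ∑ w ∈ stopWords n p with w.length = k, ψ w ≤
      ∑ k ∈ Finset.range (n + 1), levelSum ψ k := by
    refine Finset.sum_le_sum fun k _ => Finset.sum_le_sum_of_subset_of_nonneg (fun w hw => ?_)
      fun w _ _ => hpos w
    rw [← (Finset.mem_filter.1 hw).2]
    exact mem_words w
  have h3 := hsum.sum_le_tsum (Finset.range (n + 1)) fun k _ => hZ k
  linarith

theorem tendsto_levelSum_atTop {L : ℝ} (hL : 1 < L)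
    (h : Tendsto (fun n : ℕ => levelSum ψ n ^ (1 / (n : ℝ))) atTop (𝓝 L))
    (hZ : ∀ n, 0 ≤ levelSum ψ n) :
    Tendsto (levelSum ψ) atTop atTop := by
  obtain ⟨r, hr, hr1⟩ := exists_between hL
  refine tendsto_atTop_mono' atTop ?_ (tendsto_pow_atTop_atTop_of_one_lt hr)
  filter_upwards [h.eventually_const_lt hr1, eventually_gt_atTop 0] with n hn hn0
  have hn' : (n : ℝ) ≠ 0 := by exact_mod_cast hn0.ne'
  calc r ^ n ≤ (levelSum ψ n ^ (1 / (n : ℝ))) ^ n := pow_le_pow_left₀ (by linarith) hn.le n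
    _ = levelSum ψ n := by
        rw [← Real.rpow_natCast, ← Real.rpow_mul (hZ n), one_div_mul_cancel hn', Real.rpow_one]

theorem sum_words_append_le {C : ℝ} (hC : 0 < C)
    (hstep : ∀ w i, ψ (w ++ [i]) ≤ C * ψ w) (w : List ι) (m : ℕ) :
    ∑ v ∈ words ι m, ψ (w ++ v) ≤ (Fintype.card ι * C) ^ m * ψ w := by
  induction m with
  | zero => simp [sum_words_zero]
  | succ m ih =>
    calc ∑ v ∈ words ι (m + 1), ψ (w ++ v)
        = ∑ v ∈ words ι m, ∑ i, ψ ((w ++ v) ++ [i]) := by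
          rw [sum_words_add]
          refine Finset.sum_congr rfl fun v _ => ?_
          rw [sum_words_one]
          simp only [List.append_assoc]
      _ ≤ ∑ v ∈ words ι m, ∑ _i : ι, C * ψ (w ++ v) :=
          Finset.sum_le_sum fun v _ => Finset.sum_le_sum fun i _ => hstep _ i
      _ = Fintype.card ι * C * ∑ v ∈ words ι m, ψ (w ++ v) := by
          rw [Finset.mul_sum]
          refine Finset.sum_congr rfl fun v _ => ?_
          rw [Finset.sum_const, Finset.card_univ, nsmul_eq_mul]; ring
      _ ≤ Fintype.card ι * C * ((Fintype.card ι * C) ^ m * ψ w) := by gcongr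
      _ = _ := by ring

/-- The level sums tend to infinity. In the submultiplicative case long words are split at the
stopping family; in the supermultiplicative case `ψ` is compared with a function on words that does
not decrease when summed over children. -/
theorem IsQuasiMul.exists_le_sum_stopWords [Nonempty ι] (h : IsQuasiMul ψ) {L : ℝ} (hL : 1 < L)
    (hlim : Tendsto (fun n : ℕ => levelSum ψ n ^ (1 / (n : ℝ))) atTop (𝓝 L)) :
    ∃ c : ℝ, 0 < c ∧ ∀ (n : ℕ) (p : List ι → Prop), c ≤ ∑ w ∈ stopWords n p, ψ w := by
  have htop := tendsto_levelSum_atTop hL hlim fun n => (h.levelSum_pos n).le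
  rcases h.sub_or_super with hs | hs
  · refine ⟨1, one_pos, fun n p => ?_⟩
    classical
    -- A record level: `k > n` is the first level whose sum exceeds `M`, so its sum is at least that
    -- of every earlier level. Splitting the words of length `k` at the stopping family gives
    -- `levelSum ψ k ≤ (∑ ψ w) * levelSum ψ k`.
    obtain ⟨M, hM⟩ := ((Finset.range (n + 1)).image (levelSum ψ)).bddAbove
    have hex : ∃ k, M < levelSum ψ k := (htop.eventually_gt_atTop M).exists
    set k := Nat.find hex with hk
    have hkM : M < levelSum ψ k := Nat.find_spec hex
    have hrec : ∀ j ≤ k, levelSum ψ j ≤ levelSum ψ k := by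
      intro j hj
      rcases hj.lt_or_eq with hj | rfl
      · exact (not_lt.1 (Nat.find_min hex hj)).trans hkM.le
      · exact le_rfl
    have hnk : n < k := by
      by_contra hcon
      refine absurd (hM ?_) (not_le.2 hkM)
      simp only [Finset.coe_image, mem_image, Finset.mem_coe, Finset.mem_range]
      exact ⟨k, by omega, rfl⟩
    have h1 := sum_stopWords_eq n p (fun w => ∑ v ∈ words ι (k - w.length), ψ (w ++ v)) (by
      intro w hw
      have e : k - w.length = (k - (w.length + 1)) + 1 := by omega
      simp only [e, sum_words_succ, List.length_append, List.length_singleton, List.append_assoc,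
        List.singleton_append])
    have h2 : levelSum ψ k ≤ (∑ w ∈ stopWords n p, ψ w) * levelSum ψ k := by
      calc levelSum ψ k = ∑ w ∈ stopWords n p, ∑ v ∈ words ι (k - w.length), ψ (w ++ v) := by
            rw [h1]; rfl
        _ ≤ ∑ w ∈ stopWords n p, ψ w * levelSum ψ (k - w.length) := by
            refine Finset.sum_le_sum fun w _ => ?_
            rw [levelSum, Finset.mul_sum]
            exact Finset.sum_le_sum fun v _ => hs w v
        _ ≤ ∑ w ∈ stopWords n p, ψ w * levelSum ψ k :=
            Finset.sum_le_sum fun w _ =>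
              mul_le_mul_of_nonneg_left (hrec _ (Nat.sub_le _ _)) (h.pos w).le
        _ = _ := (Finset.sum_mul _ _ _).symm
    exact le_of_mul_le_mul_right (by rwa [one_mul]) (h.levelSum_pos k)
  · obtain ⟨k, hk1, hk0⟩ := ((htop.eventually_ge_atTop 1).and (eventually_gt_atTop 0)).exists
    obtain ⟨_, C, -, hC, hst⟩ := h.step
    -- Summing `Θ` over the children of `w` removes the term `ψ w` and adds the sum over the
    -- descendants at depth `k`, which is at least `ψ w * levelSum ψ k ≥ ψ w`. So the total of `Θ`
    -- over a cut is at least `Θ []`, while `Θ ≤ D * ψ`.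
    set Θ : List ι → ℝ := fun w => ∑ m ∈ Finset.range k, ∑ v ∈ words ι m, ψ (w ++ v) with hΘ
    set D : ℝ := ∑ m ∈ Finset.range k, (Fintype.card ι * C) ^ m with hD
    have hup : ∀ w, Θ w ≤ D * ψ w := by
      intro w
      rw [hD, Finset.sum_mul]
      exact Finset.sum_le_sum fun m _ => sum_words_append_le hC (fun w i => (hst w i).2) w m
    have hsub : ∀ w, Θ w ≤ ∑ i, Θ (w ++ [i]) := by
      intro w
      have e : ∑ i, Θ (w ++ [i]) =
          ∑ m ∈ Finset.range k, ∑ v ∈ words ι (m + 1), ψ (w ++ v) := by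
        rw [hΘ, Finset.sum_comm]
        refine Finset.sum_congr rfl fun m _ => ?_
        rw [sum_words_succ]
        simp only [List.append_assoc, List.singleton_append]
      have e2 := Finset.sum_range_succ (fun m => ∑ v ∈ words ι m, ψ (w ++ v)) k
      rw [Finset.sum_range_succ', sum_words_zero, List.append_nil] at e2
      have h3 : ψ w ≤ ∑ v ∈ words ι k, ψ (w ++ v) :=
        calc ψ w ≤ ψ w * levelSum ψ k := le_mul_of_one_le_right (h.pos w).le hk1
          _ ≤ _ := by
              rw [levelSum, Finset.mul_sum]
              exact Finset.sum_le_sum fun v _ => hs w v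
      rw [e]
      simp only [hΘ]
      linarith
    have hpos : 0 < Θ [] := by
      refine Finset.sum_pos (fun m _ => ?_) ⟨0, Finset.mem_range.2 hk0⟩
      exact h.levelSum_pos m
    have hD0 : 0 < D := pos_of_mul_pos_left (hpos.trans_le (hup [])) (h.pos []).le
    refine ⟨Θ [] / D, by positivity, fun n p => ?_⟩
    rw [div_le_iff₀ hD0, mul_comm, Finset.mul_sum]
    exact (le_sum_stopWords n p Θ hsub).trans (Finset.sum_le_sum fun w _ => hup w)

theorem existsUnique_zero_of_strictly_decreasing {F : ℝ → ℝ} {A B : ℝ} (hB : 0 < B)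
    (h : ∀ s t, 0 ≤ t → F s - A * t ≤ F (s + t) ∧ F (s + t) ≤ F s - B * t) :
    ∃! s, F s = 0 := by
  have hanti : StrictAnti F := fun s t hst => by
    have := (h s (t - s) (by linarith)).2
    rw [add_sub_cancel] at this
    nlinarith
  have hA : 0 < A := by
    have := h 0 1 zero_le_one
    linarith [this.1.trans this.2]
  have hcont : Continuous F := by
    refine (LipschitzWith.of_dist_le_mul (K := A.toNNReal) fun s t => ?_).continuous
    rw [Real.coe_toNNReal _ hA.le, Real.dist_eq, Real.dist_eq]
    wlog hst : s ≤ t generalizing s t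
    · rw [abs_sub_comm, abs_sub_comm s]; exact this t s (le_of_not_ge hst)
    have h1 := (h s (t - s) (by linarith)).1
    rw [add_sub_cancel] at h1
    have h2 := hanti.antitone hst
    rw [abs_of_nonneg (by linarith), abs_of_nonpos (by linarith)]
    linarith
  have h1 : ∃ s, F s ≤ 0 := by
    refine ⟨0 + |F 0| / B, ?_⟩
    have := (h 0 (|F 0| / B) (by positivity)).2
    rw [mul_div_cancel₀ _ hB.ne'] at this
    linarith [le_abs_self (F 0)]
  have h2 : ∃ s, 0 ≤ F s := by
    refine ⟨-(|F 0| / B), ?_⟩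
    have := (h (-(|F 0| / B)) (|F 0| / B) (by positivity)).2
    rw [mul_div_cancel₀ _ hB.ne', neg_add_cancel] at this
    linarith [neg_abs_le (F 0)]
  obtain ⟨s, hs⟩ := mem_range_of_exists_le_of_exists_ge hcont h1 h2
  exact ⟨s, hs, fun t ht => hanti.injective (ht.trans hs.symm)⟩

end Pressure

/-! ### The modified singular value function and its pressure -/

namespace BoxLikeIFS

variable {ι : Type*} [Fintype ι] (Φ : BoxLikeIFS ι) {μ : Measure Plane}

theorem wordPerm_one_sub (w : List ι) (j : Fin 2) : Φ.wordPerm w (1 - j) = 1 - Φ.wordPerm w j := by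
  rcases perm_eq_one_or_swap (Φ.wordPerm w) with h | h <;> rw [h] <;> fin_cases j <;> rfl

/-- The analogue of `ψ^{s,q}(w)` in which the longer side is replaced by the one in direction
`j`. -/
def coordPsi (τ : Fin 2 → ℝ) (s q : ℝ) (w : List ι) (j : Fin 2) : ℝ :=
  Φ.wordProb w ^ q * Φ.wordRatio w j ^ τ j * Φ.wordRatio w (1 - j) ^ (s - τ j)

/-- `ψ^{s,q}` with prescribed exponents of the projections. -/
def psiOf (τ : Fin 2 → ℝ) (s q : ℝ) (w : List ι) : ℝ := Φ.coordPsi τ s q w (Φ.longIndex w)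

theorem coordPsi_pos (τ : Fin 2 → ℝ) (s q : ℝ) (w : List ι) (j : Fin 2) :
    0 < Φ.coordPsi τ s q w j :=
  mul_pos (mul_pos (Real.rpow_pos_of_pos (Φ.wordProb_pos w) _)
    (Real.rpow_pos_of_pos (Φ.wordRatio_pos w _) _)) (Real.rpow_pos_of_pos (Φ.wordRatio_pos w _) _)

theorem psiOf_eq (τ : Fin 2 → ℝ) (s q : ℝ) (w : List ι) :
    Φ.psiOf τ s q w = Φ.wordProb w ^ q * Φ.alpha₁ w ^ τ (Φ.longIndex w) *
      Φ.alpha₂ w ^ (s - τ (Φ.longIndex w)) := by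
  rw [alpha₁_eq, alpha₂_eq]; rfl

theorem psiOf_pos (τ : Fin 2 → ℝ) (s q : ℝ) (w : List ι) : 0 < Φ.psiOf τ s q w :=
  Φ.coordPsi_pos τ s q w _

variable {τ : Fin 2 → ℝ}

theorem apply_wordPerm (hτ : ∀ i j, τ (Φ.perm i j) = τ j) (w : List ι) (j : Fin 2) :
    τ (Φ.wordPerm w j) = τ j := by
  rcases Φ.wordPerm_apply_eq w j with h | ⟨i, h⟩
  · rw [h]
  · rw [h, hτ]

/-- A fixed direction can be followed through a product: direction `j` of `u ++ v` is direction `j`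
of `u` and direction `wordPerm u j` of `v`. The invariance of `τ` makes the exponents match, so the
product rule is exact. -/
theorem coordPsi_append (hτ : ∀ i j, τ (Φ.perm i j) = τ j) (s q : ℝ) (u v : List ι) (j : Fin 2) :
    Φ.coordPsi τ s q (u ++ v) j = Φ.coordPsi τ s q u j * Φ.coordPsi τ s q v (Φ.wordPerm u j) := by
  have hr := fun w j => (Φ.wordRatio_pos w j).le
  rw [coordPsi, coordPsi, coordPsi, wordProb_append, wordRatio_append, wordRatio_append,
    wordPerm_one_sub, Φ.apply_wordPerm hτ, Real.mul_rpow (Φ.wordProb_pos u).le (Φ.wordProb_pos v).le,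
    Real.mul_rpow (hr _ _) (hr _ _), Real.mul_rpow (hr _ _) (hr _ _)]
  ring

theorem eq_or_eq_one_sub (j l : Fin 2) : j = l ∨ j = 1 - l := by
  fin_cases j <;> fin_cases l <;> simp

/-- Exchanging the roles of the two sides costs a power of the eccentricity whose exponent has the
sign of `τ 0 + τ 1 - s`. This decides whether `psiOf` is the larger or the smaller of the two values
of `coordPsi`. -/
theorem coordPsi_one_sub_longIndex (τ : Fin 2 → ℝ) (s q : ℝ) (w : List ι) :
    Φ.coordPsi τ s q w (1 - Φ.longIndex w) * (Φ.alpha₁ w / Φ.alpha₂ w) ^ (τ 0 + τ 1 - s) =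
      Φ.psiOf τ s q w := by
  have h1 := Φ.alpha₁_pos w
  have h2 := Φ.alpha₂_pos w
  have hτ : τ 0 + τ 1 = τ (Φ.longIndex w) + τ (1 - Φ.longIndex w) := by
    rcases eq_or_eq_one_sub (Φ.longIndex w) 0 with h | h <;> rw [h] <;> simp [add_comm]
  have e : (1 : Fin 2) - (1 - Φ.longIndex w) = Φ.longIndex w := by
    rcases eq_or_eq_one_sub (Φ.longIndex w) 0 with h | h <;> rw [h] <;> rfl
  rw [psiOf_eq, coordPsi, e, ← alpha₁_eq, ← alpha₂_eq, hτ, Real.div_rpow h1.le h2.le,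
    div_eq_mul_inv, ← Real.rpow_neg h2.le]
  generalize τ (Φ.longIndex w) = x
  generalize τ (1 - Φ.longIndex w) = y
  rw [show Φ.alpha₁ w ^ x = Φ.alpha₁ w ^ (s - y) * Φ.alpha₁ w ^ (x + y - s) by
      rw [← Real.rpow_add h1]; congr 1; ring,
    show Φ.alpha₂ w ^ (s - x) = Φ.alpha₂ w ^ y * Φ.alpha₂ w ^ (-(x + y - s)) by
      rw [← Real.rpow_add h2]; congr 1; ring]
  ring

theorem coordPsi_le_psiOf {s : ℝ} (hs : s ≤ τ 0 + τ 1) (q : ℝ) (w : List ι) (j : Fin 2) :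
    Φ.coordPsi τ s q w j ≤ Φ.psiOf τ s q w := by
  rcases eq_or_eq_one_sub j (Φ.longIndex w) with rfl | h
  · exact le_rfl
  · rw [h, ← coordPsi_one_sub_longIndex]
    refine le_mul_of_one_le_right (Φ.coordPsi_pos _ _ _ _ _).le (Real.one_le_rpow ?_ (by linarith))
    rw [one_le_div (Φ.alpha₂_pos w)]
    exact Φ.alpha₂_le_alpha₁ w

theorem psiOf_le_coordPsi {s : ℝ} (hs : τ 0 + τ 1 ≤ s) (q : ℝ) (w : List ι) (j : Fin 2) :
    Φ.psiOf τ s q w ≤ Φ.coordPsi τ s q w j := by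
  rcases eq_or_eq_one_sub j (Φ.longIndex w) with rfl | h
  · exact le_rfl
  · rw [h, ← coordPsi_one_sub_longIndex]
    refine mul_le_of_le_one_right (Φ.coordPsi_pos _ _ _ _ _).le
      (Real.rpow_le_one_of_one_le_of_nonpos ?_ (by linarith))
    rw [one_le_div (Φ.alpha₂_pos w)]
    exact Φ.alpha₂_le_alpha₁ w

/-- A maximum of exactly multiplicative expressions is submultiplicative and a minimum is
supermultiplicative; the sign of `s - (τ 0 + τ 1)` selects the case. -/
theorem isQuasiMul_psiOf (hτ : ∀ i j, τ (Φ.perm i j) = τ j) (s q : ℝ) :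
    IsQuasiMul (Φ.psiOf τ s q) := by
  have : Nonempty ι := Φ.nonempty_index
  obtain ⟨m, hm⟩ := Finite.exists_min fun x : ι × Fin 2 => Φ.coordPsi τ s q [x.1] x.2
  obtain ⟨M, hM⟩ := Finite.exists_max fun x : ι × Fin 2 => Φ.coordPsi τ s q [x.1] x.2
  have hpos := fun w j => Φ.coordPsi_pos τ s q w j
  have key : ∀ w i j, Φ.coordPsi τ s q [m.1] m.2 * Φ.coordPsi τ s q w j ≤
      Φ.coordPsi τ s q (w ++ [i]) j ∧
      Φ.coordPsi τ s q (w ++ [i]) j ≤ Φ.coordPsi τ s q [M.1] M.2 * Φ.coordPsi τ s q w j := by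
    intro w i j
    rw [Φ.coordPsi_append hτ, mul_comm (Φ.coordPsi τ s q w j)]
    exact ⟨mul_le_mul_of_nonneg_right (hm (i, _)) (hpos _ _).le,
      mul_le_mul_of_nonneg_right (hM (i, _)) (hpos _ _).le⟩
  refine ⟨Φ.psiOf_pos τ s q, ?_, _, _, hpos [m.1] m.2, hpos [M.1] M.2, fun w i => ?_⟩
  · rcases le_total s (τ 0 + τ 1) with hs | hs
    · left
      intro u v
      rw [psiOf, Φ.coordPsi_append hτ]
      exact mul_le_mul (Φ.coordPsi_le_psiOf hs q u _) (Φ.coordPsi_le_psiOf hs q v _) (hpos _ _).le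
        (Φ.psiOf_pos _ _ _ _).le
    · right
      intro u v
      rw [psiOf.eq_1 Φ τ s q (u ++ v), Φ.coordPsi_append hτ]
      exact mul_le_mul (Φ.psiOf_le_coordPsi hs q u _) (Φ.psiOf_le_coordPsi hs q v _)
        (Φ.psiOf_pos _ _ _ _).le (hpos _ _).le
  · rcases le_total s (τ 0 + τ 1) with hs | hs
    · exact ⟨(key w i _).1.trans (Φ.coordPsi_le_psiOf hs q _ _), (key w i _).2.trans
        (mul_le_mul_of_nonneg_left (Φ.coordPsi_le_psiOf hs q _ _) (hpos _ _).le)⟩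
    · exact ⟨(mul_le_mul_of_nonneg_left (Φ.psiOf_le_coordPsi hs q _ _) (hpos _ _).le).trans
        (key w i _).1, (Φ.psiOf_le_coordPsi hs q _ _).trans (key w i _).2⟩

theorem psiOf_add (τ : Fin 2 → ℝ) (s t q : ℝ) (w : List ι) :
    Φ.psiOf τ (s + t) q w = Φ.psiOf τ s q w * Φ.alpha₂ w ^ t := by
  rw [psiOf_eq, psiOf_eq, mul_assoc _ (_ ^ (s - _)), ← Real.rpow_add (Φ.alpha₂_pos w)]
  congr 2; ring

theorem levelSum_psiOf_add_le (τ : Fin 2 → ℝ) (s q : ℝ) {t : ℝ} (ht : 0 ≤ t) (n : ℕ) :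
    levelSum (Φ.psiOf τ (s + t) q) n ≤ levelSum (Φ.psiOf τ s q) n * (Φ.ratioMax ^ t) ^ n := by
  rw [levelSum, levelSum, Finset.sum_mul]
  refine Finset.sum_le_sum fun w hw => ?_
  rw [psiOf_add]
  refine mul_le_mul_of_nonneg_left ?_ (Φ.psiOf_pos _ _ _ _).le
  rw [← Real.rpow_mul_natCast Φ.ratioMax_pos.le, mul_comm, Real.rpow_natCast_mul Φ.ratioMax_pos.le]
  refine Real.rpow_le_rpow (Φ.alpha₂_pos w).le ?_ ht
  rw [← length_of_mem_words hw]
  exact (Φ.alpha₂_le w 0).trans (Φ.wordRatio_le w 0)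

theorem le_levelSum_psiOf_add (τ : Fin 2 → ℝ) (s q : ℝ) {t : ℝ} (ht : 0 ≤ t) (n : ℕ) :
    levelSum (Φ.psiOf τ s q) n * (Φ.ratioMin ^ t) ^ n ≤ levelSum (Φ.psiOf τ (s + t) q) n := by
  rw [levelSum, levelSum, Finset.sum_mul]
  refine Finset.sum_le_sum fun w hw => ?_
  rw [psiOf_add]
  refine mul_le_mul_of_nonneg_left ?_ (Φ.psiOf_pos _ _ _ _).le
  rw [← Real.rpow_mul_natCast Φ.ratioMin_pos.le, mul_comm, Real.rpow_natCast_mul Φ.ratioMin_pos.le]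
  refine Real.rpow_le_rpow (pow_nonneg Φ.ratioMin_pos.le _) ?_ ht
  rw [← length_of_mem_words hw]
  exact Φ.le_alpha₂ w (Φ.le_wordRatio w)

/-- Raising `s` by `t ≥ 0` multiplies a summand of level `n` by `α₂(w) ^ t`, which lies between
`ratioMin ^ (t * n)` and `ratioMax ^ (t * n)`. Hence `log Q` is Lipschitz and decreases at least
linearly. -/
theorem existsUnique_pressure_eq_one {Q : ℝ → ℝ} {q : ℝ} (hQ : ∀ s, 0 < Q s)
    (hlim : ∀ s, Tendsto (fun n : ℕ => levelSum (Φ.psiOf τ s q) n ^ (1 / (n : ℝ))) atTop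
      (𝓝 (Q s))) :
    StrictAnti Q ∧ ∃! s, Q s = 1 := by
  have hZ : ∀ s n, 0 ≤ levelSum (Φ.psiOf τ s q) n := fun s n =>
    Finset.sum_nonneg fun w _ => (Φ.psiOf_pos _ _ _ _).le
  have hroot : ∀ x c : ℝ, 0 ≤ x → 0 ≤ c → ∀ n : ℕ, n ≠ 0 →
      (x * c ^ n) ^ (1 / (n : ℝ)) = x ^ (1 / (n : ℝ)) * c := by
    intro x c hx hc n hn
    rw [Real.mul_rpow hx (pow_nonneg hc n), one_div, Real.pow_rpow_inv_natCast hc hn]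
  have hM := Φ.ratioMax_pos
  have hm := Φ.ratioMin_pos
  have hle : ∀ s t, 0 ≤ t → Q (s + t) ≤ Q s * Φ.ratioMax ^ t := by
    intro s t ht
    refine le_of_tendsto_of_tendsto (hlim (s + t)) ((hlim s).mul_const _) ?_
    filter_upwards [eventually_ne_atTop 0] with n hn
    rw [← hroot _ _ (hZ s n) (by positivity) n hn]
    exact Real.rpow_le_rpow (hZ _ _) (Φ.levelSum_psiOf_add_le τ s q ht n) (by positivity)
  have hge : ∀ s t, 0 ≤ t → Q s * Φ.ratioMin ^ t ≤ Q (s + t) := by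
    intro s t ht
    refine le_of_tendsto_of_tendsto ((hlim s).mul_const _) (hlim (s + t)) ?_
    filter_upwards [eventually_ne_atTop 0] with n hn
    rw [← hroot _ _ (hZ s n) (by positivity) n hn]
    exact Real.rpow_le_rpow (mul_nonneg (hZ _ _) (by positivity))
      (Φ.le_levelSum_psiOf_add τ s q ht n) (by positivity)
  constructor
  · intro s t hst
    have := hle s (t - s) (by linarith)
    rw [add_sub_cancel] at this
    refine this.trans_lt (mul_lt_of_lt_one_right (hQ s) ?_)
    exact Real.rpow_lt_one hM.le Φ.ratioMax_lt_one (by linarith)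
  have key := existsUnique_zero_of_strictly_decreasing (F := fun s => Real.log (Q s))
    (A := -Real.log Φ.ratioMin) (B := -Real.log Φ.ratioMax)
    (neg_pos.2 (Real.log_neg hM Φ.ratioMax_lt_one)) (fun s t ht => by
      have h1 := Real.log_le_log (hQ _) (hle s t ht)
      have h2 := Real.log_le_log (mul_pos (hQ s) (by positivity)) (hge s t ht)
      rw [Real.log_mul (hQ s).ne' (by positivity), Real.log_rpow hM] at h1
      rw [Real.log_mul (hQ s).ne' (by positivity), Real.log_rpow hm] at h2
      constructor <;> linarith)
  obtain ⟨s, hs, huniq⟩ := key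
  refine ⟨s, Real.eq_one_of_pos_of_log_eq_zero (hQ s) hs, fun t ht => huniq t ?_⟩
  simp [ht]

/-! ### The spectra of the projections -/

theorem measure_compl_support_map (μ : Measure Plane) (j : Fin 2) :
    μ.map (coordProj j) (μ.map (coordProj j)).supportᶜ = 0 := Measure.measure_compl_support

theorem IsSelfAffineMeasure.lqSpectrum_coordProj (hμ : Φ.IsSelfAffineMeasure μ) {q : ℝ}
    (hq : 0 ≤ q) {j : Fin 2} {t : ℝ} (ht : IsCoordExponent q μ j t) :
    lowerLqSpectrum (μ.map (coordProj j)) q = (t : EReal) ∧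
    upperLqSpectrum (μ.map (coordProj j)) q = (t : EReal) := by
  have := hμ.isProbabilityMeasure
  set ν := μ.map (coordProj j) with hνdef
  have : IsProbabilityMeasure ν :=
    Measure.isProbabilityMeasure_map (measurable_coordProj j).aemeasurable
  have hν : ν ν.supportᶜ = 0 := measure_compl_support_map μ j
  have h12 : SubExpLE (lqIntegral ν q) (Grid.real.gridSum q ν) ∧
      SubExpLE (Grid.real.gridSum q ν) (lqIntegral ν q) := by
    rcases le_total q 1 with hq1 | hq1
    · obtain ⟨c, A, hc, hA, hmass⟩ := hμ.exists_mass_lower_bound (measurable_coordProj j)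
        (fun x y => by rw [Real.dist_eq]; exact abs_coord_le_dist x y j)
      exact ⟨Grid.real.lqIntegral_subExpLE_of_le_one hq hq1 ν hν,
        Grid.gridSum_subExpLE_lqIntegral_of_le_one _ hq hq1 ν hν hc hA hmass⟩
    · exact ⟨Grid.real.lqIntegral_subExpLE_of_one_le hq1 ν hν,
        Grid.real.gridSum_subExpLE_lqIntegral_of_one_le hq1 ν hν⟩
  rw [hνdef, gridSum_map_coordProj, ← hνdef] at h12
  obtain ⟨h3, h4⟩ := ht.subExpLE
  have h13 := h12.1.trans h3
  have h42 := h4.trans h12.2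
  have hl := lowerExponent_rpow t
  have hu := upperExponent_rpow t
  exact ⟨le_antisymm (h13.lowerExponent_le.trans hl.le) (hl.ge.trans h42.lowerExponent_le),
    le_antisymm (h13.upperExponent_le.trans hu.le) (hu.ge.trans h42.upperExponent_le)⟩

theorem IsSelfAffineMeasure.exists_exponents (hμ : Φ.IsSelfAffineMeasure μ) {q : ℝ}
    (hq : 0 ≤ q) : ∃ τ : Fin 2 → ℝ, (∀ j, IsCoordExponent q μ j (τ j)) ∧
      (∀ i j, τ (Φ.perm i j) = τ j) ∧ (∀ j, lqSpectrum (μ.map (coordProj j)) q = τ j) ∧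
      ∀ s w, Φ.psi μ s q w = Φ.psiOf τ s q w := by
  choose τ hτ using fun j => hμ.exists_isCoordExponent hq j
  have hle : ∀ i j, τ (Φ.perm i j) ≤ τ j := by
    intro i j
    obtain ⟨C, hC, h⟩ := hμ.exists_coordSum_perm_le hq i j
    have h1 := ((hτ (Φ.perm i j)).subExpLE.2.trans (subExpLE_of_le_mul hC h)).trans
      (hτ j).subExpLE.1
    have h2 := h1.upperExponent_le
    rw [upperExponent_rpow, upperExponent_rpow] at h2
    exact_mod_cast h2
  have hinv : ∀ i j, τ (Φ.perm i j) = τ j := by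
    intro i j
    refine le_antisymm (hle i j) ?_
    -- A permutation of two coordinates is an involution, so the inequality at `perm i j` is the
    -- reverse of the one at `j`.
    have := hle i (Φ.perm i j)
    rcases perm_eq_one_or_swap (Φ.perm i) with h | h
    · simp [h]
    · rw [h] at this ⊢
      simpa using this
  have hspec : ∀ j, lqSpectrum (μ.map (coordProj j)) q = τ j := fun j => by
    rw [lqSpectrum, (lqSpectrum_coordProj Φ hμ hq (hτ j)).1, EReal.toReal_coe]
  refine ⟨τ, hτ, hinv, hspec, fun s w => ?_⟩
  rw [psi, wordTau, hspec, projIndex_eq, Φ.apply_wordPerm hinv, psiOf_eq]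

theorem Psi_eq_levelSum (μ : Measure Plane) (k : ℕ) (s q : ℝ) :
    Φ.Psi μ k s q = levelSum (Φ.psi μ s q) k := (sum_words_eq k _).symm

/-- The pressure exists, equals `1` exactly at `γ`, and controls the sums of the
modified singular value function over stopping families. -/
theorem IsSelfAffineMeasure.pressure (hμ : Φ.IsSelfAffineMeasure μ) {q : ℝ} (hq : 0 ≤ q) :
    (∀ s, Tendsto (fun k : ℕ => Φ.Psi μ k s q ^ (1 / (k : ℝ))) atTop (𝓝 (Φ.P μ s q))) ∧
    (∀ s, Φ.P μ s q = 1 ↔ s = Φ.gamma μ q) ∧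
    (∀ s, Φ.gamma μ q < s → ∃ C : ℝ, 0 < C ∧ ∀ (n : ℕ) (p : List ι → Prop),
      ∑ w ∈ stopWords n p, Φ.psi μ s q w ≤ C) ∧
    (∀ s, s < Φ.gamma μ q → ∃ c : ℝ, 0 < c ∧ ∀ (n : ℕ) (p : List ι → Prop),
      c ≤ ∑ w ∈ stopWords n p, Φ.psi μ s q w) := by
  have : Nonempty ι := Φ.nonempty_index
  obtain ⟨τ, -, hinv, -, hpsi⟩ := exists_exponents Φ hμ hq
  have hpsi' : ∀ s, Φ.psi μ s q = Φ.psiOf τ s q := fun s => funext (hpsi s)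
  have hqm := fun s => Φ.isQuasiMul_psiOf hinv s q
  have hP : ∀ s, 0 < Φ.P μ s q ∧ Tendsto (fun n : ℕ => levelSum (Φ.psiOf τ s q) n ^ (1 / (n : ℝ)))
      atTop (𝓝 (Φ.P μ s q)) := by
    intro s
    obtain ⟨L, hL, hlim⟩ := (hqm s).exists_tendsto
    have e : Φ.P μ s q = L := by
      rw [P]
      simp only [Psi_eq_levelSum, hpsi']
      exact hlim.limUnder_eq
    rw [e]
    exact ⟨hL, hlim⟩
  obtain ⟨hanti, s₀, hs₀, huniq⟩ := Φ.existsUnique_pressure_eq_one (fun s => (hP s).1)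
    fun s => (hP s).2
  -- The choice in the definition of `gamma` is a genuine solution because one exists.
  have hγ : Φ.P μ (Φ.gamma μ q) q = 1 := Classical.epsilon_spec (p := fun s => Φ.P μ s q = 1) ⟨s₀, hs₀⟩
  refine ⟨fun s => ?_, fun s => ⟨fun h => hanti.injective (h.trans hγ.symm), fun h => h ▸ hγ⟩,
    fun s hs => ?_, fun s hs => ?_⟩
  · simp only [Psi_eq_levelSum, hpsi']
    exact (hP s).2
  · rw [hpsi']
    exact exists_sum_stopWords_le (fun w => (Φ.psiOf_pos τ s q w).le) ((hanti hs).trans_eq hγ) (hP s).2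
  · rw [hpsi']
    exact (hqm s).exists_le_sum_stopWords (hγ.symm.trans_lt (hanti hs)) (hP s).2

end BoxLikeIFS

/-! ### The grid sums of the self-affine measure -/

/-- The quotient `δ / α` lies in `[1, 1 / m]`, so its powers with exponent `x` and `-x` are at most
`m ^ (-|x|)`, whatever the sign of `x`. -/
theorem rpow_le_mul_rpow_of_comparable {m δ α : ℝ} (hm : 0 < m) (hα : 0 < α) (h1 : m * δ ≤ α)
    (h2 : α ≤ δ) (x : ℝ) : δ ^ x ≤ m ^ (-|x|) * α ^ x ∧ α ^ x ≤ m ^ (-|x|) * δ ^ x := by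
  have hδ : 0 < δ := hα.trans_le h2
  have key : ∀ y : ℝ, |y| = |x| → (δ / α) ^ y ≤ m ^ (-|x|) := by
    intro y hy
    have h3 : 1 ≤ δ / α := by rwa [one_le_div hα]
    calc (δ / α) ^ y ≤ (δ / α) ^ |x| := Real.rpow_le_rpow_of_exponent_le h3 (hy ▸ le_abs_self y)
      _ ≤ m⁻¹ ^ |x| := by
          refine Real.rpow_le_rpow (by positivity) ?_ (abs_nonneg x)
          rw [inv_eq_one_div, div_le_div_iff₀ hα hm]; linarith
      _ = m ^ (-|x|) := by rw [Real.inv_rpow hm.le, Real.rpow_neg hm.le]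
  constructor
  · have := key x rfl
    rwa [Real.div_rpow hδ.le hα.le, div_le_iff₀ (by positivity)] at this
  · have := key (-x) (abs_neg x)
    rwa [Real.rpow_neg (by positivity), Real.div_rpow hδ.le hα.le, inv_div,
      div_le_iff₀ (by positivity)] at this

namespace BoxLikeIFS

variable {ι : Type*} [Fintype ι] {Φ : BoxLikeIFS ι} {μ : Measure Plane}

/-- The piece `S_w` at a scale at least its height looks like the projection of `μ` in the direction
of its length. -/
theorem IsSelfAffineMeasure.exists_plane_piece_le (hμ : Φ.IsSelfAffineMeasure μ) {q : ℝ}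
    (hq : 0 ≤ q) : ∃ C : ℝ≥0∞, C ≠ ∞ ∧ ∀ (w : List ι) (δ : ℝ), Φ.alpha₂ w ≤ δ →
      partSum q μ (Grid.plane.cell δ ∘ Φ.wordMap w) ≤
        C * coordSum q μ (Φ.projIndex w) (δ / Φ.alpha₁ w) ∧
      coordSum q μ (Φ.projIndex w) (δ / Φ.alpha₁ w) ≤
        C * partSum q μ (Grid.plane.cell δ ∘ Φ.wordMap w) := by
  obtain ⟨ρ, hρ1, hρ⟩ := hμ.exists_coordBox
  obtain ⟨C, hC, h⟩ := Grid.plane.exists_partSum_le Grid.real hq (4 * ρ)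
  obtain ⟨D, hD, h'⟩ := Grid.real.exists_partSum_le Grid.plane hq (4 * ρ)
  refine ⟨C + D, ENNReal.add_ne_top.2 ⟨hC, hD⟩, fun w δ hδ => ?_⟩
  have hα := Φ.alpha₁_pos w
  have hδ0 : 0 < δ := (Φ.alpha₂_pos w).trans_le hδ
  have hε : 0 < δ / Φ.alpha₁ w := by positivity
  -- The long direction is controlled by the projections being close, the short one by the height,
  -- at most `2 * ρ * α₂(w) ≤ 2 * ρ * δ` on the box.
  have e1 : ∀ x ∈ coordBox ρ, ∀ y ∈ coordBox ρ,
      dist (coordProj (Φ.projIndex w) x) (coordProj (Φ.projIndex w) y) ≤ 2 * (δ / Φ.alpha₁ w) →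
      dist (Φ.wordMap w x) (Φ.wordMap w y) ≤ 4 * ρ * δ := by
    intro x hx y hy hxy
    refine (dist_le_of_coord (r := 2 * ρ * δ) fun j => ?_).trans (by linarith)
    rcases eq_or_eq_one_sub j (Φ.longIndex w) with rfl | hj
    · rw [Φ.abs_wordMap_sub, ← alpha₁_eq, ← projIndex_eq]
      rw [Real.dist_eq, ← mul_div_assoc, le_div_iff₀ hα, mul_comm] at hxy
      refine hxy.trans ?_
      nlinarith
    · refine (abs_wordMap_sub_le hx hy w j).trans ?_
      rw [hj, ← alpha₂_eq]
      nlinarith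
  have e2 : ∀ x ∈ coordBox ρ, ∀ y ∈ coordBox ρ,
      dist (Φ.wordMap w x) (Φ.wordMap w y) ≤ 2 * δ →
      dist (coordProj (Φ.projIndex w) x) (coordProj (Φ.projIndex w) y) ≤
        4 * ρ * (δ / Φ.alpha₁ w) := by
    intro x _ y _ hxy
    have h1 := (abs_coord_le_dist _ _ (Φ.longIndex w)).trans hxy
    rw [Φ.abs_wordMap_sub, ← alpha₁_eq, ← projIndex_eq] at h1
    rw [Real.dist_eq, ← mul_div_assoc, le_div_iff₀ hα, mul_comm]
    refine h1.trans ?_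
    nlinarith
  constructor
  · refine (h μ _ hρ _ _ δ _ hδ0 hε e1 e2).trans ?_
    gcongr
    · exact le_self_add
    · exact le_rfl
  · refine (h' μ _ hρ _ _ _ δ hε hδ0 e2 e1).trans ?_
    gcongr
    exact le_add_self

/-- The sum of the grid sums of the pieces of a stopping family. -/
def pieceSum (Φ : BoxLikeIFS ι) (q : ℝ) (μ : Measure Plane) (A : Finset (List ι)) (δ : ℝ) : ℝ≥0∞ :=
  ∑ w ∈ A, posPow q (ENNReal.ofReal (Φ.wordProb w)) *
    partSum q μ (Grid.plane.cell δ ∘ Φ.wordMap w)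

/-- A family of words at which the height of the rectangles is comparable to `δ`. -/
def IsCut (Φ : BoxLikeIFS ι) (A : Finset (List ι)) (δ : ℝ) : Prop :=
  (∃ n p, A = stopWords n p) ∧ ∀ w ∈ A, Φ.ratioMin * δ ≤ Φ.alpha₂ w ∧ Φ.alpha₂ w ≤ δ

theorem exists_isCut (Φ : BoxLikeIFS ι) {δ : ℝ} (hδ : 0 < δ) (hδ1 : δ ≤ 1) :
    ∃ A, Φ.IsCut A δ := by
  obtain ⟨n, p, h⟩ := Φ.exists_stopWords_alpha₂ hδ hδ1
  exact ⟨_, ⟨n, p, rfl⟩, h⟩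

theorem ofReal_wordProb_rpow (Φ : BoxLikeIFS ι) (q : ℝ) (w : List ι) :
    posPow q (ENNReal.ofReal (Φ.wordProb w)) = ENNReal.ofReal (Φ.wordProb w ^ q) := by
  have h := Φ.wordProb_pos w
  rw [posPow_of_ne_zero (ENNReal.ofReal_pos.2 h).ne', ENNReal.ofReal_rpow_of_pos h]

theorem div_alpha₁_le {A : Finset (List ι)} {δ : ℝ} (hA : Φ.IsCut A δ) {w : List ι} (hw : w ∈ A) :
    δ / Φ.alpha₁ w ≤ Φ.ratioMin⁻¹ := by
  rw [inv_eq_one_div, div_le_div_iff₀ (Φ.alpha₁_pos w) Φ.ratioMin_pos]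
  linarith [(hA.2 w hw).1, Φ.alpha₂_le_alpha₁ w]

theorem alpha₁_le_one (Φ : BoxLikeIFS ι) (w : List ι) : Φ.alpha₁ w ≤ 1 :=
  Φ.alpha₁_le w (Φ.wordRatio_le_one w)

/-- On a cut `α₂(w)` is comparable to `δ`, so `(δ / α₁)^(-τ_w)` is comparable to `δ^(-s) α₁^(τ_w)
α₂^(s - τ_w)`: each piece contributes about `δ^(-s) ψ^{s,q}(w)`. For `s > γ` the sum of `ψ` over the
cut is bounded. -/
theorem IsSelfAffineMeasure.exists_pieceSum_le (hμ : Φ.IsSelfAffineMeasure μ) {q : ℝ} (hq : 0 ≤ q)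
    {s ε : ℝ} (hs : Φ.gamma μ q < s) (hε : 0 < ε) : ∃ C : ℝ≥0∞, C ≠ ∞ ∧
      ∀ (δ : ℝ) (A : Finset (List ι)), 0 < δ → Φ.IsCut A δ →
        Φ.pieceSum q μ A δ ≤ C * ENNReal.ofReal (δ ^ (-s - ε)) := by
  obtain ⟨τ, hτ, -, hspec, -⟩ := hμ.exists_exponents Φ hq
  obtain ⟨Cs, hCs, hsum⟩ := (hμ.pressure Φ hq).2.2.1 s hs
  obtain ⟨C, hC, hpiece⟩ := hμ.exists_plane_piece_le hq
  have hm := Φ.ratioMin_pos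
  choose D hD hDb using fun j => hτ j Φ.ratioMin⁻¹ ε
    ((one_le_inv₀ hm).2 Φ.ratioMin_lt_one.le) hε
  set E : Fin 2 → ℝ := fun j => D j * Φ.ratioMin ^ (-|s - τ j|) with hE
  have hE0 : ∀ j, 0 ≤ E j := fun j => mul_nonneg (hD j).le (by positivity)
  have hEle : ∀ j, E j ≤ ∑ j, E j := fun j =>
    Finset.single_le_sum (f := E) (fun j _ => hE0 j) (Finset.mem_univ j)
  have hE1 : 0 ≤ ∑ j, E j := Finset.sum_nonneg fun j _ => hE0 j
  refine ⟨C * ENNReal.ofReal ((∑ j, E j) * Cs), ENNReal.mul_ne_top hC ENNReal.ofReal_ne_top,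
    fun δ A hδ hA => ?_⟩
  have hterm : ∀ w ∈ A, posPow q (ENNReal.ofReal (Φ.wordProb w)) *
      partSum q μ (Grid.plane.cell δ ∘ Φ.wordMap w) ≤
      C * ENNReal.ofReal ((∑ j, E j) * δ ^ (-s - ε) * Φ.psi μ s q w) := by
    intro w hw
    have hα := Φ.alpha₁_pos w
    have hα₂ := Φ.alpha₂_pos w
    have hp := Φ.wordProb_pos w
    have hcut := hA.2 w hw
    have h1 := (hpiece w δ hcut.2).1
    have h2 := (hDb (Φ.projIndex w) (δ / Φ.alpha₁ w) (by positivity) (div_alpha₁_le hA hw)).1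
    have hpsi : Φ.psi μ s q w = Φ.wordProb w ^ q * Φ.alpha₁ w ^ τ (Φ.projIndex w) *
        Φ.alpha₂ w ^ (s - τ (Φ.projIndex w)) := by
      rw [psi, wordTau, hspec]
    generalize Φ.projIndex w = j at *
    have h3 : (δ / Φ.alpha₁ w) ^ (-τ j - ε) ≤ Φ.ratioMin ^ (-|s - τ j|) * δ ^ (-s - ε) *
        (Φ.alpha₁ w ^ τ j * Φ.alpha₂ w ^ (s - τ j)) := by
      have h4 := (rpow_le_mul_rpow_of_comparable hm hα₂ hcut.1 hcut.2 (s - τ j)).1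
      calc (δ / Φ.alpha₁ w) ^ (-τ j - ε)
          = δ ^ (-s - ε) * δ ^ (s - τ j) * (Φ.alpha₁ w ^ τ j * Φ.alpha₁ w ^ ε) := by
            rw [Real.div_rpow hδ.le hα.le, div_eq_mul_inv, ← Real.rpow_neg hα.le,
              ← Real.rpow_add hδ, ← Real.rpow_add hα]
            congr 2 <;> ring
        -- The error `α₁(w) ^ ε` is discarded because `α₁(w) ≤ 1`.
        _ ≤ δ ^ (-s - ε) * (Φ.ratioMin ^ (-|s - τ j|) * Φ.alpha₂ w ^ (s - τ j)) *
              (Φ.alpha₁ w ^ τ j * 1) := by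
            gcongr
            exact Real.rpow_le_one hα.le (Φ.alpha₁_le_one w) hε.le
        _ = _ := by ring
    calc _ ≤ ENNReal.ofReal (Φ.wordProb w ^ q) *
          (C * ENNReal.ofReal (D j * (δ / Φ.alpha₁ w) ^ (-τ j - ε))) := by
          rw [ofReal_wordProb_rpow]
          gcongr
          exact h1.trans (by gcongr)
      _ = C * ENNReal.ofReal (Φ.wordProb w ^ q * (D j * (δ / Φ.alpha₁ w) ^ (-τ j - ε))) := by
          rw [ENNReal.ofReal_mul (p := Φ.wordProb w ^ q) (by positivity)]
          ring
      _ ≤ _ := by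
          refine mul_le_mul' le_rfl (ENNReal.ofReal_le_ofReal ?_)
          calc Φ.wordProb w ^ q * (D j * (δ / Φ.alpha₁ w) ^ (-τ j - ε))
              ≤ Φ.wordProb w ^ q * (D j * (Φ.ratioMin ^ (-|s - τ j|) * δ ^ (-s - ε) *
                (Φ.alpha₁ w ^ τ j * Φ.alpha₂ w ^ (s - τ j)))) := by
                have := (hD j).le
                gcongr
            _ = E j * δ ^ (-s - ε) * Φ.psi μ s q w := by rw [hpsi, hE]; ring
            _ ≤ _ := by
                have : 0 ≤ Φ.psi μ s q w := by rw [hpsi]; positivity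
                gcongr
                exact hEle j
  have hpsi0 : ∀ w, 0 ≤ Φ.psi μ s q w := fun w => by
    have := Φ.alpha₁_pos w
    have := Φ.alpha₂_pos w
    have := Φ.wordProb_pos w
    rw [psi]; positivity
  obtain ⟨n, p, rfl⟩ := hA.1
  calc Φ.pieceSum q μ (stopWords n p) δ
      ≤ ∑ w ∈ stopWords n p, C * ENNReal.ofReal ((∑ j, E j) * δ ^ (-s - ε) * Φ.psi μ s q w) :=
        Finset.sum_le_sum hterm
    _ = C * ENNReal.ofReal ((∑ j, E j) * δ ^ (-s - ε) * ∑ w ∈ stopWords n p, Φ.psi μ s q w) := by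
        rw [← Finset.mul_sum, ← ENNReal.ofReal_sum_of_nonneg, ← Finset.mul_sum]
        exact fun w _ => mul_nonneg (by positivity) (hpsi0 w)
    _ ≤ C * ENNReal.ofReal ((∑ j, E j) * δ ^ (-s - ε) * Cs) := by
        gcongr
        exact hsum n p
    _ = _ := by
        rw [mul_assoc C, ← ENNReal.ofReal_mul (by positivity)]
        congr 2; ring

/-- The reverse of the preceding estimate: for `s < γ` the sum of `ψ` over the cut is bounded away
from `0`, and the spectral error `α₁(w) ^ (-ε) ≥ 1` again has the favourable direction. -/
theorem IsSelfAffineMeasure.exists_le_pieceSum (hμ : Φ.IsSelfAffineMeasure μ) {q : ℝ} (hq : 0 ≤ q)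
    {s ε : ℝ} (hs : s < Φ.gamma μ q) (hε : 0 < ε) : ∃ C : ℝ≥0∞, C ≠ ∞ ∧
      ∀ (δ : ℝ) (A : Finset (List ι)), 0 < δ → Φ.IsCut A δ →
        ENNReal.ofReal (δ ^ (-s + ε)) ≤ C * Φ.pieceSum q μ A δ := by
  obtain ⟨τ, hτ, -, hspec, -⟩ := hμ.exists_exponents Φ hq
  obtain ⟨c, hc, hsum⟩ := (hμ.pressure Φ hq).2.2.2 s hs
  obtain ⟨C, hC, hpiece⟩ := hμ.exists_plane_piece_le hq
  have hm := Φ.ratioMin_pos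
  choose D hD hDb using fun j => hτ j Φ.ratioMin⁻¹ ε
    ((one_le_inv₀ hm).2 Φ.ratioMin_lt_one.le) hε
  set E : Fin 2 → ℝ := fun j => Φ.ratioMin ^ (-|s - τ j|) * D j with hE
  have hE0 : ∀ j, 0 ≤ E j := fun j => mul_nonneg (by positivity) (hD j).le
  have hEle : ∀ j, E j ≤ ∑ j, E j := fun j =>
    Finset.single_le_sum (f := E) (fun j _ => hE0 j) (Finset.mem_univ j)
  refine ⟨ENNReal.ofReal c⁻¹ * (ENNReal.ofReal (∑ j, E j) * C),
    ENNReal.mul_ne_top ENNReal.ofReal_ne_top (ENNReal.mul_ne_top ENNReal.ofReal_ne_top hC),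
    fun δ A hδ hA => ?_⟩
  have hterm : ∀ w ∈ A, ENNReal.ofReal (Φ.psi μ s q w * δ ^ (-s + ε)) ≤
      ENNReal.ofReal (∑ j, E j) * C * (posPow q (ENNReal.ofReal (Φ.wordProb w)) *
        partSum q μ (Grid.plane.cell δ ∘ Φ.wordMap w)) := by
    intro w hw
    have hα := Φ.alpha₁_pos w
    have hα₂ := Φ.alpha₂_pos w
    have hp := Φ.wordProb_pos w
    have hcut := hA.2 w hw
    have h1 := (hpiece w δ hcut.2).2
    have h2 := (hDb (Φ.projIndex w) (δ / Φ.alpha₁ w) (by positivity) (div_alpha₁_le hA hw)).2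
    have hpsi : Φ.psi μ s q w = Φ.wordProb w ^ q * (Φ.alpha₁ w ^ τ (Φ.projIndex w) *
        Φ.alpha₂ w ^ (s - τ (Φ.projIndex w))) := by
      rw [psi, wordTau, hspec, mul_assoc]
    generalize Φ.projIndex w = j at *
    have h3 : Φ.alpha₁ w ^ τ j * Φ.alpha₂ w ^ (s - τ j) * δ ^ (-s + ε) ≤
        Φ.ratioMin ^ (-|s - τ j|) * (δ / Φ.alpha₁ w) ^ (-τ j + ε) := by
      have h4 := (rpow_le_mul_rpow_of_comparable hm hα₂ hcut.1 hcut.2 (s - τ j)).2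
      calc Φ.alpha₁ w ^ τ j * Φ.alpha₂ w ^ (s - τ j) * δ ^ (-s + ε)
          ≤ Φ.alpha₁ w ^ τ j * Φ.alpha₁ w ^ (-ε) *
              (Φ.ratioMin ^ (-|s - τ j|) * δ ^ (s - τ j)) * δ ^ (-s + ε) := by
            gcongr
            refine le_mul_of_one_le_right (by positivity) ?_
            exact Real.one_le_rpow_of_pos_of_le_one_of_nonpos hα (Φ.alpha₁_le_one w) (by linarith)
        _ = Φ.ratioMin ^ (-|s - τ j|) * (Φ.alpha₁ w ^ τ j * Φ.alpha₁ w ^ (-ε) *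
              (δ ^ (s - τ j) * δ ^ (-s + ε))) := by ring
        _ = _ := by
            rw [Real.div_rpow hδ.le hα.le, div_eq_mul_inv, ← Real.rpow_neg hα.le,
              ← Real.rpow_add hδ, ← Real.rpow_add hα, mul_comm (δ ^ (-τ j + ε))]
            congr 3 <;> ring
    have hnn : 0 ≤ Φ.ratioMin ^ (-|s - τ j|) := by positivity
    calc ENNReal.ofReal (Φ.psi μ s q w * δ ^ (-s + ε))
        ≤ ENNReal.ofReal (Φ.wordProb w ^ q * (Φ.ratioMin ^ (-|s - τ j|) *
            (δ / Φ.alpha₁ w) ^ (-τ j + ε))) := by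
          refine ENNReal.ofReal_le_ofReal ?_
          rw [hpsi, mul_assoc]
          gcongr
      _ = ENNReal.ofReal (Φ.wordProb w ^ q) * (ENNReal.ofReal (Φ.ratioMin ^ (-|s - τ j|)) *
            ENNReal.ofReal ((δ / Φ.alpha₁ w) ^ (-τ j + ε))) := by
          rw [ENNReal.ofReal_mul (by positivity), ENNReal.ofReal_mul hnn]
      _ ≤ ENNReal.ofReal (Φ.wordProb w ^ q) * (ENNReal.ofReal (Φ.ratioMin ^ (-|s - τ j|)) *
            (ENNReal.ofReal (D j) *
              (C * partSum q μ (Grid.plane.cell δ ∘ Φ.wordMap w)))) := by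
          gcongr
          exact h2.trans (by gcongr)
      _ = ENNReal.ofReal (E j) * C * (ENNReal.ofReal (Φ.wordProb w ^ q) *
            partSum q μ (Grid.plane.cell δ ∘ Φ.wordMap w)) := by
          rw [hE, ENNReal.ofReal_mul hnn]
          ring
      _ ≤ _ := by
          rw [ofReal_wordProb_rpow]
          gcongr
          exact hEle j
  have hpsi0 : ∀ w, 0 ≤ Φ.psi μ s q w := fun w => by
    have := Φ.alpha₁_pos w
    have := Φ.alpha₂_pos w
    have := Φ.wordProb_pos w
    rw [psi]; positivity
  obtain ⟨n, p, rfl⟩ := hA.1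
  calc ENNReal.ofReal (δ ^ (-s + ε))
      ≤ ENNReal.ofReal (c⁻¹ * ∑ w ∈ stopWords n p, Φ.psi μ s q w * δ ^ (-s + ε)) := by
        refine ENNReal.ofReal_le_ofReal ?_
        rw [← Finset.sum_mul, ← mul_assoc]
        refine le_mul_of_one_le_left (by positivity) ?_
        rw [inv_mul_eq_div, one_le_div hc]
        exact hsum n p
    _ = ENNReal.ofReal c⁻¹ * ∑ w ∈ stopWords n p, ENNReal.ofReal (Φ.psi μ s q w * δ ^ (-s + ε)) := by
        rw [ENNReal.ofReal_mul (by positivity), ENNReal.ofReal_sum_of_nonneg]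
        exact fun w _ => mul_nonneg (hpsi0 w) (by positivity)
    _ ≤ ENNReal.ofReal c⁻¹ * ∑ w ∈ stopWords n p, ENNReal.ofReal (∑ j, E j) * C *
          (posPow q (ENNReal.ofReal (Φ.wordProb w)) *
            partSum q μ (Grid.plane.cell δ ∘ Φ.wordMap w)) := by
        gcongr with w hw
        exact hterm w hw
    _ = _ := by rw [← Finset.mul_sum, ← mul_assoc]; rfl

theorem IsSelfAffineMeasure.subExpLE_rpow_gamma (hμ : Φ.IsSelfAffineMeasure μ) {q : ℝ} (hq : 0 ≤ q)
    {C : ℝ≥0∞} (hC : C ≠ ∞) {f : ℝ → ℝ≥0∞}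
    (hf : ∀ (δ : ℝ) (A : Finset (List ι)), 0 < δ → Φ.IsCut A δ → f δ ≤ C * Φ.pieceSum q μ A δ) :
    SubExpLE f fun δ => ENNReal.ofReal (δ ^ (-Φ.gamma μ q)) := by
  intro ε hε
  -- The allowance `ε` is split: `ε / 4` for moving `s` off `γ`, `ε / 4` for the spectra of the
  -- projections, `ε / 2` for the constants.
  obtain ⟨D, hD, h⟩ := hμ.exists_pieceSum_le hq (s := Φ.gamma μ q + ε / 4) (ε := ε / 4)
    (by linarith) (by linarith)
  have h1 : ∀ᶠ δ in 𝓝[>] (0 : ℝ), δ < 1 :=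
    eventually_nhdsWithin_of_eventually_nhds (eventually_lt_nhds one_pos)
  filter_upwards [h1, self_mem_nhdsWithin, eventually_le_ofReal_rpow_neg
    (ENNReal.mul_ne_top hC hD) (half_pos hε)] with δ hδ1 hδ hCδ
  have hpos : (0 : ℝ) < δ := hδ
  obtain ⟨A, hA⟩ := Φ.exists_isCut hpos hδ1.le
  calc f δ ≤ C * (D * ENNReal.ofReal (δ ^ (-(Φ.gamma μ q + ε / 4) - ε / 4))) := by
        refine (hf δ A hpos hA).trans ?_
        gcongr
        exact h δ A hpos hA
    _ ≤ ENNReal.ofReal (δ ^ (-(ε / 2))) *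
          ENNReal.ofReal (δ ^ (-(Φ.gamma μ q + ε / 4) - ε / 4)) := by
        rw [← mul_assoc]
        gcongr
    _ = _ := by
        rw [← ENNReal.ofReal_mul (by positivity), ← ENNReal.ofReal_mul (by positivity),
          ← Real.rpow_add hpos, ← Real.rpow_add hpos]
        congr 2; ring

theorem IsSelfAffineMeasure.rpow_gamma_subExpLE (hμ : Φ.IsSelfAffineMeasure μ) {q : ℝ} (hq : 0 ≤ q)
    {C : ℝ≥0∞} (hC : C ≠ ∞) {f : ℝ → ℝ≥0∞}
    (hf : ∀ (δ : ℝ) (A : Finset (List ι)), 0 < δ → Φ.IsCut A δ → Φ.pieceSum q μ A δ ≤ C * f δ) :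
    SubExpLE (fun δ => ENNReal.ofReal (δ ^ (-Φ.gamma μ q))) f := by
  intro ε hε
  obtain ⟨D, hD, h⟩ := hμ.exists_le_pieceSum hq (s := Φ.gamma μ q - ε / 4) (ε := ε / 4)
    (by linarith) (by linarith)
  have h1 : ∀ᶠ δ in 𝓝[>] (0 : ℝ), δ < 1 :=
    eventually_nhdsWithin_of_eventually_nhds (eventually_lt_nhds one_pos)
  filter_upwards [h1, self_mem_nhdsWithin, eventually_le_ofReal_rpow_neg
    (ENNReal.mul_ne_top hD hC) (half_pos hε)] with δ hδ1 hδ hCδ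
  have hpos : (0 : ℝ) < δ := hδ
  obtain ⟨A, hA⟩ := Φ.exists_isCut hpos hδ1.le
  calc ENNReal.ofReal (δ ^ (-Φ.gamma μ q))
      = ENNReal.ofReal (δ ^ (-(ε / 2))) *
          ENNReal.ofReal (δ ^ (-(Φ.gamma μ q - ε / 4) + ε / 4)) := by
        rw [← ENNReal.ofReal_mul (by positivity), ← Real.rpow_add hpos]
        congr 2; ring
    _ ≤ ENNReal.ofReal (δ ^ (-(ε / 2))) * (D * (C * f δ)) := by
        gcongr
        refine (h δ A hpos hA).trans ?_
        gcongr
        exact hf δ A hpos hA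
    _ ≤ ENNReal.ofReal (δ ^ (-(ε / 2))) * (ENNReal.ofReal (δ ^ (-(ε / 2))) * f δ) := by
        rw [← mul_assoc D]
        gcongr
    _ = _ := by
        rw [← mul_assoc, ← ENNReal.ofReal_mul (by positivity), ← Real.rpow_add hpos]
        congr 3; ring

theorem IsSelfAffineMeasure.gridSum_eq (hμ : Φ.IsSelfAffineMeasure μ) (q : ℝ) (n : ℕ)
    (p : List ι → Prop) (δ : ℝ) : Grid.plane.gridSum q μ δ =
      ∑' k, posPow q (∑ w ∈ stopWords n p, ENNReal.ofReal (Φ.wordProb w) *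
        μ (Φ.wordMap w ⁻¹' (Grid.plane.cell δ ⁻¹' {k}))) := by
  rw [Grid.gridSum, partSum]
  simp only [← hμ.measure_eq_sum_stopWords n p (Grid.plane.measurableSet δ _)]

/-- In this form the sum over pieces has, in each cell, the sum of the powers of those masses whose
sum is raised to the power `q` in the grid sum. The comparison becomes a question about single
cells. -/
theorem pieceSum_eq (Φ : BoxLikeIFS ι) {q : ℝ} (hq : 0 ≤ q) (μ : Measure Plane)
    (A : Finset (List ι)) (δ : ℝ) : Φ.pieceSum q μ A δ =
      ∑' k, ∑ w ∈ A, posPow q (ENNReal.ofReal (Φ.wordProb w) *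
        μ (Φ.wordMap w ⁻¹' (Grid.plane.cell δ ⁻¹' {k}))) := by
  rw [Summable.tsum_finsetSum fun _ _ => ENNReal.summable, pieceSum]
  refine Finset.sum_congr rfl fun w _ => ?_
  rw [partSum, ← ENNReal.tsum_mul_left]
  simp only [posPow_mul hq]
  rfl

theorem IsSelfAffineMeasure.gridSum_subExpLE_of_le_one (hμ : Φ.IsSelfAffineMeasure μ) {q : ℝ}
    (hq : 0 ≤ q) (hq1 : q ≤ 1) :
    SubExpLE (Grid.plane.gridSum q μ) fun δ => ENNReal.ofReal (δ ^ (-Φ.gamma μ q)) := by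
  refine hμ.subExpLE_rpow_gamma hq ENNReal.one_ne_top fun δ A hδ hA => ?_
  obtain ⟨n, p, rfl⟩ := hA.1
  rw [one_mul, hμ.gridSum_eq q n p, pieceSum_eq Φ hq]
  exact ENNReal.tsum_le_tsum fun k => posPow_sum_le hq hq1 _ _

theorem IsSelfAffineMeasure.subExpLE_gridSum_of_one_le (hμ : Φ.IsSelfAffineMeasure μ) {q : ℝ}
    (hq1 : 1 ≤ q) :
    SubExpLE (fun δ => ENNReal.ofReal (δ ^ (-Φ.gamma μ q))) (Grid.plane.gridSum q μ) := by
  have hq : 0 ≤ q := by linarith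
  refine hμ.rpow_gamma_subExpLE hq ENNReal.one_ne_top fun δ A hδ hA => ?_
  obtain ⟨n, p, rfl⟩ := hA.1
  rw [one_mul, hμ.gridSum_eq q n p, pieceSum_eq Φ hq]
  exact ENNReal.tsum_le_tsum fun k => sum_posPow_le hq1 _ _

end BoxLikeIFS

/-! ### The rectangular open set condition -/

theorem exists_clamp {a b x η : ℝ} (hη : 0 ≤ η) (hab : 2 * η ≤ b - a) (hx : x ∈ Icc a b) :
    ∃ y, y ∈ Icc (a + η) (b - η) ∧ |x - y| ≤ η := by
  refine ⟨max (a + η) (min x (b - η)), ⟨le_max_left _ _, max_le (by linarith) (min_le_right _ _)⟩, ?_⟩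
  rw [abs_le]
  rcases le_total x (b - η) with h | h
  · rw [min_eq_left h]
    rcases le_total x (a + η) with h' | h'
    · rw [max_eq_left h']; constructor <;> linarith [hx.1]
    · rw [max_eq_right h']; constructor <;> linarith
  · rw [min_eq_right h, max_eq_right (by linarith)]; constructor <;> linarith [hx.2]

/-- The open box with the given opposite vertices. -/
def openBox (lo hi : Fin 2 → ℝ) : Set Plane := {x | ∀ j, x j ∈ Ioo (lo j) (hi j)}

/-- The closed box with the given opposite vertices. -/
def closedBox (lo hi : Fin 2 → ℝ) : Set Plane := {x | ∀ j, x j ∈ Icc (lo j) (hi j)}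

theorem isClosed_closedBox (lo hi : Fin 2 → ℝ) : IsClosed (closedBox lo hi) := by
  have : closedBox lo hi = ⋂ j, (fun x : Plane => x j) ⁻¹' Icc (lo j) (hi j) := by
    ext x; simp [closedBox]
  rw [this]
  exact isClosed_iInter fun j => isClosed_Icc.preimage (by fun_prop)

/-- A point of a closed box can be moved by `η j` in the direction `j` to have distance at least
`η j` from the sides orthogonal to it. -/
theorem exists_inner_point {lo hi η : Fin 2 → ℝ} (hη : ∀ j, 0 ≤ η j)
    (hle : ∀ j, 2 * η j ≤ hi j - lo j) {x : Plane} (hx : x ∈ closedBox lo hi) :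
    ∃ y : Plane, ∀ j, y j ∈ Icc (lo j + η j) (hi j - η j) ∧ |x j - y j| ≤ η j := by
  choose y hy using fun j => exists_clamp (hη j) (hle j) (hx j)
  exact ⟨WithLp.toLp 2 y, hy⟩

theorem exists_inradius {lo hi : Fin 2 → ℝ} (hlt : ∀ j, lo j < hi j) :
    ∃ m : ℝ, 0 < m ∧ ∀ j, 2 * m ≤ hi j - lo j := by
  obtain ⟨j, hj⟩ := Finite.exists_min fun j => hi j - lo j
  exact ⟨(hi j - lo j) / 2, by linarith [hlt j], fun l => by linarith [hj l]⟩

namespace BoxLikeIFS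

variable {ι : Type*} [Fintype ι] {Φ : BoxLikeIFS ι} {μ : Measure Plane}

theorem wordMap_injective (Φ : BoxLikeIFS ι) (w : List ι) : Function.Injective (Φ.wordMap w) := by
  intro x y hxy
  have h : ∀ j, x (Φ.wordPerm w j) = y (Φ.wordPerm w j) := by
    intro j
    have h1 := Φ.abs_wordMap_sub w x y j
    rw [hxy, sub_self, abs_zero, eq_comm, mul_eq_zero] at h1
    exact sub_eq_zero.1 (abs_eq_zero.1 (h1.resolve_left (Φ.wordRatio_pos w j).ne'))
  ext l
  have := h (Φ.wordPerm w l)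
  rwa [wordPerm_wordPerm] at this

theorem ROSC.exists_openBox (h : Φ.ROSC) : ∃ lo hi : Fin 2 → ℝ, (∀ j, lo j < hi j) ∧
    (∀ i, Φ.S i '' openBox lo hi ⊆ openBox lo hi) ∧
    Pairwise fun i j => Disjoint (Φ.S i '' openBox lo hi) (Φ.S j '' openBox lo hi) := by
  obtain ⟨a, b, c, d, hab, hcd, h1, h2⟩ := h
  have e : openBox ![a, c] ![b, d] = {x : Plane | x 0 ∈ Ioo a b ∧ x 1 ∈ Ioo c d} := by
    ext x; simp [openBox, Fin.forall_fin_two]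
  refine ⟨![a, c], ![b, d], by simp [Fin.forall_fin_two, hab, hcd], ?_⟩
  rw [e]
  exact ⟨h1, h2⟩

section Box

variable {lo hi : Fin 2 → ℝ}

theorem wordMap_image_openBox_subset (hinv : ∀ i, Φ.S i '' openBox lo hi ⊆ openBox lo hi)
    (w : List ι) : Φ.wordMap w '' openBox lo hi ⊆ openBox lo hi := by
  induction w with
  | nil => rw [show Φ.wordMap [] = id from rfl, image_id]
  | cons i w ih =>
    rw [show Φ.wordMap (i :: w) = Φ.S i ∘ Φ.wordMap w from rfl, image_comp]
    exact (image_mono ih).trans (hinv i)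

/-- The full-measure criterion needs a closed invariant set. A point of the closed box can be moved
into the open one by an arbitrarily small amount, which the map does not enlarge. -/
theorem S_image_closedBox_subset (hlt : ∀ j, lo j < hi j)
    (hinv : ∀ i, Φ.S i '' openBox lo hi ⊆ openBox lo hi) (i : ι) :
    Φ.S i '' closedBox lo hi ⊆ closedBox lo hi := by
  rintro _ ⟨x, hx, rfl⟩ j
  obtain ⟨m, hm0, hmle⟩ := exists_inradius hlt
  have key : ∀ ε : ℝ, 0 < ε → lo j ≤ Φ.S i x j + ε ∧ Φ.S i x j ≤ hi j + ε := by
    intro ε hε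
    have hη : 0 < min ε m := lt_min hε hm0
    obtain ⟨y, hy⟩ := exists_inner_point (η := fun _ => min ε m) (fun _ => hη.le)
      (fun l => (mul_le_mul_of_nonneg_left (min_le_right ε m) zero_le_two).trans (hmle l)) hx
    have hyb : y ∈ openBox lo hi := fun l => ⟨by linarith [(hy l).1.1], by linarith [(hy l).1.2]⟩
    have h1 := hinv i ⟨y, hyb, rfl⟩ j
    have h2 := Φ.abs_wordMap_sub [i] x y j
    have h3 : |Φ.S i x j - Φ.S i y j| ≤ ε := by
      rw [wordMap_singleton] at h2
      rw [h2]
      calc _ ≤ 1 * |x (Φ.wordPerm [i] j) - y (Φ.wordPerm [i] j)| :=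
            mul_le_mul_of_nonneg_right (Φ.wordRatio_le_one _ _) (abs_nonneg _)
        _ ≤ ε := by rw [one_mul]; exact (hy _).2.trans (min_le_left _ _)
    have h4 := abs_le.1 h3
    constructor
    · linarith [h1.1, h4.1]
    · linarith [h1.2, h4.2]
  exact ⟨le_of_forall_pos_le_add fun ε hε => (key ε hε).1,
    le_of_forall_pos_le_add fun ε hε => (key ε hε).2⟩

/-- The two words branch at a common prefix. The images are disjoint at the branching letters, the
remaining letters stay inside by invariance, and the injective map of the prefix preserves
disjointness. -/
theorem disjoint_wordMap_image (hinv : ∀ i, Φ.S i '' openBox lo hi ⊆ openBox lo hi)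
    (hdisj : Pairwise fun i j => Disjoint (Φ.S i '' openBox lo hi) (Φ.S j '' openBox lo hi))
    {n : ℕ} {p : List ι → Prop} {u v : List ι} (hu : u ∈ stopWords n p) (hv : v ∈ stopWords n p)
    (huv : u ≠ v) : Disjoint (Φ.wordMap u '' openBox lo hi) (Φ.wordMap v '' openBox lo hi) := by
  obtain ⟨t, i, j, u', v', hij, rfl, rfl⟩ := stopWords_pairwise hu hv huv
  have hsub : ∀ k (w : List ι), Φ.wordMap (t ++ k :: w) '' openBox lo hi ⊆
      Φ.wordMap t '' (Φ.S k '' openBox lo hi) := by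
    intro k w
    rw [wordMap_append, image_comp, show Φ.wordMap (k :: w) = Φ.S k ∘ Φ.wordMap w from rfl,
      image_comp]
    exact image_mono (image_mono (wordMap_image_openBox_subset hinv w))
  exact ((disjoint_image_iff (Φ.wordMap_injective t)).2 (hdisj hij)).mono (hsub i u') (hsub j v')

/-- Near every point of `S_w` of the closed box there is a ball inside `S_w` of the open box, of
radius comparable to the height of `S_w`. -/
theorem exists_ball_subset_wordMap_image {m : ℝ} (hmle : ∀ j, 2 * m ≤ hi j - lo j)
    (w : List ι) {r : ℝ} (hr : 0 ≤ r) (hrw : ∀ j, r ≤ Φ.wordRatio w j * m) {x : Plane}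
    (hx : x ∈ closedBox lo hi) : ∃ y : Plane, (∀ j, |Φ.wordMap w x j - y j| ≤ r) ∧
      ∀ z : Plane, (∀ j, |z j - y j| < r) → z ∈ Φ.wordMap w '' openBox lo hi := by
  have hpos := fun j => Φ.wordRatio_pos w j
  -- The displacement in the source that `S_w` turns into exactly `r` in every target coordinate.
  set η : Fin 2 → ℝ := fun l => r / Φ.wordRatio w (Φ.wordPerm w l) with hη
  have hηm : ∀ l, η l ≤ m := fun l => by
    rw [hη, div_le_iff₀ (hpos _), mul_comm]; exact hrw _
  have hησ : ∀ j, Φ.wordRatio w j * η (Φ.wordPerm w j) = r := fun j => by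
    rw [hη]
    simp only [wordPerm_wordPerm]
    exact mul_div_cancel₀ _ (hpos j).ne'
  obtain ⟨y, hy⟩ := exists_inner_point (fun l => div_nonneg hr (hpos _).le)
    (fun l => (mul_le_mul_of_nonneg_left (hηm l) zero_le_two).trans (hmle l)) hx
  refine ⟨Φ.wordMap w y, fun j => ?_, fun z hz => ?_⟩
  · rw [Φ.abs_wordMap_sub, ← hησ j]
    exact mul_le_mul_of_nonneg_left (hy _).2 (hpos j).le
  · obtain ⟨z, rfl⟩ := Φ.wordMap_surjective w z
    refine ⟨z, fun l => ?_, rfl⟩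
    have h1 := hz (Φ.wordPerm w l)
    rw [Φ.abs_wordMap_sub, ← hησ (Φ.wordPerm w l), wordPerm_wordPerm,
      mul_lt_mul_iff_right₀ (hpos _)] at h1
    have h2 := abs_lt.1 h1
    have h3 := (hy l).1
    exact ⟨by linarith [h3.1], by linarith [h3.2]⟩

end Box

/-- Each piece charging the cell `k` contains, near that cell, a coordinate square of size
comparable to `δ` inside its image of the open box. These images are disjoint by the ROSC, so only
boundedly many fit around one cell. -/
theorem IsSelfAffineMeasure.exists_card_le (hμ : Φ.IsSelfAffineMeasure μ) (hR : Φ.ROSC) :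
    ∃ N : ℕ, ∀ (δ : ℝ) (A : Finset (List ι)), 0 < δ → Φ.IsCut A δ → ∀ (k : Grid.plane.K)
      (W : Finset (List ι)), W ⊆ A →
      (∀ w ∈ W, μ (Φ.wordMap w ⁻¹' (Grid.plane.cell δ ⁻¹' {k})) ≠ 0) → W.card ≤ N := by
  obtain ⟨lo, hi, hlt, hinv, hdisj⟩ := hR.exists_openBox
  obtain ⟨m, hm0, hmle⟩ := exists_inradius hlt
  have hfull : μ (closedBox lo hi)ᶜ = 0 := by
    refine hμ.measure_compl_of_invariant (isClosed_closedBox lo hi)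
      ⟨WithLp.toLp 2 lo, fun j => ⟨le_rfl, (hlt j).le⟩⟩ (S_image_closedBox_subset hlt hinv)
  set c := Φ.ratioMin * m with hc
  have hc0 : 0 < c := mul_pos Φ.ratioMin_pos hm0
  -- The centres lie within `(2 * c + 2 + 2 * c) * δ` of each other and fall into distinct cells of
  -- size `c * δ / 4`; the constant is the quotient of the two lengths.
  obtain ⟨N, hN⟩ := Grid.plane.exists_encard_image_le ((4 * c + 2) * (4 / c))
  refine ⟨N, fun δ A hδ hA k W hWA hW => ?_⟩
  have hr : 0 < c * δ := mul_pos hc0 hδ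
  have hex : ∀ w ∈ W, ∃ y : Plane, (∃ x, Grid.plane.cell δ x = k ∧ dist x y ≤ 2 * (c * δ)) ∧
      ∀ z : Plane, (∀ j, |z j - y j| < c * δ) → z ∈ Φ.wordMap w '' openBox lo hi := by
    intro w hw
    obtain ⟨x, hx, hxk⟩ : ∃ x ∈ closedBox lo hi, Grid.plane.cell δ (Φ.wordMap w x) = k := by
      by_contra! hcon
      exact hW w hw (preimage_eq_zero_of_forall hfull hcon)
    obtain ⟨y, hy1, hy2⟩ := exists_ball_subset_wordMap_image (Φ := Φ) hmle w hr.le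
      (fun j => by
        have := (hA.2 w (hWA hw)).1.trans (Φ.alpha₂_le w j)
        have := mul_le_mul_of_nonneg_right this hm0.le
        linarith) hx
    exact ⟨y, ⟨_, hxk, dist_le_of_coord hy1⟩, hy2⟩
  choose! y hy1 hy2 using hex
  have hinj : InjOn (fun w => Grid.plane.cell (c * δ / 4) (y w)) W := by
    intro u hu v hv huv
    by_contra hne
    have hd : dist (y u) (y v) < c * δ :=
      (Grid.plane.dist_le _ (by positivity) _ _ huv).trans_lt (by linarith)
    have h1 := hy2 u hu (y u) fun j => by rw [sub_self, abs_zero]; exact hr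
    have h2 := hy2 v hv (y u) fun j => (abs_coord_le_dist _ _ j).trans_lt hd
    obtain ⟨n, p, hnp⟩ := hA.1
    exact Set.disjoint_left.1 (disjoint_wordMap_image hinv hdisj (hnp ▸ hWA hu) (hnp ▸ hWA hv) hne)
      h1 h2
  have h3 := hN (c * δ / 4) (by positivity) (y '' W) (by
    rintro _ ⟨u, hu, rfl⟩ _ ⟨v, hv, rfl⟩
    obtain ⟨x, hx, hxu⟩ := hy1 u hu
    obtain ⟨x', hx', hxv⟩ := hy1 v hv
    have h4 := Grid.plane.dist_le δ hδ x x' (hx.trans hx'.symm)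
    have h5 := dist_triangle4 (y u) x x' (y v)
    rw [dist_comm (y u) x] at h5
    have e : (4 * c + 2) * (4 / c) * (c * δ / 4) = (4 * c + 2) * δ := by field_simp
    rw [e]
    linarith)
  rw [image_image, hinj.encard_image, encard_coe_eq_coe_finsetCard] at h3
  exact_mod_cast h3

/-- The same small set `W` must serve both the sum of the masses and the sum of their powers, hence
the arbitrary `g` with `g 0 = 0`. -/
theorem IsSelfAffineMeasure.exists_sum_filter (hμ : Φ.IsSelfAffineMeasure μ) (hR : Φ.ROSC) :
    ∃ N : ℕ, ∀ (δ : ℝ) (A : Finset (List ι)), 0 < δ → Φ.IsCut A δ → ∀ k : Grid.plane.K,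
      ∃ W : Finset (List ι), W.card ≤ N ∧ ∀ g : ℝ≥0∞ → ℝ≥0∞, g 0 = 0 →
        ∑ w ∈ A, g (ENNReal.ofReal (Φ.wordProb w) *
          μ (Φ.wordMap w ⁻¹' (Grid.plane.cell δ ⁻¹' {k}))) =
        ∑ w ∈ W, g (ENNReal.ofReal (Φ.wordProb w) *
          μ (Φ.wordMap w ⁻¹' (Grid.plane.cell δ ⁻¹' {k}))) := by
  classical
  obtain ⟨N, hN⟩ := hμ.exists_card_le hR
  refine ⟨N, fun δ A hδ hA k => ⟨A.filter fun w =>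
    μ (Φ.wordMap w ⁻¹' (Grid.plane.cell δ ⁻¹' {k})) ≠ 0, ?_, fun g hg => ?_⟩⟩
  · exact hN δ A hδ hA k _ (Finset.filter_subset _ _) fun w hw => (Finset.mem_filter.1 hw).2
  · refine (Finset.sum_subset (Finset.filter_subset _ _) fun w hw hw' => ?_).symm
    have h0 : μ (Φ.wordMap w ⁻¹' (Grid.plane.cell δ ⁻¹' {k})) = 0 := by
      by_contra h0
      exact hw' (Finset.mem_filter.2 ⟨hw, h0⟩)
    rw [h0, mul_zero, hg]

theorem IsSelfAffineMeasure.gridSum_subExpLE_of_rosc (hμ : Φ.IsSelfAffineMeasure μ) (hR : Φ.ROSC)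
    {q : ℝ} (hq : 0 ≤ q) :
    SubExpLE (Grid.plane.gridSum q μ) fun δ => ENNReal.ofReal (δ ^ (-Φ.gamma μ q)) := by
  obtain ⟨N, hN⟩ := hμ.exists_sum_filter hR
  refine hμ.subExpLE_rpow_gamma hq (C := (N : ℝ≥0∞) ^ q)
    (ENNReal.rpow_ne_top_of_nonneg hq (by simp)) fun δ A hδ hA => ?_
  have hN' := hN δ A hδ hA
  obtain ⟨n, p, rfl⟩ := hA.1
  rw [hμ.gridSum_eq q n p, pieceSum_eq Φ hq, ← ENNReal.tsum_mul_left]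
  refine ENNReal.tsum_le_tsum fun k => ?_
  obtain ⟨W, hWN, hW⟩ := hN' k
  have h1 := hW id rfl
  simp only [id] at h1
  rw [h1, hW (posPow q) (posPow_zero q)]
  refine (posPow_sum_le_card hq W _).trans ?_
  gcongr

theorem IsSelfAffineMeasure.subExpLE_gridSum_of_rosc (hμ : Φ.IsSelfAffineMeasure μ) (hR : Φ.ROSC)
    {q : ℝ} (hq : 0 ≤ q) :
    SubExpLE (fun δ => ENNReal.ofReal (δ ^ (-Φ.gamma μ q))) (Grid.plane.gridSum q μ) := by
  obtain ⟨N, hN⟩ := hμ.exists_sum_filter hR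
  refine hμ.rpow_gamma_subExpLE hq (C := (N : ℝ≥0∞)) (by simp) fun δ A hδ hA => ?_
  have hN' := hN δ A hδ hA
  obtain ⟨n, p, rfl⟩ := hA.1
  rw [hμ.gridSum_eq q n p, pieceSum_eq Φ hq, ← ENNReal.tsum_mul_left]
  refine ENNReal.tsum_le_tsum fun k => ?_
  obtain ⟨W, hWN, hW⟩ := hN' k
  have h1 := hW id rfl
  simp only [id] at h1
  rw [h1, hW (posPow q) (posPow_zero q)]
  refine (sum_posPow_le_card hq W _).trans ?_
  gcongr

/-! ### Comparison of the multifractal quantities of the measure with its grid sums -/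

theorem IsSelfAffineMeasure.lqIntegral_equiv (hμ : Φ.IsSelfAffineMeasure μ) {q : ℝ} (hq : 0 ≤ q) :
    SubExpLE (lqIntegral μ q) (Grid.plane.gridSum q μ) ∧
      SubExpLE (Grid.plane.gridSum q μ) (lqIntegral μ q) := by
  have := hμ.isProbabilityMeasure
  have hν : μ μ.supportᶜ = 0 := Measure.measure_compl_support
  rcases le_total q 1 with hq1 | hq1
  · obtain ⟨c, A, hc, hA, hmass⟩ := hμ.exists_mass_lower_bound measurable_id fun x y => le_rfl
    rw [Measure.map_id] at hmass
    exact ⟨Grid.plane.lqIntegral_subExpLE_of_le_one hq hq1 μ hν,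
      Grid.gridSum_subExpLE_lqIntegral_of_le_one _ hq hq1 μ hν hc hA hmass⟩
  · exact ⟨Grid.plane.lqIntegral_subExpLE_of_one_le hq1 μ hν,
      Grid.plane.gridSum_subExpLE_lqIntegral_of_one_le hq1 μ hν⟩

theorem packingSum_equiv (μ : Measure Plane) {q : ℝ} (hq : 0 ≤ q) :
    SubExpLE (packingSum μ q) (Grid.plane.gridSum q μ) ∧
      SubExpLE (Grid.plane.gridSum q μ) (packingSum μ q) :=
  ⟨Grid.plane.packingSum_subExpLE hq μ,
    Grid.plane.gridSum_subExpLE_packingSum hq μ Measure.measure_compl_support⟩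

end BoxLikeIFS

end


/-- The first three conjuncts say that the objects entering the definition of `γ` are well defined:
the `L^q`-spectra of the two projections of `μ` exist and are finite, the limit defining `P` exists,
and `γ(q)` is the unique solution `s` of `P(s,q) = 1`. -/
theorem theorem2p6 {ι : Type*} [Fintype ι] (Φ : BoxLikeIFS ι) (μ : Measure Plane)
    (hμ : Φ.IsSelfAffineMeasure μ) :
    (∀ j : Fin 2, ∀ q : ℝ, 0 ≤ q →
      lowerLqSpectrum (μ.map (coordProj j)) q = (lqSpectrum (μ.map (coordProj j)) q : EReal) ∧
      upperLqSpectrum (μ.map (coordProj j)) q = (lqSpectrum (μ.map (coordProj j)) q : EReal)) ∧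
    (∀ s q : ℝ, 0 ≤ q →
      Tendsto (fun k : ℕ => Φ.Psi μ k s q ^ (1 / (k : ℝ))) atTop (𝓝 (Φ.P μ s q))) ∧
    (∀ q : ℝ, 0 ≤ q → ∀ s : ℝ, Φ.P μ s q = 1 ↔ s = Φ.gamma μ q) ∧
    (∀ q ∈ Icc (0 : ℝ) 1,
      upperCoveringDim μ q = upperPackingDim μ q ∧
      upperPackingDim μ q = upperLqSpectrum μ q ∧
      upperLqSpectrum μ q ≤ (Φ.gamma μ q : EReal)) ∧
    (∀ q : ℝ, 1 ≤ q →
      (Φ.gamma μ q : EReal) ≤ lowerPackingDim μ q ∧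
      lowerPackingDim μ q = lowerLqSpectrum μ q) ∧
    (Φ.ROSC → ∀ q : ℝ, 0 ≤ q →
      lowerPackingDim μ q = (Φ.gamma μ q : EReal) ∧
      upperPackingDim μ q = (Φ.gamma μ q : EReal) ∧
      lowerLqSpectrum μ q = (Φ.gamma μ q : EReal) ∧
      upperLqSpectrum μ q = (Φ.gamma μ q : EReal)) := by
  have hpack : ∀ q : ℝ, 0 ≤ q →
      lowerPackingDim μ q = lowerExponent (Grid.plane.gridSum q μ) ∧
      upperPackingDim μ q = upperExponent (Grid.plane.gridSum q μ) := fun q hq => by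
    obtain ⟨h1, h2⟩ := BoxLikeIFS.packingSum_equiv μ hq
    exact ⟨le_antisymm h1.lowerExponent_le h2.lowerExponent_le,
      le_antisymm h1.upperExponent_le h2.upperExponent_le⟩
  have hlq : ∀ q : ℝ, 0 ≤ q →
      lowerLqSpectrum μ q = lowerExponent (Grid.plane.gridSum q μ) ∧
      upperLqSpectrum μ q = upperExponent (Grid.plane.gridSum q μ) := fun q hq => by
    obtain ⟨h1, h2⟩ := hμ.lqIntegral_equiv hq
    exact ⟨le_antisymm h1.lowerExponent_le h2.lowerExponent_le,
      le_antisymm h1.upperExponent_le h2.upperExponent_le⟩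
  refine ⟨fun j q hq => ?_, fun s q hq => (hμ.pressure Φ hq).1 s,
    fun q hq s => (hμ.pressure Φ hq).2.1 s, fun q hq => ?_, fun q hq => ?_, fun hR q hq => ?_⟩
  · obtain ⟨τ, hτ, -, hspec, -⟩ := hμ.exists_exponents Φ hq
    rw [hspec]
    exact hμ.lqSpectrum_coordProj Φ hq (hτ j)
  · obtain ⟨hq0, hq1⟩ := hq
    refine ⟨?_, ?_, ?_⟩
    · rw [(hpack q hq0).2]
      exact le_antisymm (Grid.plane.coveringSum_subExpLE hq0 μ).upperExponent_le
        (Grid.plane.gridSum_subExpLE_coveringSum hq0 hq1 μ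
          Measure.measure_compl_support).upperExponent_le
    · rw [(hpack q hq0).2, (hlq q hq0).2]
    · rw [(hlq q hq0).2]
      exact (hμ.gridSum_subExpLE_of_le_one hq0 hq1).upperExponent_le.trans
        (upperExponent_rpow _).le
  · have hq0 : 0 ≤ q := by linarith
    rw [(hpack q hq0).1, (hlq q hq0).1]
    exact ⟨(lowerExponent_rpow _).ge.trans (hμ.subExpLE_gridSum_of_one_le hq).lowerExponent_le, rfl⟩
  · have h1 := hμ.gridSum_subExpLE_of_rosc hR hq
    have h2 := hμ.subExpLE_gridSum_of_rosc hR hq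
    have hl : lowerExponent (Grid.plane.gridSum q μ) = (Φ.gamma μ q : EReal) :=
      le_antisymm (h1.lowerExponent_le.trans (lowerExponent_rpow _).le)
        ((lowerExponent_rpow _).ge.trans h2.lowerExponent_le)
    have hu : upperExponent (Grid.plane.gridSum q μ) = (Φ.gamma μ q : EReal) :=
      le_antisymm (h1.upperExponent_le.trans (upperExponent_rpow _).le)
        ((upperExponent_rpow _).ge.trans h2.upperExponent_le)
    exact ⟨(hpack q hq).1.trans hl, (hpack q hq).2.trans hu, (hlq q hq).1.trans hl,
      (hlq q hq).2.trans hu⟩
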